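/- Let $\beta>0$ and let $m,n\ge 1$ be integers. For $\alpha>0$ let $\chi_\alpha$ be the distribution on $(0,\infty)$ with density $\frac{1}{2^{\alpha/2-1}\Gamma(\alpha/2)}x^{\alpha-1}e^{-x^2/2}$. Put $N=2m$ if $m\le n$ and $N=2n+1$ if $m\ge n+1$. Let $\mathcal J$ be a random matrix from the chiral Gaussian $\beta$-ensemble, that is, the $N\times N$ real symmetric tridiagonal matrix with zero diagonal and off-diagonal entries $a_1,\dots,a_{N-1}$, where the $a_k$ are independent, $a_{2j-1}\sim\chi_{\beta(n-j+1)}$ and $a_{2j}\sim\chi_{\beta(m-j)}$. Its spectral measure $\mu$ is the probability measure on $\mathbb R$ with $\langle e_1,\mathcal J^k e_1\rangle=\int x^k\,d\mu(x)$ for all integers $k\ge 0$. Let $a=|n-m|+1-2/\beta$ and $$h_{\beta,s,a}=2^{s(a\beta/2+1+(s-1)\beta/2)}\prod_{j=1}^s\frac{\Gamma(1+\beta j/2)\,\Gamma(1+\beta a/2+\beta(j-1)/2)}{\Gamma(1+\beta/2)} .$$ (i) If $m\le n$, then with probability $1$ $$\mu=\sum_{j=1}^m \tfrac12 w_j(\delta_{\lambda_j}+\delta_{-\lambda_j}),$$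 with distinct $\lambda_j>0$ and with $w_j>0$, $\sum_{j=1}^m w_j=1$. When the pairs $(\lambda_j,w_j)$ are listed in uniformly random order (independent of $\mathcal J$), the joint law of $\lambda_1,\dots,\lambda_m,w_1,\dots,w_{m-1}$ is $$\frac{2^m}{h_{\beta,m,a}}\prod_{j=1}^m\lambda_j^{\beta a+1}e^{-\lambda_j^2/2}\prod_{1\le j<k\le m}|\lambda_k^2-\lambda_j^2|^\beta\,d\lambda_1\cdots d\lambda_m\times\frac{\Gamma(\beta m/2)}{\Gamma(\beta/2)^m}\prod_{j=1}^m w_j^{\beta/2-1}\,dw_1\cdots dw_{m-1}$$ on $\{\lambda_j>0\ (1\le j\le m)\}\times\{w_j>0\ (1\le j\le m)\}$, where $w_m=1-\sum_{j=1}^{m-1}w_j$. (ii) If $m\ge n+1$, then with probability $1$ $$\mu=w_0\delta_0+\sum_{j=1}^n \tfrac12 w_j(\delta_{\lambda_j}+\delta_{-\lambda_j}),$$ with distinct $\lambda_j>0$ and with $w_0>0$, $w_j>0$, $w_0+\sum_{j=1}^n w_j=1$. When the pairs $(\lambda_j,w_j)$, $1\le j\le n$, are listed in uniformly random order (independent of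 $\mathcal J$), the joint law of $\lambda_1,\dots,\lambda_n,w_1,\dots,w_n$ is $$\frac{2^n}{h_{\beta,n,a}}\prod_{j=1}^n\lambda_j^{\beta a+1}e^{-\lambda_j^2/2}\prod_{1\le j<k\le n}|\lambda_k^2-\lambda_j^2|^\beta\,d\lambda_1\cdots d\lambda_n\times\frac{\Gamma(\beta m/2)}{\Gamma(\beta/2)^n\,\Gamma(\beta(m-n)/2)}\,w_0^{\beta(m-n)/2-1}\prod_{j=1}^n w_j^{\beta/2-1}\,dw_1\cdots dw_n$$ on $\{\lambda_j>0\ (1\le j\le n)\}\times\{w_j>0\ (0\le j\le n)\}$, where $w_0=1-\sum_{j=1}^n w_j$. -/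

import Mathlib

open MeasureTheory ProbabilityTheory
open scoped ENNReal

noncomputable section

/-- The density of the chi distribution with parameter `α > 0`. -/
def chiPDF (α x : ℝ) : ℝ :=
  if 0 < x then
    1 / ((2 : ℝ) ^ (α / 2 - 1) * Real.Gamma (α / 2)) * x ^ (α - 1) * Real.exp (-x ^ 2 / 2)
  else 0

/-- The chi distribution with parameter `α > 0`, as a measure on `ℝ`. -/
def chiMeasure (α : ℝ) : Measure ℝ :=
  volume.withDensity fun x => ENNReal.ofReal (chiPDF α x)

/-- The `N × N` Jacobi matrix with zero diagonal and off-diagonal entries `a₁, …, a_{N-1}`;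
the entry `a_{k+1}` is stored as `a k`. -/
def zeroDiagJacobi {N : ℕ} (a : Fin (N - 1) → ℝ) : Matrix (Fin N) (Fin N) ℝ :=
  Matrix.of fun i j =>
    if h : (i : ℕ) + 1 = (j : ℕ) then a ⟨i, by omega⟩
    else if h' : (j : ℕ) + 1 = (i : ℕ) then a ⟨j, by omega⟩
    else 0

/-- The size of the Jacobi matrix: `2m` if `m ≤ n`, and `2n + 1` if `m ≥ n + 1`. -/
def chiralSize (m n : ℕ) : ℕ := if m ≤ n then 2 * m else 2 * n + 1

/-- The chi parameter of the entry stored at the zero-based index `k`, that is of `a_{k+1}`: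
`a_{2j-1} = x_j` (so `k = 2(j-1)`) has parameter `β (n - j + 1)`, and
`a_{2j} = y_j` (so `k = 2(j-1) + 1`) has parameter `β (m - j)`. -/
def chiralParam (β : ℝ) (m n k : ℕ) : ℝ :=
  if Even k then β * ((n : ℝ) - ((k / 2 : ℕ) : ℝ))
  else β * ((m : ℝ) - (((k / 2 : ℕ) : ℝ) + 1))

/-- The random matrix `J` belongs to the chiral Gaussian `β`-ensemble with parameters `m`, `n`:
it has size `chiralSize m n`, and almost surely it is the Jacobi matrix with zero diagonal
whose off-diagonal entries are independent chi variables with parameters `chiralParam β m n`. -/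
def IsChiralGaussianBetaEnsemble {Ω : Type*} [MeasurableSpace Ω] (P : Measure Ω)
    (β : ℝ) (m n : ℕ) {N : ℕ} (J : Ω → Matrix (Fin N) (Fin N) ℝ) : Prop :=
  N = chiralSize m n ∧
  ∃ a : Fin (N - 1) → Ω → ℝ,
    (∀ k, HasLaw (a k) (chiMeasure (chiralParam β m n k)) P) ∧
    iIndepFun a P ∧
    ∀ᵐ ω ∂P, J ω = zeroDiagJacobi fun k => a k ω

/-- `μ` is the spectral measure of the real symmetric matrix `A` with respect to the basis
vector `e_i`: the probability measure with `⟨e_i, A ^ k e_i⟩ = ∫ x ^ k dμ` for all `k ≥ 0`. -/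
def IsSpectralMeasure {N : ℕ} (A : Matrix (Fin N) (Fin N) ℝ) (i : Fin N)
    (μ : Measure ℝ) : Prop :=
  IsProbabilityMeasure μ ∧
  ∀ k : ℕ, Integrable (fun x : ℝ => x ^ k) μ ∧
    (Pi.single i 1 : Fin N → ℝ) ⬝ᵥ (A ^ k).mulVec (Pi.single i 1) = ∫ x, x ^ k ∂μ

/-- The measure `∑ j, ½ w_j (δ_{l_j} + δ_{-l_j})`. -/
def symmetricAtoms {s : ℕ} (l w : Fin s → ℝ) : Measure ℝ :=
  ∑ j, ENNReal.ofReal (w j / 2) • (Measure.dirac (l j) + Measure.dirac (-l j))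

/-- The exponent parameter `a = |n - m| + 1 - 2 / β`. -/
def chiralA (β : ℝ) (m n : ℕ) : ℝ := |(n : ℝ) - (m : ℝ)| + 1 - 2 / β

/-- The normalization constant `h_{β,s,a}`. -/
def chiralNorm (β : ℝ) (s : ℕ) (a : ℝ) : ℝ :=
  (2 : ℝ) ^ ((s : ℝ) * (a * β / 2 + 1 + ((s : ℝ) - 1) * β / 2)) *
    ∏ j ∈ Finset.Icc 1 s,
      Real.Gamma (1 + β * (j : ℝ) / 2) *
        Real.Gamma (1 + β * a / 2 + β * ((j : ℝ) - 1) / 2) / Real.Gamma (1 + β / 2)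

/-- The density of the (unordered) `l₁, …, l_s` on `(0, ∞)^s`. -/
def eigenvalueDensity (β : ℝ) (s : ℕ) (a : ℝ) (l : Fin s → ℝ) : ℝ :=
  if ∀ j, 0 < l j then
    2 ^ s / chiralNorm β s a *
      (∏ j, l j ^ (β * a + 1) * Real.exp (-l j ^ 2 / 2)) *
      ∏ j, ∏ k ∈ Finset.Ioi j, |l k ^ 2 - l j ^ 2| ^ β
  else 0

/-- The density of `w₁, …, w_{m-1}` in the case `m ≤ n`, where `w_m = 1 - w₁ - ⋯ - w_{m-1}`. -/
def weightDensity (β : ℝ) (m : ℕ) (w : Fin (m - 1) → ℝ) : ℝ :=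
  if (∀ j, 0 < w j) ∧ 0 < 1 - ∑ j, w j then
    Real.Gamma (β * m / 2) / Real.Gamma (β / 2) ^ m *
      ((∏ j, w j ^ (β / 2 - 1)) * (1 - ∑ j, w j) ^ (β / 2 - 1))
  else 0

/-- The density of `w₁, …, w_n` in the case `m ≥ n + 1`, where `w₀ = 1 - w₁ - ⋯ - w_n`. -/
def weightDensityWithZero (β : ℝ) (m n : ℕ) (w : Fin n → ℝ) : ℝ :=
  if (∀ j, 0 < w j) ∧ 0 < 1 - ∑ j, w j then
    Real.Gamma (β * m / 2) /
        (Real.Gamma (β / 2) ^ n * Real.Gamma (β * ((m : ℝ) - (n : ℝ)) / 2)) *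
      (1 - ∑ j, w j) ^ (β * ((m : ℝ) - (n : ℝ)) / 2 - 1) * ∏ j, w j ^ (β / 2 - 1)
  else 0

/-- The joint law of `(l₁, …, l_s)` and `(w₁, …, w_r)`, `r ≤ s`, when the `s` random pairs
`(l_j, w_j)` are listed in a uniformly random order that is independent of them. -/
def randomOrderLaw {Ω : Type*} [MeasurableSpace Ω] (P : Measure Ω) {s r : ℕ} (hr : r ≤ s)
    (l w : Ω → Fin s → ℝ) : Measure ((Fin s → ℝ) × (Fin r → ℝ)) :=
  ((s.factorial : ℝ≥0∞))⁻¹ • ∑ σ : Equiv.Perm (Fin s),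
    P.map fun ω => (fun j => l ω (σ j), fun j => w ω (σ (Fin.castLE hr j)))

end

/-!
A Jacobi matrix with zero diagonal and positive off-diagonal entries `a₁, …, a_d` and a symmetric
probability measure with `d + 1` atoms determine each other, and the link between them is the
vector of the even moments `m₂, m₄, …, m_{2d}`: it is a function `F` of the entries
(`jacobiMoment`) and a function `G` of the positive atoms `l` and free weights `w` (`atomMoment`).
Both are injective and they have the same image. Injectivity of `F` is read off from
`m_{2k} = (a₁ ⋯ a_k)² + (a function of a₁, …, a_{k-1})` (`jacobiMoment_injOn`), that of `G`, for
atoms in a fixed order, from a Vandermonde matrix (`atomMoment_injOn`). The spectral theorem leads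
from the entries to the atoms (`exists_symmetric_atoms_zeroDiagJacobi`); the three-term recursion of
the orthogonal polynomials leads back (`exists_jacobiMoment_eq`). Hence `G⁻¹ ∘ F` carries the law of
the entries to the law of atoms and weights, and the densities are related by the ratio of the two
Jacobian determinants (`map_withDensity_of_image_eq`).

The derivative of `F` is triangular (`det_fderiv_jacobiMoment`). That of `G` is a confluent
Vandermonde matrix, which becomes triangular in a basis of Newton polynomials
(`det_confluent_eq`, `abs_det_fderiv_atomMoment_last`, `abs_det_fderiv_atomMoment_zero`). What is
left is to express the products of powers of the `a_k` in the chi densities and in the Jacobian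
through `l` and `w`. Since the vectors `J ^ k e₁` have a triangular matrix with diagonal entries
`a₁ ⋯ a_k`, the Hankel determinants of `m₀, m₂, m₄, …` and of `m₂, m₄, m₆, …` are on the one hand
products of squares of such partial products, on the other hand products of the weights, of powers
of the atoms, and of the squared Vandermonde determinant in the `l_j²`
(`prod_even_eq_of_moments`, `prod_even_eq_of_moments_of_zero`, `prod_odd_eq_of_moments`). The chi
parameters of the ensemble are exactly those for which `∏ a_k ^ α_k` is a combination of powers of
the two determinants (`prod_rpow_chiralParam_of_le`, `prod_rpow_chiralParam_of_gt`), while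
`∑ a_k² = ∑ l_j²` by comparing traces.
No integral has to be evaluated: the normalizing constants come out of the chi densities
(`prod_chiConst_of_le`, `prod_chiConst_of_gt`).

The atoms are listed in a random order `σ`. The list then has a density on the domain
`atomDomain σ` of points in the corresponding order; these domains are disjoint and cover all
lists of distinct atoms, and averaging over `σ` yields a density on the whole cone
(`average_withDensity_atomDomain`). The cases `m ≤ n` and `m ≥ n + 1` are treated together by
allowing `r` free weights with `r = s - 1` (no atom at the origin, the last weight is `1` minus the
sum of the others) or `r = s` (an atom at the origin, which carries the missing mass).
-/

/-! ### Powers of a zero-diagonal Jacobi matrix applied to the first basis vector -/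

/-- The coordinates of `J ^ k e₀`, where `J` is the infinite zero-diagonal Jacobi matrix whose
off-diagonal entry between the indices `i` and `i + 1` is `a i`. -/
noncomputable def jacobiVec (a : ℕ → ℝ) : ℕ → ℕ → ℝ
  | 0, i => if i = 0 then 1 else 0
  | k + 1, 0 => a 0 * jacobiVec a k 1
  | k + 1, i + 1 => a i * jacobiVec a k i + a (i + 1) * jacobiVec a k (i + 2)

theorem jacobiVec_eq_zero_of_lt (a : ℕ → ℝ) : ∀ {k i : ℕ}, k < i → jacobiVec a k i = 0
  | 0, i, h => by simp [jacobiVec, h.ne']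
  | k + 1, 0, h => by simp at h
  | k + 1, i + 1, h => by
    rw [jacobiVec, jacobiVec_eq_zero_of_lt a (by omega), jacobiVec_eq_zero_of_lt a (by omega)]
    simp

theorem jacobiVec_self (a : ℕ → ℝ) (k : ℕ) : jacobiVec a k k = ∏ i ∈ Finset.range k, a i := by
  induction k with
  | zero => simp [jacobiVec]
  | succ k ih =>
    rw [jacobiVec, jacobiVec_eq_zero_of_lt a (by omega : k < k + 2), ih, Finset.prod_range_succ]
    ring

/-- The matrix entries reached by a walk of length `k` from `0` to some `i < k` all have index
less than `k - 1`. -/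
theorem jacobiVec_congr {a b : ℕ → ℝ} {k : ℕ} (h : ∀ j, j + 1 < k → a j = b j) {i : ℕ}
    (hi : i < k) : jacobiVec a k i = jacobiVec b k i := by
  induction k generalizing i with
  | zero => omega
  | succ k ih =>
    have hle : ∀ j, j ≤ k → jacobiVec a k j = jacobiVec b k j := by
      intro j hj
      rcases hj.lt_or_eq with hj | rfl
      · exact ih (fun j' hj' => h j' (by omega)) hj
      · rw [jacobiVec_self, jacobiVec_self]
        exact Finset.prod_congr rfl fun x hx => h x (by simpa using hx)
    have hup : ∀ j, j ≤ k → a j * jacobiVec a k (j + 1) = b j * jacobiVec b k (j + 1) := by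
      intro j hj
      rcases hj.lt_or_eq with hj | rfl
      · rw [h j (by omega), hle _ hj]
      · rw [jacobiVec_eq_zero_of_lt a (by omega), jacobiVec_eq_zero_of_lt b (by omega)]
        simp
    cases i with
    | zero => exact hup 0 (by omega)
    | succ i =>
      rw [jacobiVec, jacobiVec, hup (i + 1) (by omega), hle i (by omega), h i (by omega)]

theorem jacobiVec_eq_zero_of_odd (a : ℕ → ℝ) :
    ∀ {k i : ℕ}, Odd (k + i) → jacobiVec a k i = 0
  | 0, 0, h => by simp at h
  | 0, i + 1, _ => by simp [jacobiVec]
  | k + 1, 0, h => by rw [jacobiVec, jacobiVec_eq_zero_of_odd a (by simpa using h), mul_zero]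
  | k + 1, i + 1, h => by
    rw [jacobiVec, jacobiVec_eq_zero_of_odd a (k := k) (i := i) (by grind),
      jacobiVec_eq_zero_of_odd a (k := k) (i := i + 2) (by grind)]
    simp

/-- Extension of a finite sequence by zeros. -/
noncomputable def zeroExtend {d : ℕ} (a : Fin d → ℝ) (i : ℕ) : ℝ :=
  if h : i < d then a ⟨i, h⟩ else 0

@[simp] theorem zeroExtend_coe {d : ℕ} (a : Fin d → ℝ) (i : Fin d) : zeroExtend a i = a i := by
  simp [zeroExtend]

theorem zeroExtend_of_lt {d : ℕ} (a : Fin d → ℝ) {i : ℕ} (h : i < d) :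
    zeroExtend a i = a ⟨i, h⟩ := by
  simp [zeroExtend, h]

theorem zeroExtend_of_ge {d : ℕ} (a : Fin d → ℝ) {i : ℕ} (h : d ≤ i) : zeroExtend a i = 0 := by
  simp [zeroExtend, h]

/-- The even moments `⟨e₀, J ^ (2 (k + 1)) e₀⟩ = ‖J ^ (k + 1) e₀‖²`, for `k < d`, of the Jacobi
matrix with off-diagonal entries `a 0, …, a (d - 1)`. -/
noncomputable def jacobiMoment {d : ℕ} (a : Fin d → ℝ) (k : Fin d) : ℝ :=
  ∑ i ∈ Finset.range (k + 2), jacobiVec (zeroExtend a) (k + 1) i ^ 2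

theorem jacobiMoment_eq {d : ℕ} (a : Fin d → ℝ) (k : Fin d) :
    jacobiMoment a k = (∑ i ∈ Finset.range (k + 1), jacobiVec (zeroExtend a) (k + 1) i ^ 2) +
      (∏ i ∈ Finset.range (k : ℕ), zeroExtend a i) ^ 2 * a k ^ 2 := by
  rw [jacobiMoment, Finset.sum_range_succ, jacobiVec_self, Finset.prod_range_succ, zeroExtend_coe,
    mul_pow]

theorem jacobiMoment_sub_of_eq_below {d : ℕ} {a b : Fin d → ℝ} {k : Fin d}
    (h : ∀ j < k, a j = b j) :
    jacobiMoment a k - jacobiMoment b k =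
      (∏ i ∈ Finset.range (k : ℕ), zeroExtend a i) ^ 2 * (a k ^ 2 - b k ^ 2) := by
  have h' : ∀ j : ℕ, j < k → zeroExtend a j = zeroExtend b j := fun j hj => by
    rw [zeroExtend_of_lt a (hj.trans k.2), zeroExtend_of_lt b (hj.trans k.2)]
    exact h _ hj
  rw [jacobiMoment_eq, jacobiMoment_eq,
    Finset.sum_congr rfl fun i hi => by
      rw [jacobiVec_congr (b := zeroExtend b) (fun j hj => h' j (by omega))
        (Finset.mem_range.1 hi)],
    Finset.prod_congr rfl fun i hi => h' i (Finset.mem_range.1 hi)]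
  ring

theorem prod_zeroExtend_pos {d : ℕ} {a : Fin d → ℝ} (ha : ∀ i, 0 < a i) {k : ℕ} (hk : k ≤ d) :
    0 < ∏ i ∈ Finset.range k, zeroExtend a i :=
  Finset.prod_pos fun i hi => by
    rw [zeroExtend_of_lt a ((Finset.mem_range.1 hi).trans_le hk)]
    exact ha _

/-- A Jacobi matrix with zero diagonal and positive off-diagonal entries is determined by its
even moments. -/
theorem jacobiMoment_injOn (d : ℕ) :
    Set.InjOn (jacobiMoment (d := d)) {a | ∀ i, 0 < a i} := by
  intro a ha b hb hab
  have key : ∀ n (hn : n < d), a ⟨n, hn⟩ = b ⟨n, hn⟩ := by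
    intro n
    induction n using Nat.strong_induction_on with
    | _ n ih =>
      intro hn
      have h1 := jacobiMoment_sub_of_eq_below (a := a) (b := b) (k := ⟨n, hn⟩)
        fun j hj => ih j hj j.2
      rw [hab, sub_self, eq_comm, mul_eq_zero] at h1
      have h2 := h1.resolve_left (pow_ne_zero 2 (prod_zeroExtend_pos ha hn.le).ne')
      exact (pow_left_inj₀ (ha _).le (hb _).le two_ne_zero).1 (sub_eq_zero.1 h2)
  funext i
  exact key i i.2

theorem differentiable_jacobiVec (d k i : ℕ) :
    Differentiable ℝ fun a : Fin d → ℝ => jacobiVec (zeroExtend a) k i := by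
  have hext : ∀ i : ℕ, Differentiable ℝ fun a : Fin d → ℝ => zeroExtend a i := by
    intro i
    by_cases h : i < d
    · simp only [zeroExtend, h, dite_true]
      fun_prop
    · simp only [zeroExtend, h, dite_false]
      fun_prop
  induction k generalizing i with
  | zero => simp [jacobiVec]
  | succ k ih =>
    cases i with
    | zero => exact (hext 0).mul (ih 1)
    | succ i => exact ((hext i).mul (ih i)).add ((hext (i + 1)).mul (ih (i + 2)))

theorem differentiable_jacobiMoment (d : ℕ) : Differentiable ℝ (jacobiMoment (d := d)) := by
  rw [differentiable_pi]
  intro k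
  unfold jacobiMoment
  exact Differentiable.fun_sum fun i _ => (differentiable_jacobiVec d _ i).pow 2

/-- The Jacobian matrix of the moments is lower triangular. -/
theorem det_fderiv_jacobiMoment {d : ℕ} (a : Fin d → ℝ) :
    (fderiv ℝ jacobiMoment a).det =
      ∏ k : Fin d, (∏ i ∈ Finset.range (k : ℕ), zeroExtend a i) ^ 2 * (2 * a k) := by
  have hline : ∀ i k : Fin d, HasDerivAt (fun t : ℝ => jacobiMoment (a + t • Pi.single i 1) k)
      (fderiv ℝ jacobiMoment a (Pi.single i 1) k) 0 := by
    intro i k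
    have h0 : HasFDerivAt jacobiMoment (fderiv ℝ jacobiMoment a)
        (a + (0 : ℝ) • (Pi.single i 1 : Fin d → ℝ)) := by
      rw [zero_smul, add_zero]
      exact (differentiable_jacobiMoment d a).hasFDerivAt
    have h1 : HasDerivAt (fun t : ℝ => a + t • (Pi.single i 1 : Fin d → ℝ))
        (Pi.single i 1) 0 := by
      simpa using ((hasDerivAt_id (0 : ℝ)).smul_const (Pi.single i 1 : Fin d → ℝ)).const_add a
    exact hasDerivAt_pi.1 (h0.comp_hasDerivAt (0 : ℝ) h1) k
  have hval : ∀ i k : Fin d, k ≤ i → ∀ t : ℝ, jacobiMoment (a + t • Pi.single i 1) k =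
      jacobiMoment a k - (∏ i ∈ Finset.range (k : ℕ), zeroExtend a i) ^ 2 *
        (a k ^ 2 - (a k + t * (Pi.single i 1 : Fin d → ℝ) k) ^ 2) := by
    intro i k hik t
    have := jacobiMoment_sub_of_eq_below (a := a) (b := a + t • Pi.single i 1) (k := k)
      fun j hj => by simp [(hj.trans_le hik).ne]
    simp only [Pi.add_apply, Pi.smul_apply, smul_eq_mul] at this
    linarith
  rw [ContinuousLinearMap.det, ← LinearMap.det_toMatrix', Matrix.det_of_isLowerTriangular]
  · refine Finset.prod_congr rfl fun k _ => ?_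
    rw [LinearMap.toMatrix'_apply]
    refine (hline k k).unique ?_
    simp_rw [hval k k le_rfl]
    have h1 : HasDerivAt (fun t : ℝ => a k + t * (Pi.single k 1 : Fin d → ℝ) k) 1 0 := by
      simpa using ((hasDerivAt_id (0 : ℝ)).const_add (a k))
    have := (((h1.pow 2).const_sub (a k ^ 2)).const_mul
      ((∏ i ∈ Finset.range (k : ℕ), zeroExtend a i) ^ 2)).const_sub (jacobiMoment a k)
    convert! this using 1
    simp
  · intro k i hik
    rw [LinearMap.toMatrix'_apply]
    refine (hline i k).unique ?_
    have hik' : k < i := hik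
    simp_rw [hval i k hik'.le]
    simpa [hik'.ne] using hasDerivAt_const (0 : ℝ) (jacobiMoment a k)

/-! ### Finite real Jacobi matrices with zero diagonal -/

theorem zeroDiagJacobi_apply {N : ℕ} (a : Fin (N - 1) → ℝ) (i j : Fin N) :
    zeroDiagJacobi a i j = (if (i : ℕ) + 1 = j then zeroExtend a i else 0) +
      if (j : ℕ) + 1 = i then zeroExtend a j else 0 := by
  simp only [zeroDiagJacobi, Matrix.of_apply]
  split_ifs with h1 h2 h2
  · omega
  · rw [zeroExtend_of_lt a (by omega), add_zero]
  · rw [zeroExtend_of_lt a (by omega), zero_add]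
  · simp

theorem zeroDiagJacobi_transpose {N : ℕ} (a : Fin (N - 1) → ℝ) :
    (zeroDiagJacobi a).transpose = zeroDiagJacobi a := by
  ext i j
  rw [Matrix.transpose_apply, zeroDiagJacobi_apply, zeroDiagJacobi_apply, add_comm]

theorem zeroDiagJacobi_mulVec_apply {N : ℕ} (a : Fin (N - 1) → ℝ) (u : ℕ → ℝ) (i : Fin N) :
    (zeroDiagJacobi a).mulVec (fun j => u j) i =
      (if (i : ℕ) = 0 then 0 else zeroExtend a (i - 1) * u (i - 1)) +
        zeroExtend a i * u (i + 1) := by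
  have hi := i.2
  simp only [Matrix.mulVec, dotProduct, zeroDiagJacobi_apply, add_mul, Finset.sum_add_distrib]
  rw [Fin.sum_univ_eq_sum_range
      (fun j : ℕ => (if (i : ℕ) + 1 = j then zeroExtend a i else 0) * u j),
    Fin.sum_univ_eq_sum_range
      (fun j : ℕ => (if j + 1 = (i : ℕ) then zeroExtend a j else 0) * u j), add_comm]
  congr 1
  · by_cases h : (i : ℕ) = 0
    · simp [h]
    · have : ∀ j : ℕ, (j + 1 = (i : ℕ)) ↔ ((i : ℕ) - 1 = j) := by omega
      simp only [this, ite_mul, zero_mul, Finset.sum_ite_eq, Finset.mem_range, h, if_false]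
      rw [if_pos (by omega)]
  · simp only [ite_mul, zero_mul, Finset.sum_ite_eq, Finset.mem_range]
    split_ifs with h
    · rfl
    · rw [zeroExtend_of_ge a (by omega), zero_mul]

theorem zeroDiagJacobi_pow_mulVec {N : ℕ} (a : Fin (N - 1) → ℝ) (hN : 0 < N) (k : ℕ) :
    (zeroDiagJacobi a ^ k).mulVec (Pi.single ⟨0, hN⟩ 1) =
      fun i : Fin N => jacobiVec (zeroExtend a) k i := by
  induction k with
  | zero =>
    ext i
    simp [jacobiVec, Matrix.one_apply, Fin.ext_iff]
  | succ k ih =>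
    rw [pow_succ', ← Matrix.mulVec_mulVec, ih]
    ext i
    rw [zeroDiagJacobi_mulVec_apply]
    obtain ⟨i, hi⟩ := i
    cases i <;> simp [jacobiVec]

/-- Moments of the spectral measure as inner products of the vectors `J ^ k e₀`. -/
theorem single_dotProduct_zeroDiagJacobi_pow {N : ℕ} (a : Fin (N - 1) → ℝ) (hN : 0 < N)
    (j k : ℕ) :
    (Pi.single ⟨0, hN⟩ 1 : Fin N → ℝ) ⬝ᵥ (zeroDiagJacobi a ^ (j + k)).mulVec
      (Pi.single ⟨0, hN⟩ 1) =
      ∑ i ∈ Finset.range N, jacobiVec (zeroExtend a) j i * jacobiVec (zeroExtend a) k i := by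
  rw [← Fin.sum_univ_eq_sum_range
      (fun i : ℕ => jacobiVec (zeroExtend a) j i * jacobiVec (zeroExtend a) k i), pow_add,
    ← Matrix.mulVec_mulVec, Matrix.dotProduct_mulVec, ← Matrix.mulVec_transpose,
    Matrix.transpose_pow, zeroDiagJacobi_transpose, zeroDiagJacobi_pow_mulVec,
    zeroDiagJacobi_pow_mulVec, dotProduct]

theorem trace_zeroDiagJacobi_sq {N : ℕ} (a : Fin (N - 1) → ℝ) :
    (zeroDiagJacobi a ^ 2).trace = 2 * ∑ i, a i ^ 2 := by
  have h1 : ∀ i j : Fin N, zeroDiagJacobi a i j * zeroDiagJacobi a j i =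
      (if (i : ℕ) + 1 = j then zeroExtend a i ^ 2 else 0) +
        if (j : ℕ) + 1 = i then zeroExtend a j ^ 2 else 0 := by
    intro i j
    rw [zeroDiagJacobi_apply, zeroDiagJacobi_apply]
    split_ifs <;> first | omega | ring
  have h2 : ∑ i : Fin N, ∑ j : Fin N,
      (if (i : ℕ) + 1 = j then zeroExtend a i ^ 2 else 0) = ∑ i, a i ^ 2 := by
    have h3 : ∀ i : Fin N, ∑ j : Fin N, (if (i : ℕ) + 1 = j then zeroExtend a i ^ 2 else 0) =
        zeroExtend a i ^ 2 := by
      intro i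
      rw [Fin.sum_univ_eq_sum_range
        (fun j : ℕ => if (i : ℕ) + 1 = j then zeroExtend a i ^ 2 else 0)]
      simp only [Finset.sum_ite_eq, Finset.mem_range]
      split_ifs with h
      · rfl
      · rw [zeroExtend_of_ge a (by omega)]; simp
    simp_rw [h3]
    rw [Fin.sum_univ_eq_sum_range (fun i : ℕ => zeroExtend a i ^ 2)]
    rw [← Finset.sum_subset (Finset.range_mono (Nat.sub_le N 1)) fun x _ hx => by
      rw [zeroExtend_of_ge a (by simpa using hx)]; simp]
    rw [← Fin.sum_univ_eq_sum_range (fun i : ℕ => zeroExtend a i ^ 2)]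
    simp
  simp only [sq (zeroDiagJacobi a), Matrix.trace, Matrix.diag_apply, Matrix.mul_apply, h1,
    Finset.sum_add_distrib]
  rw [h2, Finset.sum_comm, h2]
  ring

/-! ### Finitely supported measures and their moments -/

/-- A finitely supported signed measure with at most `n` atoms is determined by its first `n`
moments. -/
theorem eq_zero_of_moments_eq_zero {f : ℝ →₀ ℝ} {n : ℕ} (hn : f.support.card ≤ n)
    (hf : ∀ k < n, Finsupp.linearCombination ℝ (fun x : ℝ => x ^ k) f = 0) : f = 0 := by
  set e := f.support.equivFin.symm
  have h := Matrix.eq_zero_of_forall_pow_sum_mul_pow_eq_zero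
    (f := fun i => (e i : ℝ)) (v := fun i => f (e i))
    (Subtype.val_injective.comp e.injective) fun k => by
      have := hf k (k.2.trans_le hn)
      rw [Finsupp.linearCombination_apply, Finsupp.sum, ← Finset.sum_coe_sort] at this
      rw [← this, ← e.sum_comp]
      rfl
  ext x
  by_contra hx
  have hx' : x ∈ f.support := Finsupp.mem_support_iff.2 hx
  have := congrFun h (e.symm ⟨x, hx'⟩)
  simp at this
  exact hx this

/-- Summation over a symmetric finite set of reals, by absolute values. -/
theorem sum_eq_of_neg_mem {S : Finset ℝ} (hS : ∀ x ∈ S, -x ∈ S) {M : Type*} [AddCommMonoid M]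
    (g : ℝ → M) :
    ∑ x ∈ S, g x = (if (0 : ℝ) ∈ S then g 0 else 0) + ∑ x ∈ S with 0 < x, (g x + g (-x)) := by
  rw [Finset.sum_add_distrib, ← Finset.sum_filter_add_sum_filter_not S (fun x => 0 < x),
    ← Finset.sum_filter_add_sum_filter_not (S.filter fun x => ¬ 0 < x) (fun x => x < 0)]
  have h1 : ∑ x ∈ (S.filter fun x => ¬ 0 < x) with x < 0, g x = ∑ x ∈ S with 0 < x, g (-x) := by
    refine Finset.sum_nbij' (fun x => -x) (fun x => -x) ?_ ?_ ?_ ?_ ?_ <;>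
      simp +contextual [hS, le_of_lt]
  have h2 : ((S.filter fun x => ¬ 0 < x).filter fun x => ¬ x < 0) =
      if (0 : ℝ) ∈ S then {0} else ∅ := by
    ext x
    split_ifs with h
    · simp only [Finset.mem_filter, Finset.mem_singleton, not_lt]
      exact ⟨fun hx => le_antisymm hx.1.2 hx.2, fun hx => by subst hx; simp [h]⟩
    · simp only [Finset.mem_filter, not_lt, Finset.notMem_empty, iff_false]
      rintro ⟨⟨hx, h3⟩, h4⟩
      exact h (le_antisymm h3 h4 ▸ hx)
  rw [h1, h2]
  split_ifs
  · rw [Finset.sum_singleton]; abel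
  · rw [Finset.sum_empty]; abel

/-- A finitely supported measure with vanishing odd moments is symmetric. -/
theorem apply_neg_of_odd_moments_eq_zero {f : ℝ →₀ ℝ}
    (hf : ∀ k, Odd k → Finsupp.linearCombination ℝ (fun x : ℝ => x ^ k) f = 0) (x : ℝ) :
    f (-x) = f x := by
  have h : f - f.mapDomain (fun x => -x) = 0 := by
    refine eq_zero_of_moments_eq_zero le_rfl fun k _ => ?_
    rw [map_sub, Finsupp.linearCombination_mapDomain]
    rcases Nat.even_or_odd k with hk | hk
    · have : ((fun x : ℝ => x ^ k) ∘ fun x => -x) = fun x => x ^ k := by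
        ext x; simp [hk.neg_pow]
      rw [this, sub_self]
    · have : ((fun x : ℝ => x ^ k) ∘ fun x => -x) = -fun x => x ^ k := by
        ext x; simp [hk.neg_pow]
      rw [this, hf k hk, Finsupp.linearCombination_apply, Finsupp.sum]
      simp only [Pi.neg_apply, smul_neg, Finset.sum_neg_distrib, sub_neg_eq_add, zero_add]
      have := hf k hk
      rwa [Finsupp.linearCombination_apply, Finsupp.sum] at this
  have h1 := DFunLike.congr_fun (sub_eq_zero.1 h) (-x)
  rw [h1, Finsupp.mapDomain_apply neg_injective]

/-! ### The spectral measure of a zero-diagonal Jacobi matrix -/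

/-- An eigenvector is determined by its first coordinate, through the recursion given by the rows
of the matrix. Hence the eigenvalues are simple and the spectral measure charges all of them. -/
theorem eq_zero_of_zeroDiagJacobi_mulVec_eq {N : ℕ} {a : Fin (N - 1) → ℝ} (ha : ∀ i, 0 < a i)
    (hN : 0 < N) {u : Fin N → ℝ} {c : ℝ} (hu : (zeroDiagJacobi a).mulVec u = c • u)
    (h0 : u ⟨0, hN⟩ = 0) : u = 0 := by
  set U : ℕ → ℝ := fun i => if h : i < N then u ⟨i, h⟩ else 0 with hU
  have hUu : (fun j : Fin N => U j) = u := by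
    ext j; simp [hU]
  have key : ∀ i < N, U i = 0 := by
    intro i
    induction i using Nat.strong_induction_on with
    | _ i ih =>
      intro hi
      rcases i with _ | i
      · simp [hU, hN, h0]
      · have h1 := zeroDiagJacobi_mulVec_apply a U ⟨i, by omega⟩
        rw [hUu, hu] at h1
        have h2 : u ⟨i, by omega⟩ = 0 := by
          have := ih i (by omega) (by omega)
          simpa [hU, show i < N by omega] using this
        have h3 : i = 0 ∨ U (i - 1) = 0 := by
          rcases Nat.eq_zero_or_pos i with h | h
          · exact Or.inl h
          · exact Or.inr (ih (i - 1) (by omega) (by omega))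
        have h4 : zeroExtend a i * U (i + 1) = 0 := by
          rcases h3 with rfl | h3
          · simpa [h0] using h1.symm
          · simpa [h2, h3] using h1.symm
        rw [zeroExtend_of_lt a (by omega)] at h4
        exact (mul_eq_zero.1 h4).resolve_left (ha _).ne'
  rw [← hUu]
  ext j
  exact key j j.2

open Matrix in
/-- The spectral measure of a zero-diagonal Jacobi matrix of size `N` with positive off-diagonal
entries has `N` atoms. -/
theorem exists_atoms_zeroDiagJacobi {N : ℕ} {a : Fin (N - 1) → ℝ} (ha : ∀ i, 0 < a i)
    (hN : 0 < N) :
    ∃ f : ℝ →₀ ℝ, (∀ x, 0 ≤ f x) ∧ f.support.card = N ∧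
      (∀ k, (Pi.single ⟨0, hN⟩ 1 : Fin N → ℝ) ⬝ᵥ (zeroDiagJacobi a ^ k).mulVec
        (Pi.single ⟨0, hN⟩ 1) = Finsupp.linearCombination ℝ (fun x : ℝ => x ^ k) f) ∧
      2 * ∑ i, a i ^ 2 = ∑ x ∈ f.support, x ^ 2 := by
  have hA : (zeroDiagJacobi a).IsHermitian := by
    rw [Matrix.IsHermitian, Matrix.conjTranspose_eq_transpose_of_trivial, zeroDiagJacobi_transpose]
  set μ := hA.eigenvalues with hμ
  set u : Fin N → Fin N → ℝ := fun i => ⇑(hA.eigenvectorBasis i) with hu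
  have heig : ∀ i, (zeroDiagJacobi a).mulVec (u i) = μ i • u i := hA.mulVec_eigenvectorBasis
  have horth : ∀ i j, u i ⬝ᵥ u j = if i = j then 1 else 0 := by
    intro i j
    have := orthonormal_iff_ite.1 hA.eigenvectorBasis.orthonormal i j
    rw [EuclideanSpace.inner_eq_star_dotProduct, star_trivial, dotProduct_comm] at this
    exact this
  have hne : ∀ i, u i ≠ 0 := fun i h => by
    have := horth i i
    simp [h] at this
  have hfirst : ∀ i, u i ⟨0, hN⟩ ≠ 0 := fun i h =>
    hne i (eq_zero_of_zeroDiagJacobi_mulVec_eq ha hN (heig i) h)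
  have hinj : Function.Injective μ := by
    intro i j hij
    by_contra hne'
    -- two independent eigenvectors have a nonzero combination with vanishing first coordinate
    have h1 : (u j ⟨0, hN⟩) • u i - (u i ⟨0, hN⟩) • u j = 0 := by
      refine eq_zero_of_zeroDiagJacobi_mulVec_eq ha hN (c := μ i) ?_ ?_
      · rw [Matrix.mulVec_sub, Matrix.mulVec_smul, Matrix.mulVec_smul, heig, heig, ← hij, smul_sub,
          smul_comm (μ i), smul_comm (μ i)]
      · simp [mul_comm]
    have h2 := congrArg (fun v => u i ⬝ᵥ v) h1
    simp [dotProduct_sub, dotProduct_smul, horth, hne'] at h2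
    exact hfirst j h2
  have hdiag : ∀ k, zeroDiagJacobi a ^ k = (hA.eigenvectorUnitary : Matrix (Fin N) (Fin N) ℝ) *
      diagonal (fun i => μ i ^ k) * star (hA.eigenvectorUnitary : Matrix (Fin N) (Fin N) ℝ) := by
    intro k
    conv_lhs => rw [hA.spectral_theorem, ← map_pow, Unitary.conjStarAlgAut_apply,
      Matrix.diagonal_pow]
    rfl
  refine ⟨∑ i, Finsupp.single (μ i) (u i ⟨0, hN⟩ ^ 2), ?_, ?_, ?_, ?_⟩
  · intro x
    rw [Finsupp.finsetSum_apply]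
    refine Finset.sum_nonneg fun i _ => ?_
    rw [Finsupp.single_apply]
    split_ifs
    · positivity
    · exact le_rfl
  all_goals
    have hsupp : (∑ i, Finsupp.single (μ i) (u i ⟨0, hN⟩ ^ 2)).support =
        Finset.univ.image μ := by
      ext x
      simp only [Finsupp.mem_support_iff, Finset.mem_image, Finset.mem_univ, true_and,
        Finsupp.finsetSum_apply, Finsupp.single_apply]
      constructor
      · intro h
        obtain ⟨i, -, hi⟩ := Finset.exists_ne_zero_of_sum_ne_zero h
        exact ⟨i, by by_contra h'; simp [h'] at hi⟩
      · rintro ⟨i, rfl⟩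
        simp only [hinj.eq_iff, Finset.sum_ite_eq', Finset.mem_univ, if_true]
        exact pow_ne_zero 2 (hfirst i)
  · rw [hsupp, Finset.card_image_of_injective _ hinj, Finset.card_univ, Fintype.card_fin]
  · intro k
    rw [map_sum]
    simp only [Finsupp.linearCombination_single, smul_eq_mul]
    rw [Matrix.mulVec_single_one, single_one_dotProduct, hdiag k, Matrix.col_apply,
      Matrix.mul_apply]
    refine Finset.sum_congr rfl fun i _ => ?_
    rw [Matrix.mul_diagonal, Matrix.star_apply, star_trivial, hA.eigenvectorUnitary_apply]
    simp only [hu]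
    ring
  · rw [hsupp, Finset.sum_image fun x _ y _ h => hinj h, ← trace_zeroDiagJacobi_sq, hdiag 2,
      Matrix.trace_mul_comm, ← mul_assoc, Unitary.coe_star_mul_self, one_mul, Matrix.trace_diagonal]

/-- The spectral measure of a zero-diagonal Jacobi matrix with positive off-diagonal entries is
symmetric; it charges the origin if and only if the size of the matrix is odd. -/
theorem exists_symmetric_atoms_zeroDiagJacobi {N : ℕ} {a : Fin (N - 1) → ℝ} (ha : ∀ i, 0 < a i)
    (hN : 0 < N) {s : ℕ} (hs : N = 2 * s ∨ N = 2 * s + 1) :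
    ∃ (l w : Fin s → ℝ) (w₀ : ℝ), StrictAnti l ∧ (∀ j, 0 < l j) ∧ (∀ j, 0 < w j) ∧
      (N = 2 * s → w₀ = 0) ∧ (N = 2 * s + 1 → 0 < w₀) ∧
      (∀ k, (Pi.single ⟨0, hN⟩ 1 : Fin N → ℝ) ⬝ᵥ (zeroDiagJacobi a ^ k).mulVec
        (Pi.single ⟨0, hN⟩ 1) = w₀ * 0 ^ k + ∑ j, w j / 2 * (l j ^ k + (-l j) ^ k)) ∧
      ∑ i, a i ^ 2 = ∑ j, l j ^ 2 := by
  obtain ⟨f, hf0, hcard, hmom, htr⟩ := exists_atoms_zeroDiagJacobi ha hN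
  have hsymm : ∀ x, f (-x) = f x := apply_neg_of_odd_moments_eq_zero fun k hk => by
    rw [← hmom, zeroDiagJacobi_pow_mulVec, single_one_dotProduct]
    exact jacobiVec_eq_zero_of_odd _ (by simpa using hk)
  have hneg : ∀ x ∈ f.support, -x ∈ f.support := by
    intro x hx
    simpa [hsymm] using hx
  set S := f.support.filter fun x => 0 < x with hS
  have h1 := sum_eq_of_neg_mem hneg (fun _ => (1 : ℕ))
  simp only [hcard, Finset.sum_const, smul_eq_mul] at h1
  rw [← hS] at h1
  have hScard : S.card = s := by
    split_ifs at h1 <;> omega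
  have hzero : ((0 : ℝ) ∈ f.support) ↔ N = 2 * s + 1 := by
    split_ifs at h1 with h <;> simp only [h, true_iff, false_iff] <;> omega
  have henum : ∀ g : ℝ → ℝ, ∑ x ∈ S, g x = ∑ j : Fin s, g (S.orderEmbOfFin hScard j.rev) := by
    intro g
    rw [← Finset.sum_coe_sort, ← (S.orderIsoOfFin hScard).toEquiv.sum_comp,
      ← Equiv.sum_comp Fin.revPerm]
    rfl
  have hmem : ∀ j, S.orderEmbOfFin hScard j ∈ S := Finset.orderEmbOfFin_mem S hScard
  refine ⟨fun j => S.orderEmbOfFin hScard j.rev, fun j => 2 * f (S.orderEmbOfFin hScard j.rev),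
    f 0, ?_, ?_, ?_, ?_, ?_, ?_, ?_⟩
  · intro i j hij
    exact (S.orderEmbOfFin hScard).strictMono (Fin.rev_lt_rev.2 hij)
  · intro j
    exact (Finset.mem_filter.1 (hmem _)).2
  · intro j
    have := (Finset.mem_filter.1 (hmem j.rev)).1
    have := (hf0 _).lt_of_ne' (Finsupp.mem_support_iff.1 this)
    positivity
  · intro h
    by_contra h'
    have := hzero.1 (Finsupp.mem_support_iff.2 h')
    omega
  · intro h
    exact (hf0 0).lt_of_ne' (Finsupp.mem_support_iff.1 (hzero.2 h))
  · intro k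
    rw [hmom, Finsupp.linearCombination_apply, Finsupp.sum, sum_eq_of_neg_mem hneg, henum]
    congr 1
    · split_ifs with h
      · rfl
      · rw [Finsupp.notMem_support_iff.1 h, zero_mul]
    · refine Finset.sum_congr rfl fun j _ => ?_
      simp only [hsymm, smul_eq_mul]
      ring
  · rw [sum_eq_of_neg_mem hneg, henum] at htr
    simp only [neg_sq, ← two_mul, ne_eq, OfNat.ofNat_ne_zero, not_false_eq_true, zero_pow,
      ite_self, zero_add, ← Finset.mul_sum] at htr
    linarith

/-! ### From a symmetric measure to a Jacobi matrix -/

section OrthogonalPolynomials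

open Polynomial

/-- The monic orthogonal polynomials of a symmetric linear functional `L`, defined by their
three-term recursion `P (k + 2) = X P (k + 1) - c P k` with `c = L (P (k + 1)²) / L (P k²)`. -/
noncomputable def symmOrthoPoly (L : ℝ[X] →ₗ[ℝ] ℝ) : ℕ → ℝ[X]
  | 0 => 1
  | 1 => X
  | k + 2 => X * symmOrthoPoly L (k + 1) -
      C (L (symmOrthoPoly L (k + 1) * symmOrthoPoly L (k + 1)) /
        L (symmOrthoPoly L k * symmOrthoPoly L k)) * symmOrthoPoly L k

variable {L : ℝ[X] →ₗ[ℝ] ℝ}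

theorem symmOrthoPoly_monic_natDegree (L : ℝ[X] →ₗ[ℝ] ℝ) :
    ∀ k, (symmOrthoPoly L k).Monic ∧ (symmOrthoPoly L k).natDegree = k
  | 0 => by simp [symmOrthoPoly]
  | 1 => by simp [symmOrthoPoly, monic_X]
  | k + 2 => by
    obtain ⟨h1, h2⟩ := symmOrthoPoly_monic_natDegree L (k + 1)
    obtain ⟨-, h4⟩ := symmOrthoPoly_monic_natDegree L k
    have hm : (X * symmOrthoPoly L (k + 1)).Monic := monic_X.mul h1
    have hd : (X * symmOrthoPoly L (k + 1)).natDegree = k + 2 := by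
      rw [monic_X.natDegree_mul h1, natDegree_X, h2]; ring
    have hlt : (C (L (symmOrthoPoly L (k + 1) * symmOrthoPoly L (k + 1)) /
        L (symmOrthoPoly L k * symmOrthoPoly L k)) * symmOrthoPoly L k).natDegree <
        (X * symmOrthoPoly L (k + 1)).natDegree := by
      refine (natDegree_C_mul_le _ _).trans_lt ?_
      rw [h4, hd]; omega
    rw [symmOrthoPoly]
    exact ⟨hm.sub_of_left (degree_lt_degree hlt), by
      rw [natDegree_sub_eq_left_of_natDegree_lt hlt, hd]⟩

theorem symmOrthoPoly_comp_neg (L : ℝ[X] →ₗ[ℝ] ℝ) :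
    ∀ k, (symmOrthoPoly L k).comp (-X) = (-1) ^ k * symmOrthoPoly L k
  | 0 => by simp [symmOrthoPoly]
  | 1 => by simp [symmOrthoPoly]
  | k + 2 => by
    rw [symmOrthoPoly, sub_comp, mul_comp, mul_comp, symmOrthoPoly_comp_neg L (k + 1),
      symmOrthoPoly_comp_neg L k, X_comp, C_comp]
    ring

variable {N : ℕ}

theorem symmOrthoPoly_norm_pos (hpos : ∀ p : ℝ[X], p ≠ 0 → p.natDegree < N → 0 < L (p * p))
    {k : ℕ} (hk : k < N) : 0 < L (symmOrthoPoly L k * symmOrthoPoly L k) :=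
  hpos _ (symmOrthoPoly_monic_natDegree L k).1.ne_zero
    ((symmOrthoPoly_monic_natDegree L k).2.symm ▸ hk)

/-- The recursion has no term in `P (k + 1)` because `L` is symmetric: `P k` has the parity of `k`,
so that polynomials of different parity are orthogonal. -/
theorem symmOrthoPoly_orthogonal (hpos : ∀ p : ℝ[X], p ≠ 0 → p.natDegree < N → 0 < L (p * p))
    (hsymm : ∀ p : ℝ[X], L (p.comp (-X)) = L p) :
    ∀ k < N, ∀ j < k, L (symmOrthoPoly L k * symmOrthoPoly L j) = 0 := by
  have hpar : ∀ j k, Odd (j + k) → L (symmOrthoPoly L k * symmOrthoPoly L j) = 0 := by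
    intro j k hjk
    have h1 := hsymm (symmOrthoPoly L k * symmOrthoPoly L j)
    rw [mul_comp, symmOrthoPoly_comp_neg, symmOrthoPoly_comp_neg] at h1
    have h2 : (-1 : ℝ[X]) ^ k * symmOrthoPoly L k * ((-1) ^ j * symmOrthoPoly L j) =
        -(symmOrthoPoly L k * symmOrthoPoly L j) := by
      have : (-1 : ℝ[X]) ^ k * (-1) ^ j = -1 := by rw [← pow_add, add_comm, hjk.neg_one_pow]
      linear_combination (symmOrthoPoly L k * symmOrthoPoly L j) * this
    rw [h2, map_neg] at h1
    linarith
  have hX : ∀ i, 0 < i → X * symmOrthoPoly L i = symmOrthoPoly L (i + 1) +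
      C (L (symmOrthoPoly L i * symmOrthoPoly L i) /
        L (symmOrthoPoly L (i - 1) * symmOrthoPoly L (i - 1))) * symmOrthoPoly L (i - 1) := by
    intro i hi
    obtain ⟨i, rfl⟩ : ∃ i', i = i' + 1 := ⟨i - 1, by omega⟩
    rw [symmOrthoPoly.eq_3]
    simp
  intro k
  induction k using Nat.strong_induction_on with
  | _ k ih =>
    intro hk j hj
    rcases k with _ | _ | k
    · omega
    · obtain rfl : j = 0 := by omega
      exact hpar 0 1 (by decide)
    · have hC : ∀ (c : ℝ) (p : ℝ[X]), L (C c * p) = c * L p := fun c p => by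
        rw [← smul_eq_C_mul, map_smul, smul_eq_mul]
      rcases Nat.even_or_odd (j + (k + 2)) with hev | hod
      swap
      · exact hpar _ _ hod
      have hjk : j ≤ k := by grind
      -- move the factor `X` to the lower-degree polynomial and expand it
      have h1 : L (symmOrthoPoly L (k + 2) * symmOrthoPoly L j) =
          L (symmOrthoPoly L (k + 1) * (X * symmOrthoPoly L j)) -
          L (symmOrthoPoly L (k + 1) * symmOrthoPoly L (k + 1)) /
            L (symmOrthoPoly L k * symmOrthoPoly L k) *
            L (symmOrthoPoly L k * symmOrthoPoly L j) := by
        rw [← hC, ← map_sub, symmOrthoPoly.eq_3]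
        congr 1
        ring
      have h2 : L (symmOrthoPoly L (k + 1) * (X * symmOrthoPoly L j)) =
          L (symmOrthoPoly L (k + 1) * symmOrthoPoly L (j + 1)) := by
        rcases Nat.eq_zero_or_pos j with rfl | hj0
        · simp [symmOrthoPoly]
        · rw [hX j hj0, mul_add, map_add, mul_left_comm, hC,
            ih (k + 1) (by omega) (by omega) (j - 1) (by omega)]
          simp
      rw [h1, h2]
      rcases hjk.lt_or_eq with hlt | rfl
      · rw [ih (k + 1) (by omega) (by omega) (j + 1) (by omega), ih k (by omega) (by omega) j hlt]
        simp
      · rw [div_mul_cancel₀ _ (symmOrthoPoly_norm_pos hpos (by omega : j < N)).ne', sub_self]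

/-- Every symmetric normalized linear functional that is positive on squares of polynomials of
degree at most `d` has the first even moments of a zero-diagonal Jacobi matrix: the matrix of the
multiplication by `X` in the basis of normalized orthogonal polynomials. -/
theorem exists_jacobiMoment_eq_of_pos {d : ℕ}
    (hpos : ∀ p : ℝ[X], p ≠ 0 → p.natDegree < d + 1 → 0 < L (p * p))
    (hsymm : ∀ p : ℝ[X], L (p.comp (-X)) = L p) (h1 : L 1 = 1) :
    ∃ a : Fin d → ℝ, (∀ i, 0 < a i) ∧
      ∀ k : Fin d, jacobiMoment a k = L (X ^ (2 * ((k : ℕ) + 1))) := by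
  set P := symmOrthoPoly L with hP
  set h : ℕ → ℝ := fun k => L (P k * P k) with hh
  have hhpos : ∀ k ≤ d, 0 < h k := fun k hk => symmOrthoPoly_norm_pos hpos (by omega)
  have hC : ∀ (c : ℝ) (p : ℝ[X]), L (C c * p) = c * L p := fun c p => by
    rw [← smul_eq_C_mul, map_smul, smul_eq_mul]
  set a : Fin d → ℝ := fun i => √(h (i + 1) / h i) with ha
  have hapos : ∀ i, 0 < a i := fun i =>
    Real.sqrt_pos.2 (div_pos (hhpos _ (by omega)) (hhpos _ (by omega)))
  refine ⟨a, hapos, fun k => ?_⟩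
  -- the normalized polynomials; `X ^ k` has the coordinates of `J ^ k e₀` in this basis
  set p : ℕ → ℝ[X] := fun i => C (√(h i))⁻¹ * P i with hp
  have horth : ∀ i ≤ d, ∀ j ≤ d, L (p i * p j) = if i = j then 1 else 0 := by
    intro i hi j hj
    have : p i * p j = C ((√(h i))⁻¹ * (√(h j))⁻¹) * (P i * P j) := by
      simp only [hp, C_mul]; ring
    rw [this, hC]
    split_ifs with hij
    · subst hij
      rw [← mul_inv, Real.mul_self_sqrt (hhpos i hi).le]
      exact inv_mul_cancel₀ (hhpos i hi).ne'
    · rcases lt_or_gt_of_ne hij with hlt | hlt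
      · rw [mul_comm (P i), symmOrthoPoly_orthogonal hpos hsymm j (by omega) i hlt, mul_zero]
      · rw [symmOrthoPoly_orthogonal hpos hsymm i (by omega) j hlt, mul_zero]
  have hXP : ∀ i, X * P (i + 1) = P (i + 2) + C (h (i + 1) / h i) * P i := by
    intro i
    simp only [hP, hh, symmOrthoPoly]
    ring
  have haC : ∀ i (hi : i < d), zeroExtend a i = √(h (i + 1)) / √(h i) := by
    intro i hi
    rw [zeroExtend_of_lt a hi]
    exact Real.sqrt_div (hhpos _ (by omega)).le _
  have hXp0 : 0 < d → X * p 0 = C (zeroExtend a 0) * p 1 := by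
    intro hd
    have hne : √(h 1) ≠ 0 := (Real.sqrt_pos.2 (hhpos 1 (by omega))).ne'
    have h0 : h 0 = 1 := by simp [hh, hP, symmOrthoPoly, h1]
    rw [haC 0 hd]
    simp only [hp, ← mul_assoc, ← C_mul, hP, symmOrthoPoly, zero_add, h0]
    rw [Real.sqrt_one, div_one, mul_inv_cancel₀ hne]
    simp
  have hXp : ∀ i, i + 1 < d → X * p (i + 1) =
      C (zeroExtend a (i + 1)) * p (i + 2) + C (zeroExtend a i) * p i := by
    intro i hi
    have hne0 : √(h i) ≠ 0 := (Real.sqrt_pos.2 (hhpos i (by omega))).ne'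
    have hne1 : √(h (i + 1)) ≠ 0 := (Real.sqrt_pos.2 (hhpos (i + 1) (by omega))).ne'
    have hne2 : √(h (i + 2)) ≠ 0 := (Real.sqrt_pos.2 (hhpos (i + 2) (by omega))).ne'
    rw [haC i (by omega), haC (i + 1) hi]
    simp only [hp, ← mul_assoc, ← C_mul]
    rw [mul_comm X, mul_assoc, hXP, mul_add, ← mul_assoc, ← C_mul]
    congr 3
    · rw [div_mul_eq_mul_div, mul_inv_cancel₀ hne2, one_div]
    · have h2 : h (i + 1) / h i = √(h (i + 1)) * √(h (i + 1)) / (√(h i) * √(h i)) := by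
        rw [Real.mul_self_sqrt (hhpos _ (by omega)).le, Real.mul_self_sqrt (hhpos _ (by omega)).le]
      rw [h2, div_mul_eq_div_div, ← mul_div_assoc, ← mul_div_assoc, inv_mul_cancel_left₀ hne1,
        div_eq_mul_inv (√(h (i + 1)) / √(h i))]
  have hexp : ∀ k ≤ d, (X : ℝ[X]) ^ k =
      ∑ i ∈ Finset.range (k + 1), C (jacobiVec (zeroExtend a) k i) * p i := by
    intro k
    induction k with
    | zero =>
      intro _
      simp [jacobiVec, hp, hh, hP, symmOrthoPoly, h1]
    | succ k ih =>
      intro hk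
      rw [pow_succ', ih (by omega), Finset.mul_sum]
      set v := jacobiVec (zeroExtend a) with hv
      set A := zeroExtend a with hA
      have hterm : ∀ i ∈ Finset.range (k + 1), X * (C (v k i) * p i) =
          C (v k i * A i) * p (i + 1) +
            (if i = 0 then 0 else C (v k i * A (i - 1)) * p (i - 1)) := by
        intro i hi
        rw [Finset.mem_range] at hi
        rcases i with _ | i
        · rw [mul_left_comm, hXp0 (by omega), if_pos rfl, C_mul]; ring
        · rw [mul_left_comm, hXp i (by omega), if_neg (by omega), C_mul, C_mul]
          simp only [Nat.add_sub_cancel]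
          ring
      rw [Finset.sum_congr rfl hterm, Finset.sum_add_distrib, Finset.sum_range_succ' _ (k + 1),
        Finset.sum_range_succ' (fun i => if i = 0 then (0 : ℝ[X]) else _) k]
      have hs : ∀ n, v (k + 1) (n + 1) = v k n * A n + v k (n + 2) * A (n + 1) := by
        intro n
        simp only [hv, jacobiVec]; ring
      have hs0 : v (k + 1) 0 = v k 1 * A 0 := by
        simp only [hv, jacobiVec]; ring
      simp only [hs, hs0, C_add, add_mul, Finset.sum_add_distrib, if_true, add_zero,
        Nat.add_sub_cancel, Nat.succ_ne_zero, if_false]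
      rw [add_assoc]
      congr 1
      rw [← Finset.sum_range_succ' (fun n => C (v k (n + 1) * A n) * p n) (k + 1)]
      rw [Finset.sum_range_succ, Finset.sum_range_succ]
      have z1 : v k (k + 1) = 0 := jacobiVec_eq_zero_of_lt _ (by omega)
      have z2 : v k (k + 1 + 1) = 0 := jacobiVec_eq_zero_of_lt _ (by omega)
      rw [z1, z2]
      simp
  have hk := k.2
  rw [show 2 * ((k : ℕ) + 1) = (k + 1) + (k + 1) by ring, pow_add, hexp (k + 1) (by omega),
    Finset.sum_mul_sum, map_sum, jacobiMoment]
  refine Finset.sum_congr rfl fun i hi => ?_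
  rw [map_sum, Finset.sum_eq_single i]
  · rw [mul_mul_mul_comm, ← C_mul, hC, horth i (by grind) i (by grind)]
    simp [sq]
  · intro j hj hji
    rw [mul_mul_mul_comm, ← C_mul, hC, horth i (by grind) j (by grind), if_neg (Ne.symm hji),
      mul_zero]
  · intro h; exact absurd hi h

end OrthogonalPolynomials

/-- Every symmetric probability measure with `d + 1` atoms has the even moments of a zero-diagonal
Jacobi matrix with positive off-diagonal entries. -/
theorem exists_jacobiMoment_eq {s d : ℕ} {l w : Fin s → ℝ} {w₀ : ℝ} (hl : Function.Injective l)
    (hl0 : ∀ j, 0 < l j) (hw : ∀ j, 0 < w j) (hsum : w₀ + ∑ j, w j = 1)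
    (hw₀ : (w₀ = 0 ∧ d + 1 = 2 * s) ∨ (0 < w₀ ∧ d + 1 = 2 * s + 1)) :
    ∃ a : Fin d → ℝ, (∀ i, 0 < a i) ∧
      ∀ k : Fin d, jacobiMoment a k = ∑ j, w j * l j ^ (2 * ((k : ℕ) + 1)) := by
  classical
  set L : Polynomial ℝ →ₗ[ℝ] ℝ := w₀ • Polynomial.leval 0 +
    ∑ j, (w j / 2) • (Polynomial.leval (l j) + Polynomial.leval (-l j)) with hL
  have hLp : ∀ p : Polynomial ℝ, L p =
      w₀ * p.eval 0 + ∑ j, w j / 2 * (p.eval (l j) + p.eval (-l j)) := by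
    intro p
    simp [hL, Polynomial.leval, mul_add]
  have hw₀' : 0 ≤ w₀ := by rcases hw₀ with h | h <;> linarith
  have hpos : ∀ p : Polynomial ℝ, p ≠ 0 → p.natDegree < d + 1 → 0 < L (p * p) := by
    intro p hp0 hdeg
    rw [hLp]
    simp only [Polynomial.eval_mul]
    have hnn : ∀ j, 0 ≤ w j / 2 * (p.eval (l j) * p.eval (l j) + p.eval (-l j) * p.eval (-l j)) :=
      fun j => mul_nonneg (half_pos (hw j)).le
        (add_nonneg (mul_self_nonneg _) (mul_self_nonneg _))
    have h0 : 0 ≤ w₀ * (p.eval 0 * p.eval 0) := mul_nonneg hw₀' (mul_self_nonneg _)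
    refine (add_nonneg h0 (Finset.sum_nonneg fun j _ => hnn j)).lt_of_ne' fun hzero => ?_
    rw [add_eq_zero_iff_of_nonneg h0 (Finset.sum_nonneg fun j _ => hnn j),
      Finset.sum_eq_zero_iff_of_nonneg fun j _ => hnn j] at hzero
    -- a polynomial of norm zero vanishes at more points than its degree allows
    have hroot : ∀ j, p.eval (l j) = 0 ∧ p.eval (-l j) = 0 := by
      intro j
      have := (mul_eq_zero.1 (hzero.2 j (Finset.mem_univ j))).resolve_left (half_pos (hw j)).ne'
      rw [add_eq_zero_iff_of_nonneg (mul_self_nonneg _) (mul_self_nonneg _)] at this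
      simpa using this
    set S := Finset.univ.image l ∪ Finset.univ.image (fun j => -l j) with hS
    have hScard : S.card = 2 * s := by
      rw [hS, Finset.card_union_of_disjoint, Finset.card_image_of_injective _ hl,
        Finset.card_image_of_injective (f := fun j => -l j) _ (neg_injective.comp hl)]
      · simp; ring
      · rw [Finset.disjoint_left]
        simp only [Finset.mem_image, Finset.mem_univ, true_and, not_exists]
        rintro _ ⟨i, rfl⟩ j hj
        have := hl0 i
        have := hl0 j
        linarith
    have hS0 : ∀ x ∈ S, p.eval x = 0 := by
      intro x hx
      simp only [hS, Finset.mem_union, Finset.mem_image, Finset.mem_univ, true_and] at hx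
      rcases hx with ⟨j, rfl⟩ | ⟨j, rfl⟩
      · exact (hroot j).1
      · exact (hroot j).2
    rcases hw₀ with ⟨-, hd⟩ | ⟨hpos, hd⟩
    · exact hp0 (Polynomial.eq_zero_of_natDegree_lt_card_of_eval_eq_zero' p S hS0 (by omega))
    · have h00 : p.eval 0 = 0 := by
        simpa [hpos.ne'] using hzero.1
      have hnot : (0 : ℝ) ∉ S := by
        simp only [hS, Finset.mem_union, Finset.mem_image, Finset.mem_univ, true_and]
        rintro (⟨j, hj⟩ | ⟨j, hj⟩) <;> have := hl0 j <;> linarith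
      refine hp0 (Polynomial.eq_zero_of_natDegree_lt_card_of_eval_eq_zero' p (insert 0 S) ?_ ?_)
      · intro x hx
        rcases Finset.mem_insert.1 hx with rfl | hx
        · exact h00
        · exact hS0 x hx
      · rw [Finset.card_insert_of_notMem hnot]
        omega
  have hsymm : ∀ p : Polynomial ℝ, L (p.comp (-Polynomial.X)) = L p := by
    intro p
    rw [hLp, hLp]
    simp [Polynomial.eval_comp, add_comm]
  have hone : L 1 = 1 := by
    rw [hLp]
    simp only [Polynomial.eval_one]
    rw [mul_one]
    refine Eq.trans ?_ hsum
    congr 1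
    exact Finset.sum_congr rfl fun j _ => by ring
  obtain ⟨a, ha, hak⟩ := exists_jacobiMoment_eq_of_pos hpos hsymm hone
  refine ⟨a, ha, fun k => ?_⟩
  rw [hak, hLp]
  simp only [Polynomial.eval_pow, Polynomial.eval_X]
  rw [zero_pow (by omega), mul_zero, zero_add]
  refine Finset.sum_congr rfl fun j _ => ?_
  rw [(even_two_mul ((k : ℕ) + 1)).neg_pow]
  ring

/-! ### Hankel determinants -/

/-- Two evaluations of a Hankel determinant: from a triangular factorization `V Vᵀ`, and from the
atoms of the measure. -/
theorem prod_diag_sq_eq_of_gram {n : ℕ} {V : Matrix (Fin n) (Fin n) ℝ}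
    (hV : ∀ i j, i < j → V i j = 0) {x w : Fin n → ℝ}
    (h : ∀ i j : Fin n, ∑ k, V i k * V j k = ∑ k, w k * x k ^ ((i : ℕ) + j)) :
    (∏ i, V i i) ^ 2 = (∏ i, w i) * (∏ i, ∏ j ∈ Finset.Ioi i, (x j - x i)) ^ 2 := by
  have h1 : V * V.transpose =
      (Matrix.vandermonde x).transpose * (Matrix.diagonal w * Matrix.vandermonde x) := by
    ext i j
    rw [Matrix.mul_apply, Matrix.mul_apply]
    simp only [Matrix.diagonal_mul, Matrix.transpose_apply, h, Matrix.vandermonde_apply]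
    exact Finset.sum_congr rfl fun k _ => by ring
  have h2 := congrArg Matrix.det h1
  have h3 : V.det = ∏ i, V i i := Matrix.det_of_isLowerTriangular V fun i j hij => hV i j hij
  rw [Matrix.det_mul, Matrix.det_mul, Matrix.det_mul, Matrix.det_transpose, Matrix.det_transpose,
    Matrix.det_diagonal, Matrix.det_vandermonde, h3] at h2
  rw [sq, h2]
  ring

theorem sum_range_eq_sum_of_support {N n : ℕ} {g : ℕ → ℝ} (φ : ℕ → ℕ) (hφ : StrictMono φ)
    (hn : ∀ k < n, φ k < N) (hg : ∀ t, (∀ k < n, φ k ≠ t) → g t = 0) :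
    ∑ t ∈ Finset.range N, g t = ∑ k : Fin n, g (φ k) := by
  rw [Fin.sum_univ_eq_sum_range (fun k => g (φ k)),
    ← Finset.sum_image (f := g) (g := φ) fun _ _ _ _ h => hφ.injective h]
  symm
  refine Finset.sum_subset ?_ ?_
  · intro t ht
    obtain ⟨k, hk, rfl⟩ := Finset.mem_image.1 ht
    exact Finset.mem_range.2 (hn k (Finset.mem_range.1 hk))
  · intro t _ ht
    refine hg t fun k hk hkt => ht ?_
    exact Finset.mem_image.2 ⟨k, Finset.mem_range.2 hk, hkt⟩

section Moments

variable {a : ℕ → ℝ} {N s : ℕ} {w₀ : ℝ} {l w : Fin s → ℝ}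
  (hM : ∀ j k n : ℕ, j + k = 2 * n → ∑ i ∈ Finset.range N, jacobiVec a j i * jacobiVec a k i =
    w₀ * 0 ^ n + ∑ i, w i * (l i ^ 2) ^ n)

include hM

/-- The Hankel determinant of the moments of orders `2, 4, 6, …`. -/
theorem prod_odd_eq_of_moments (hs : 2 * s ≤ N) :
    ∏ k ∈ Finset.range s, (∏ i ∈ Finset.range (2 * k + 1), a i) ^ 2 =
      (∏ i, w i * l i ^ 2) * (∏ i, ∏ j ∈ Finset.Ioi i, (l j ^ 2 - l i ^ 2)) ^ 2 := by
  have h := prod_diag_sq_eq_of_gram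
    (V := Matrix.of fun i j : Fin s => jacobiVec a (2 * i + 1) (2 * j + 1))
    (x := fun i => l i ^ 2) (w := fun i => w i * l i ^ 2) ?_ ?_
  · rw [← h, ← Fin.prod_univ_eq_prod_range
      (fun k => (∏ i ∈ Finset.range (2 * k + 1), a i) ^ 2), Finset.prod_pow]
    simp [jacobiVec_self]
  · intro i j hij
    have : (i : ℕ) < j := hij
    exact jacobiVec_eq_zero_of_lt a (by omega)
  · intro i j
    simp only [Matrix.of_apply]
    rw [← sum_range_eq_sum_of_support (N := N)
      (g := fun t => jacobiVec a (2 * i + 1) t * jacobiVec a (2 * j + 1) t) (fun k => 2 * k + 1)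
      (fun _ _ h => by dsimp only; omega) (fun k hk => by omega), hM _ _ (i + j + 1) (by ring)]
    · rw [zero_pow (by omega), mul_zero, zero_add]
      exact Finset.sum_congr rfl fun k _ => by ring
    · intro t ht
      rcases Nat.even_or_odd t with h | h
      · rw [jacobiVec_eq_zero_of_odd a (k := 2 * i + 1) (by grind), zero_mul]
      · obtain ⟨k, rfl⟩ := h
        have : s ≤ k := by
          by_contra h
          exact ht k (by omega) rfl
        rw [jacobiVec_eq_zero_of_lt a (by omega), zero_mul]

theorem gram_even_of_moments {n : ℕ} (hn : 2 * n ≤ N + 1) (i j : Fin n) :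
    ∑ k : Fin n, jacobiVec a (2 * i) (2 * k) * jacobiVec a (2 * j) (2 * k) =
      w₀ * 0 ^ ((i : ℕ) + j) + ∑ k, w k * (l k ^ 2) ^ ((i : ℕ) + j) := by
  rw [← sum_range_eq_sum_of_support (N := N)
    (g := fun t => jacobiVec a (2 * i) t * jacobiVec a (2 * j) t) (fun k => 2 * k)
    (fun _ _ h => by dsimp only; omega) (fun k hk => by omega), hM _ _ (i + j) (by ring)]
  intro t ht
  rcases Nat.even_or_odd' t with ⟨k, rfl | rfl⟩
  · have : n ≤ k := by
      by_contra h
      exact ht k (by omega) rfl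
    rw [jacobiVec_eq_zero_of_lt a (by omega), zero_mul]
  · rw [jacobiVec_eq_zero_of_odd a (k := 2 * i) (by grind), zero_mul]

/-- The Hankel determinant of the moments of orders `0, 2, 4, …` of a measure without an atom at
the origin. -/
theorem prod_even_eq_of_moments (hs : 2 * s ≤ N) (hw₀ : w₀ = 0) :
    ∏ k ∈ Finset.range s, (∏ i ∈ Finset.range (2 * k), a i) ^ 2 =
      (∏ i, w i) * (∏ i, ∏ j ∈ Finset.Ioi i, (l j ^ 2 - l i ^ 2)) ^ 2 := by
  have h := prod_diag_sq_eq_of_gram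
    (V := Matrix.of fun i j : Fin s => jacobiVec a (2 * i) (2 * j))
    (x := fun i => l i ^ 2) (w := w) ?_ ?_
  · rw [← h, ← Fin.prod_univ_eq_prod_range
      (fun k => (∏ i ∈ Finset.range (2 * k), a i) ^ 2), Finset.prod_pow]
    simp [jacobiVec_self]
  · intro i j hij
    have : (i : ℕ) < j := hij
    exact jacobiVec_eq_zero_of_lt a (by omega)
  · intro i j
    simp only [Matrix.of_apply]
    rw [gram_even_of_moments hM (by omega), hw₀, zero_mul, zero_add]

/-- The Hankel determinant of the moments of orders `0, 2, 4, …` when there is an atom at the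
origin: it counts as one more node. -/
theorem prod_even_eq_of_moments_of_zero (hs : 2 * s + 1 ≤ N) :
    ∏ k ∈ Finset.range (s + 1), (∏ i ∈ Finset.range (2 * k), a i) ^ 2 =
      w₀ * (∏ i, w i) * (∏ i, l i ^ 2) ^ 2 *
        (∏ i, ∏ j ∈ Finset.Ioi i, (l j ^ 2 - l i ^ 2)) ^ 2 := by
  have h := prod_diag_sq_eq_of_gram
    (V := Matrix.of fun i j : Fin (s + 1) => jacobiVec a (2 * i) (2 * j))
    (x := Fin.cons 0 fun i => l i ^ 2) (w := Fin.cons w₀ w) ?_ ?_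
  · rw [← Fin.prod_univ_eq_prod_range
      (fun k => (∏ i ∈ Finset.range (2 * k), a i) ^ 2), Finset.prod_pow]
    simp only [Matrix.of_apply, jacobiVec_self] at h
    rw [h, Fin.prod_univ_succ, Fin.prod_univ_succ]
    simp only [Fin.prod_Ioi_zero, Fin.prod_Ioi_succ, Fin.cons_zero, Fin.cons_succ, sub_zero]
    ring
  · intro i j hij
    have : (i : ℕ) < j := hij
    exact jacobiVec_eq_zero_of_lt a (by omega)
  · intro i j
    simp only [Matrix.of_apply]
    rw [gram_even_of_moments hM (by omega), Fin.sum_univ_succ]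
    simp only [Fin.cons_zero, Fin.cons_succ]

end Moments

/-! ### The Jacobian of the moments as functions of the atoms -/

section Confluent

open Polynomial

/-- For linear functionals that kill constants, the determinant of the values on `X, …, X ^ d` can
be computed from any monic polynomials of degrees `1, …, d`. -/
theorem det_functional_X_pow_eq {d : ℕ} (φ : Fin d → ℝ[X] →ₗ[ℝ] ℝ) (hφ : ∀ i, φ i 1 = 0)
    (Q : Fin d → ℝ[X]) (hQ : ∀ k, (Q k).Monic) (hdeg : ∀ k, (Q k).natDegree = k + 1) :
    (Matrix.of fun k i : Fin d => φ i (X ^ ((k : ℕ) + 1))).det =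
      (Matrix.of fun k i : Fin d => φ i (Q k)).det := by
  set T : Matrix (Fin d) (Fin d) ℝ := Matrix.of fun k l => (Q k).coeff (l + 1) with hT
  have h1 : (Matrix.of fun k i : Fin d => φ i (Q k)) =
      T * Matrix.of fun k i : Fin d => φ i (X ^ ((k : ℕ) + 1)) := by
    ext k i
    rw [Matrix.mul_apply]
    simp only [hT, Matrix.of_apply]
    conv_lhs => rw [(Q k).as_sum_range' (d + 1) (by rw [hdeg]; omega)]
    rw [map_sum, Finset.sum_range_succ']
    simp only [← smul_X_eq_monomial, map_smul, smul_eq_mul, pow_zero, hφ, mul_zero, add_zero]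
    rw [Fin.sum_univ_eq_sum_range fun l => (Q k).coeff (l + 1) * φ i (X ^ (l + 1))]
  have h2 : T.det = ∏ k, T k k := Matrix.det_of_isLowerTriangular T fun k l hkl => by
    have : (k : ℕ) < l := hkl
    exact coeff_eq_zero_of_natDegree_lt (by rw [hdeg]; omega)
  have h3 : ∀ k, T k k = 1 := fun k => by
    have := (hQ k).coeff_natDegree
    rwa [hdeg] at this
  rw [h1, Matrix.det_mul, h2, Finset.prod_congr rfl fun k _ => h3 k, Finset.prod_const_one, one_mul]

/-- The identification of `d = r + s` coordinates with `s` atoms and `r` weights; the weights come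
first, so that the Jacobian matrix becomes triangular in a basis of Newton polynomials. -/
def atomIndexEquiv {s r d : ℕ} (hd : d = r + s) : Fin s ⊕ Fin r ≃ Fin d :=
  (Equiv.sumComm _ _).trans (finSumFinEquiv.trans (finCongr hd.symm))

@[simp] theorem atomIndexEquiv_inl {s r d : ℕ} (hd : d = r + s) (j : Fin s) :
    (atomIndexEquiv hd (Sum.inl j) : ℕ) = r + j := by
  simp [atomIndexEquiv]

@[simp] theorem atomIndexEquiv_inr {s r d : ℕ} (hd : d = r + s) (j : Fin r) :
    (atomIndexEquiv hd (Sum.inr j) : ℕ) = j := by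
  simp [atomIndexEquiv]

/-- A confluent Vandermonde determinant: the functionals are differences of values at the nodes
`x j` and at a special node `ξ`, and multiples of the derivatives at all nodes. -/
theorem det_confluent_eq {s r d : ℕ} (hd : d = r + s) (hrs : r ≤ s) (x κ : Fin s → ℝ) (ξ : ℝ)
    (hξ : ∀ j : Fin s, r ≤ j → x j = ξ) (φ : Fin d → ℝ[X] →ₗ[ℝ] ℝ)
    (hinl : ∀ j p, φ (atomIndexEquiv hd (Sum.inl j)) p = κ j * p.derivative.eval (x j))
    (hinr : ∀ j p, φ (atomIndexEquiv hd (Sum.inr j)) p =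
      p.eval (x (Fin.castLE hrs j)) - p.eval ξ) :
    (Matrix.of fun k i : Fin d => φ i (X ^ ((k : ℕ) + 1))).det =
      (∏ j, κ j * (((X - C ξ) * Lagrange.nodal Finset.univ
          fun i => x (Fin.castLE hrs i)).derivative.eval (x j) *
            ∏ i ∈ Finset.Iio j, (x j - x i))) *
        ∏ j : Fin r, (x (Fin.castLE hrs j) - ξ) *
          ∏ i ∈ Finset.Iio j, (x (Fin.castLE hrs j) - x (Fin.castLE hrs i)) := by
  set y : Fin r → ℝ := fun i => x (Fin.castLE hrs i) with hy
  set R : ℝ[X] := (X - C ξ) * Lagrange.nodal Finset.univ y with hR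
  have hRm : R.Monic := (monic_X_sub_C ξ).mul (Lagrange.nodal_monic)
  have hRd : R.natDegree = r + 1 := by
    rw [hR, (monic_X_sub_C ξ).natDegree_mul Lagrange.nodal_monic, natDegree_X_sub_C,
      Lagrange.natDegree_nodal]
    simp [add_comm]
  have hRξ : R.eval ξ = 0 := by simp [hR]
  have hRx : ∀ j, R.eval (x j) = 0 := by
    intro j
    by_cases hj : (j : ℕ) < r
    · rw [hR, eval_mul]
      have : x j = y ⟨j, hj⟩ := rfl
      rw [this, Lagrange.eval_nodal_at_node (Finset.mem_univ _), mul_zero]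
    · rw [hξ j (by omega), hRξ]
  -- Newton polynomials that run through the nodes once and then a second time
  set q : Fin s ⊕ Fin r → ℝ[X] := Sum.elim (fun j => R * Lagrange.nodal (Finset.Iio j) x)
    (fun j => (X - C ξ) * Lagrange.nodal (Finset.Iio j) y) with hq
  set e := atomIndexEquiv hd with he
  have hqm : ∀ c, (q c).Monic := by
    rintro (j | j)
    · exact hRm.mul Lagrange.nodal_monic
    · exact (monic_X_sub_C ξ).mul Lagrange.nodal_monic
  have hqd : ∀ c, (q c).natDegree = e c + 1 := by
    rintro (j | j)
    · simp only [hq, Sum.elim_inl]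
      rw [hRm.natDegree_mul Lagrange.nodal_monic, hRd, Lagrange.natDegree_nodal]
      simp [he]; ring
    · simp only [hq, Sum.elim_inr]
      rw [(monic_X_sub_C ξ).natDegree_mul Lagrange.nodal_monic, natDegree_X_sub_C,
        Lagrange.natDegree_nodal]
      simp [he]; ring
  have hRder : ∀ (j : Fin s) (p : ℝ[X]), (R * p).derivative.eval (x j) =
      R.derivative.eval (x j) * p.eval (x j) := by
    intro j p
    rw [derivative_mul, eval_add, eval_mul, eval_mul, hRx]
    ring
  rw [det_functional_X_pow_eq φ ?_ (fun k => q (e.symm k)) (fun k => hqm _)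
    (fun k => by rw [hqd, e.apply_symm_apply]),
    Matrix.det_of_isUpperTriangular, ← e.prod_comp, Fintype.prod_sum_type]
  · congr 1
    · refine Finset.prod_congr rfl fun j _ => ?_
      simp only [Matrix.of_apply, e.symm_apply_apply]
      rw [hinl]
      simp only [hq, Sum.elim_inl]
      rw [hRder, Lagrange.eval_nodal]
    · refine Finset.prod_congr rfl fun j _ => ?_
      simp only [Matrix.of_apply, e.symm_apply_apply]
      rw [hinr]
      simp only [hq, Sum.elim_inr, eval_mul, eval_sub, eval_X, eval_C, Lagrange.eval_nodal]
      ring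
  · intro k i hik
    obtain ⟨k, rfl⟩ := e.surjective k
    obtain ⟨i, rfl⟩ := e.surjective i
    have hik' : (e i : ℕ) < e k := hik
    simp only [Matrix.of_apply, e.symm_apply_apply]
    rcases k with k | k <;> rcases i with i | i
    · have hlt : i < k := by
        rw [he] at hik'
        simp only [atomIndexEquiv_inl] at hik'
        exact Fin.lt_def.2 (by omega)
      rw [hinl]
      simp only [hq, Sum.elim_inl]
      rw [hRder, Lagrange.eval_nodal_at_node (Finset.mem_Iio.2 hlt)]
      ring
    · rw [hinr]
      simp only [hq, Sum.elim_inl, eval_mul, hRx, hRξ]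
      ring
    · rw [he] at hik'
      simp only [atomIndexEquiv_inl, atomIndexEquiv_inr] at hik'
      omega
    · have hlt : i < k := by
        rw [he] at hik'
        simp only [atomIndexEquiv_inr] at hik'
        exact Fin.lt_def.2 (by omega)
      rw [hinr]
      simp only [hq, Sum.elim_inr, eval_mul]
      have : x (Fin.castLE hrs i) = y i := rfl
      rw [this, Lagrange.eval_nodal_at_node (Finset.mem_Iio.2 hlt)]
      simp
  · intro i
    obtain ⟨i, rfl⟩ := e.surjective i
    rcases i with i | i
    · rw [hinl]; simp
    · rw [hinr]; simp

theorem prod_Iio_eq_prod_Ioi {s : ℕ} (x : Fin s → ℝ) :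
    ∏ j, ∏ i ∈ Finset.Iio j, (x j - x i) = ∏ i, ∏ j ∈ Finset.Ioi i, (x j - x i) :=
  Finset.prod_comm' (by simp)

theorem abs_prod_erase_eq {s : ℕ} (x : Fin s → ℝ) :
    |∏ j, ∏ i ∈ Finset.univ.erase j, (x j - x i)| =
      (∏ i, ∏ j ∈ Finset.Ioi i, (x j - x i)) ^ 2 := by
  have h := Finset.prod_prod_Ioi_mul_eq_prod_prod_off_diag fun j i : Fin s => x i - x j
  have h2 : ∀ j : Fin s, Finset.univ.erase j = {j}ᶜ := fun j => by ext; simp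
  simp only [h2, ← h, Finset.abs_prod]
  rw [← sq_abs]
  simp only [Finset.abs_prod, ← Finset.prod_pow]
  refine Finset.prod_congr rfl fun i _ => Finset.prod_congr rfl fun j _ => ?_
  rw [abs_mul, abs_sub_comm (x i), sq]

/-- The confluent Vandermonde determinant when all but one of the masses are free. -/
theorem abs_det_confluent_last {r d : ℕ} (hd : d = r + (r + 1)) (x κ : Fin (r + 1) → ℝ)
    (φ : Fin d → ℝ[X] →ₗ[ℝ] ℝ)
    (hinl : ∀ j p, φ (atomIndexEquiv hd (Sum.inl j)) p = κ j * p.derivative.eval (x j))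
    (hinr : ∀ j p, φ (atomIndexEquiv hd (Sum.inr j)) p =
      p.eval (x (Fin.castLE r.le_succ j)) - p.eval (x (Fin.last r))) :
    |(Matrix.of fun k i : Fin d => φ i (X ^ ((k : ℕ) + 1))).det| =
      |∏ j, κ j| * (∏ i, ∏ j ∈ Finset.Ioi i, (x j - x i)) ^ 4 := by
  have hR : (X - C (x (Fin.last r))) * Lagrange.nodal Finset.univ
      (fun i => x (Fin.castLE r.le_succ i)) = Lagrange.nodal Finset.univ x := by
    rw [Lagrange.nodal, Lagrange.nodal, Fin.prod_univ_castSucc, mul_comm]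
    rfl
  rw [det_confluent_eq hd r.le_succ x κ (x (Fin.last r))
    (fun j hj => by congr 1; exact Fin.ext (by simp; omega)) φ hinl hinr, hR]
  simp only [Lagrange.eval_nodal_derivative_eval_node_eq (Finset.mem_univ _), Lagrange.eval_nodal]
  rw [Finset.prod_mul_distrib, Finset.prod_mul_distrib, prod_Iio_eq_prod_Ioi]
  have hlast : |∏ j : Fin r, (x (Fin.castLE r.le_succ j) - x (Fin.last r)) *
      ∏ i ∈ Finset.Iio j, (x (Fin.castLE r.le_succ j) - x (Fin.castLE r.le_succ i))| =
      |∏ i, ∏ j ∈ Finset.Ioi i, (x j - x i)| := by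
    rw [← prod_Iio_eq_prod_Ioi, Fin.prod_univ_castSucc]
    simp only [Fin.Iio_castSucc, Fin.Iio_last_eq_map, Finset.prod_map]
    rw [Finset.prod_mul_distrib, mul_comm, abs_mul, abs_mul]
    congr 1
    rw [Finset.abs_prod, Finset.abs_prod]
    exact Finset.prod_congr rfl fun i _ => abs_sub_comm _ _
  rw [abs_mul, abs_mul, abs_mul, hlast, abs_prod_erase_eq, mul_assoc, mul_assoc, ← abs_mul,
    abs_mul_self]
  ring

/-- The confluent Vandermonde determinant with an additional atom at the origin. -/
theorem abs_det_confluent_zero {r d : ℕ} (hd : d = r + r) (x κ : Fin r → ℝ)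
    (φ : Fin d → ℝ[X] →ₗ[ℝ] ℝ)
    (hinl : ∀ j p, φ (atomIndexEquiv hd (Sum.inl j)) p = κ j * p.derivative.eval (x j))
    (hinr : ∀ j p, φ (atomIndexEquiv hd (Sum.inr j)) p =
      p.eval (x (Fin.castLE le_rfl j)) - p.eval 0) :
    |(Matrix.of fun k i : Fin d => φ i (X ^ ((k : ℕ) + 1))).det| =
      |∏ j, κ j| * (∏ j, x j) ^ 2 * (∏ i, ∏ j ∈ Finset.Ioi i, (x j - x i)) ^ 4 := by
  rw [det_confluent_eq hd le_rfl x κ 0 (fun j hj => absurd j.2 (by omega)) φ hinl hinr]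
  have hder : ∀ j, ((X - C 0) * Lagrange.nodal Finset.univ
      fun i => x (Fin.castLE le_rfl i)).derivative.eval (x j) =
        x j * ∏ i ∈ Finset.univ.erase j, (x j - x i) := by
    intro j
    simp only [Fin.castLE_rfl, id_eq]
    rw [derivative_mul, eval_add, eval_mul, eval_mul, Lagrange.eval_nodal_at_node
      (Finset.mem_univ j), mul_zero, zero_add, Lagrange.eval_nodal_derivative_eval_node_eq
      (Finset.mem_univ _), Lagrange.eval_nodal]
    simp
  simp only [Fin.castLE_rfl, id_eq] at hder ⊢
  simp only [hder, sub_zero]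
  rw [Finset.prod_mul_distrib, Finset.prod_mul_distrib, Finset.prod_mul_distrib,
    Finset.prod_mul_distrib, prod_Iio_eq_prod_Ioi]
  set D := ∏ i, ∏ j ∈ Finset.Ioi i, (x j - x i) with hD
  have h1 : (∏ j, κ j) * ((∏ j, x j) * (∏ j, ∏ i ∈ Finset.univ.erase j, (x j - x i)) * D) *
      ((∏ j, x j) * D) = (∏ j, κ j) * (∏ j, ∏ i ∈ Finset.univ.erase j, (x j - x i)) *
        (((∏ j, x j) * D) * ((∏ j, x j) * D)) := by ring
  rw [h1, abs_mul, abs_mul, abs_prod_erase_eq, abs_mul_self]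
  ring

end Confluent

/-- The list of `s` masses, of which the first `r` are given; each remaining one is the mass that
is missing to a total of `1`. Only `r ≤ s ≤ r + 1` is of interest. -/
noncomputable def fullWeight {s r : ℕ} (w : Fin r → ℝ) (j : Fin s) : ℝ :=
  if h : (j : ℕ) < r then w ⟨j, h⟩ else 1 - ∑ i, w i

/-- The even moments of orders `2, …, 2 d` of the symmetric measure with atoms `± l j` of total
masses `fullWeight w j`. -/
noncomputable def atomMoment (d : ℕ) {s r : ℕ} (p : (Fin s → ℝ) × (Fin r → ℝ)) (k : Fin d) : ℝ :=
  ∑ j, fullWeight p.2 j * p.1 j ^ (2 * ((k : ℕ) + 1))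

/-- Coordinates on the space of atoms and free weights. -/
def atomCoords {s r d : ℕ} (hd : d = r + s) : (Fin d → ℝ) ≃ᵐ (Fin s → ℝ) × (Fin r → ℝ) :=
  (MeasurableEquiv.arrowCongr' (atomIndexEquiv hd).symm (MeasurableEquiv.refl ℝ)).trans
    (MeasurableEquiv.sumPiEquivProdPi fun _ => ℝ)

theorem atomCoords_apply {s r d : ℕ} (hd : d = r + s) (z : Fin d → ℝ) :
    atomCoords hd z = (fun j => z (atomIndexEquiv hd (Sum.inl j)),
      fun j => z (atomIndexEquiv hd (Sum.inr j))) := rfl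

theorem measurePreserving_atomCoords {s r d : ℕ} (hd : d = r + s) :
    MeasurePreserving (atomCoords (s := s) (r := r) hd) volume volume :=
  (volume_measurePreserving_sumPiEquivProdPi fun _ => ℝ).comp
    (volume_preserving_arrowCongr' _ _ (MeasurePreserving.id _))

theorem hasDerivAt_atomMoment_line {s r d : ℕ} (p v : (Fin s → ℝ) × (Fin r → ℝ)) (k : Fin d) :
    HasDerivAt (fun t : ℝ => atomMoment d (p + t • v) k)
      (∑ j : Fin s, ((if h : (j : ℕ) < r then v.2 ⟨j, h⟩ else -∑ i, v.2 i) *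
        p.1 j ^ (2 * ((k : ℕ) + 1)) + fullWeight p.2 j *
          (2 * ((k : ℝ) + 1) * p.1 j ^ (2 * (k : ℕ) + 1) * v.1 j))) 0 := by
  unfold atomMoment
  refine HasDerivAt.fun_sum fun j _ => ?_
  have hline : ∀ b c : ℝ, HasDerivAt (fun t : ℝ => b + t * c) c 0 := fun b c => by
    simpa using ((hasDerivAt_id (0 : ℝ)).mul_const c).const_add b
  have h1 : HasDerivAt (fun t : ℝ => fullWeight (p + t • v).2 j)
      (if h : (j : ℕ) < r then v.2 ⟨j, h⟩ else -∑ i, v.2 i) 0 := by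
    unfold fullWeight
    split_ifs with h
    · exact hline _ _
    · exact (HasDerivAt.fun_sum fun i _ => hline (p.2 i) (v.2 i)).const_sub 1
  have h2 : HasDerivAt (fun t : ℝ => (p + t • v).1 j ^ (2 * ((k : ℕ) + 1)))
      (2 * ((k : ℝ) + 1) * p.1 j ^ (2 * (k : ℕ) + 1) * v.1 j) 0 := by
    have := (hline (p.1 j) (v.1 j)).pow (2 * ((k : ℕ) + 1))
    convert! this using 1
    rw [show 2 * ((k : ℕ) + 1) - 1 = 2 * k + 1 by omega]
    push_cast
    ring
  convert! h1.mul h2 using 1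
  simp

theorem differentiable_atomMoment {s r d : ℕ} (hd : d = r + s) :
    Differentiable ℝ fun z : Fin d → ℝ => atomMoment d (atomCoords (s := s) hd z) := by
  rw [differentiable_pi]
  intro k
  unfold atomMoment
  refine Differentiable.fun_sum fun j _ => ?_
  simp only [atomCoords_apply]
  refine Differentiable.mul ?_ ((differentiable_apply _).pow _)
  unfold fullWeight
  split_ifs with h
  · exact differentiable_apply _
  · exact (differentiable_const _).sub (Differentiable.fun_sum fun i _ => differentiable_apply _)

open Polynomial in
/-- The Jacobian matrix of the moments consists of the values on monomials, in the squared atoms, of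
point evaluations and of evaluations of derivatives. The node `ξ` carries the missing mass: it is
the square of the last atom if `s = r + 1`, and the origin if `s = r`. -/
theorem det_fderiv_atomMoment {s r d : ℕ} (hd : d = r + s) (hrs : r ≤ s) (z : Fin d → ℝ) (ξ : ℝ)
    (hξ : ∀ k : ℕ, ∑ j : Fin s, (if (j : ℕ) < r then 0 else
      ((atomCoords (s := s) hd z).1 j ^ 2) ^ (k + 1)) = ξ ^ (k + 1))
    (φ : Fin d → ℝ[X] →ₗ[ℝ] ℝ)
    (hinl : ∀ j p, φ (atomIndexEquiv hd (Sum.inl j)) p =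
      2 * fullWeight (atomCoords hd z).2 j * (atomCoords hd z).1 j *
        p.derivative.eval ((atomCoords (s := s) hd z).1 j ^ 2))
    (hinr : ∀ j p, φ (atomIndexEquiv hd (Sum.inr j)) p =
      p.eval ((atomCoords hd z).1 (Fin.castLE hrs j) ^ 2) - p.eval ξ) :
    (fderiv ℝ (fun z => atomMoment d (atomCoords (s := s) hd z)) z).det =
      (Matrix.of fun k i : Fin d => φ i (X ^ ((k : ℕ) + 1))).det := by
  set e := atomIndexEquiv (s := s) hd with he
  set p := atomCoords (s := s) hd z with hp
  have hline : ∀ i k : Fin d, HasDerivAt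
      (fun t : ℝ => atomMoment d (p + t • atomCoords hd (Pi.single i 1)) k)
      (fderiv ℝ (fun z => atomMoment d (atomCoords (s := s) hd z)) z (Pi.single i 1) k) 0 := by
    intro i k
    have h0 : HasFDerivAt (fun z => atomMoment d (atomCoords (s := s) hd z))
        (fderiv ℝ (fun z => atomMoment d (atomCoords (s := s) hd z)) z)
        (z + (0 : ℝ) • (Pi.single i 1 : Fin d → ℝ)) := by
      rw [zero_smul, add_zero]
      exact (differentiable_atomMoment hd z).hasFDerivAt
    have h1 : HasDerivAt (fun t : ℝ => z + t • (Pi.single i 1 : Fin d → ℝ))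
        (Pi.single i 1) 0 := by
      simpa using ((hasDerivAt_id (0 : ℝ)).smul_const (Pi.single i 1 : Fin d → ℝ)).const_add z
    exact hasDerivAt_pi.1 (h0.comp_hasDerivAt (0 : ℝ) h1) k
  rw [ContinuousLinearMap.det, ← LinearMap.det_toMatrix']
  congr 1
  ext k i
  rw [LinearMap.toMatrix'_apply, Matrix.of_apply]
  refine ((hline i k).unique (hasDerivAt_atomMoment_line p _ k)).trans ?_
  obtain ⟨i, rfl⟩ := e.surjective i
  rcases i with i | i
  · rw [hinl, atomCoords_apply, ← he, Finset.sum_eq_single i]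
    · simp
      ring
    · intro j _ hji
      simp [hji]
    · simp
  · rw [hinr, atomCoords_apply, ← he]
    have hsplit : ∀ j : Fin s, ((if h : (j : ℕ) < r then
        (Pi.single (e (Sum.inr i)) (1 : ℝ) : Fin d → ℝ) (e (Sum.inr ⟨j, h⟩)) else
          -∑ i', (Pi.single (e (Sum.inr i)) (1 : ℝ) : Fin d → ℝ) (e (Sum.inr i'))) *
        p.1 j ^ (2 * ((k : ℕ) + 1)) + fullWeight p.2 j *
          (2 * ((k : ℝ) + 1) * p.1 j ^ (2 * (k : ℕ) + 1) *
            (Pi.single (e (Sum.inr i)) (1 : ℝ) : Fin d → ℝ) (e (Sum.inl j)))) =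
        (if j = Fin.castLE hrs i then (p.1 j ^ 2) ^ ((k : ℕ) + 1) else 0) -
          (if (j : ℕ) < r then 0 else (p.1 j ^ 2) ^ ((k : ℕ) + 1)) := by
      intro j
      have hi := i.2
      by_cases h : (j : ℕ) < r
      · simp [Pi.single_apply, h, Fin.ext_iff, ← pow_mul]
      · have : j ≠ Fin.castLE hrs i := fun h' => h (by simp [h'])
        simp [Pi.single_apply, h, this, ← pow_mul]
    refine (Finset.sum_congr rfl fun j _ => hsplit j).trans ?_
    rw [Finset.sum_sub_distrib, hξ]
    simp

open Polynomial in
theorem exists_confluent_functionals {s r d : ℕ} (hd : d = r + s) (hrs : r ≤ s) (x κ : Fin s → ℝ)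
    (ξ : ℝ) : ∃ φ : Fin d → ℝ[X] →ₗ[ℝ] ℝ,
      (∀ j p, φ (atomIndexEquiv hd (Sum.inl j)) p = κ j * p.derivative.eval (x j)) ∧
      ∀ j p, φ (atomIndexEquiv hd (Sum.inr j)) p =
        p.eval (x (Fin.castLE hrs j)) - p.eval ξ := by
  refine ⟨fun i => Sum.elim (fun j => κ j • (leval (x j)).comp derivative)
    (fun j => leval (x (Fin.castLE hrs j)) - leval ξ) ((atomIndexEquiv hd).symm i), ?_, ?_⟩
  · intro j p
    simp [leval]
  · intro j p
    simp [leval]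

theorem abs_det_fderiv_atomMoment_last {r d : ℕ} (hd : d = r + (r + 1)) (z : Fin d → ℝ)
    {l : Fin (r + 1) → ℝ} {w : Fin r → ℝ} (hz : atomCoords hd z = (l, w)) :
    |(fderiv ℝ (fun z => atomMoment d (atomCoords (s := r + 1) hd z)) z).det| =
      |∏ j, 2 * fullWeight w j * l j| *
        (∏ i, ∏ j ∈ Finset.Ioi i, (l j ^ 2 - l i ^ 2)) ^ 4 := by
  obtain ⟨φ, h1, h2⟩ := exists_confluent_functionals hd r.le_succ (fun j => l j ^ 2)
    (fun j => 2 * fullWeight w j * l j) (l (Fin.last r) ^ 2)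
  rw [det_fderiv_atomMoment hd r.le_succ z (l (Fin.last r) ^ 2) ?_ φ ?_ ?_,
    abs_det_confluent_last hd (fun j => l j ^ 2) (fun j => 2 * fullWeight w j * l j) φ h1 h2]
  · intro k
    simp [Fin.sum_univ_castSucc, hz]
  · simpa [hz] using h1
  · simpa [hz] using h2

theorem abs_det_fderiv_atomMoment_zero {r d : ℕ} (hd : d = r + r) (z : Fin d → ℝ)
    {l w : Fin r → ℝ} (hz : atomCoords hd z = (l, w)) :
    |(fderiv ℝ (fun z => atomMoment d (atomCoords (s := r) hd z)) z).det| =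
      |∏ j, 2 * fullWeight w j * l j| * (∏ j, l j ^ 2) ^ 2 *
        (∏ i, ∏ j ∈ Finset.Ioi i, (l j ^ 2 - l i ^ 2)) ^ 4 := by
  obtain ⟨φ, h1, h2⟩ := exists_confluent_functionals hd le_rfl (fun j => l j ^ 2)
    (fun j => 2 * fullWeight w j * l j) 0
  rw [det_fderiv_atomMoment hd le_rfl z 0 ?_ φ ?_ ?_,
    abs_det_confluent_zero hd (fun j => l j ^ 2) (fun j => 2 * fullWeight w j * l j) φ h1 h2]
  · intro k
    simp
  · simpa [hz] using h1
  · simpa [hz] using h2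

/-! ### The correspondence between Jacobi matrices and atoms -/

/-- The mass at the origin: what is missing to a total of `1` when `r = s`, and `0` otherwise. -/
noncomputable def originWeight (s : ℕ) {r : ℕ} (w : Fin r → ℝ) : ℝ :=
  if r = s then 1 - ∑ i, w i else 0

theorem originWeight_add_sum_fullWeight {s r : ℕ} (h : s = r ∨ s = r + 1) (w : Fin r → ℝ) :
    originWeight s w + ∑ j : Fin s, fullWeight w j = 1 := by
  rcases h with rfl | rfl
  · simp [originWeight, fullWeight]
  · simp [originWeight, fullWeight, Fin.sum_univ_castSucc]

theorem fullWeight_comp_castLE {s r : ℕ} (hrs : r ≤ s) (h : s = r ∨ s = r + 1) {w : Fin s → ℝ}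
    (hw : s = r + 1 → ∑ j, w j = 1) : fullWeight (fun j => w (Fin.castLE hrs j)) = w := by
  rcases h with rfl | rfl
  · ext j
    simp [fullWeight]
  · have hw := hw rfl
    rw [Fin.sum_univ_castSucc] at hw
    have hcast : ∀ j : Fin r, Fin.castLE hrs j = j.castSucc := fun _ => rfl
    ext j
    refine Fin.lastCases ?_ (fun j => ?_) j
    · simp only [fullWeight, Fin.val_last, lt_irrefl, dite_false, hcast]
      linear_combination -hw
    · simp only [fullWeight, Fin.val_castSucc, j.2, dite_true]
      rfl

/-- The positive atoms and weights such that the atoms, read in the order `σ⁻¹`, decrease. -/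
def atomDomain {s r : ℕ} (σ : Equiv.Perm (Fin s)) : Set ((Fin s → ℝ) × (Fin r → ℝ)) :=
  {p | (∀ j, 0 < p.1 j) ∧ (∀ j, 0 < p.2 j) ∧ 0 < 1 - ∑ j, p.2 j ∧ StrictAnti (p.1 ∘ σ.symm)}

theorem measurableSet_atomDomain {s r : ℕ} (σ : Equiv.Perm (Fin s)) :
    MeasurableSet (atomDomain (r := r) σ) := by
  have : atomDomain (r := r) σ = (⋂ j, {p | 0 < p.1 j}) ∩ ((⋂ j, {p | 0 < p.2 j}) ∩
      ({p | 0 < 1 - ∑ j, p.2 j} ∩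
        ⋂ i, ⋂ j, ⋂ _ : i < j, {p | p.1 (σ.symm j) < p.1 (σ.symm i)})) := by
    ext p
    simp [atomDomain, StrictAnti]
  rw [this]
  refine (MeasurableSet.iInter fun j => ?_).inter ((MeasurableSet.iInter fun j => ?_).inter
    (MeasurableSet.inter ?_ (MeasurableSet.iInter fun i => MeasurableSet.iInter fun j =>
      MeasurableSet.iInter fun _ => ?_)))
  · exact measurableSet_lt (by fun_prop) (by fun_prop)
  · exact measurableSet_lt (by fun_prop) (by fun_prop)
  · exact measurableSet_lt (by fun_prop) (by fun_prop)
  · exact measurableSet_lt (by fun_prop) (by fun_prop)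

theorem fullWeight_pos {s r : ℕ} {w : Fin r → ℝ} (hw : ∀ j, 0 < w j) (hw' : 0 < 1 - ∑ j, w j)
    (j : Fin s) : 0 < fullWeight w j := by
  unfold fullWeight
  split_ifs
  · exact hw _
  · exact hw'

theorem originWeight_nonneg {s r : ℕ} {w : Fin r → ℝ} (hw' : 0 < 1 - ∑ j, w j) :
    0 ≤ originWeight s w := by
  unfold originWeight
  split_ifs
  · exact hw'.le
  · exact le_rfl

theorem fst_injective_of_mem_atomDomain {s r : ℕ} {σ : Equiv.Perm (Fin s)}
    {p : (Fin s → ℝ) × (Fin r → ℝ)} (hp : p ∈ atomDomain σ) : Function.Injective p.1 := by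
  have := hp.2.2.2.injective
  rwa [σ.symm.injective_comp] at this

/-- The squares of the atoms, with their masses, as a finitely supported function. -/
noncomputable def squaredAtoms {s r : ℕ} (p : (Fin s → ℝ) × (Fin r → ℝ)) : ℝ →₀ ℝ :=
  Finsupp.single 0 (originWeight s p.2) + ∑ j, Finsupp.single (p.1 j ^ 2) (fullWeight p.2 j)

theorem squaredAtoms_apply_sq {s r : ℕ} {p : (Fin s → ℝ) × (Fin r → ℝ)} {y : ℝ}
    (hy : 0 < y) (hp : ∀ j, 0 < p.1 j) :
    squaredAtoms p (y ^ 2) = ∑ j, if p.1 j = y then fullWeight p.2 j else 0 := by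
  rw [squaredAtoms, Finsupp.add_apply, Finsupp.single_eq_of_ne (pow_ne_zero 2 hy.ne'), zero_add,
    Finsupp.finsetSum_apply]
  refine Finset.sum_congr rfl fun j _ => ?_
  rw [Finsupp.single_apply]
  congr 1
  exact propext (pow_left_inj₀ (hp j).le hy.le two_ne_zero)

theorem linearCombination_squaredAtoms {s r : ℕ} (p : (Fin s → ℝ) × (Fin r → ℝ)) (k : ℕ) :
    Finsupp.linearCombination ℝ (fun x : ℝ => x ^ k) (squaredAtoms p) =
      originWeight s p.2 * 0 ^ k + ∑ j, fullWeight p.2 j * p.1 j ^ (2 * k) := by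
  simp [squaredAtoms, pow_mul]

/-- Ordered atoms and weights are determined by the even moments of orders up to `2 d`. -/
theorem atomMoment_injOn {s r d : ℕ} (hd : d = r + s) (h : s = r ∨ s = r + 1)
    (σ : Equiv.Perm (Fin s)) :
    Set.InjOn (atomMoment d) (atomDomain (s := s) (r := r) σ) := by
  classical
  intro p hp q hq hpq
  have hsub : squaredAtoms p - squaredAtoms q = 0 := by
    refine eq_zero_of_moments_eq_zero (n := d + 1) ?_ fun k hk => ?_
    · have hsupp : (squaredAtoms p - squaredAtoms q).support ⊆
          (if r = s then {0} else ∅) ∪ (Finset.univ.image (fun j => p.1 j ^ 2) ∪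
            Finset.univ.image fun j => q.1 j ^ 2) := by
        intro x hx
        contrapose! hx
        simp only [Finset.mem_union, Finset.mem_image, Finset.mem_univ, true_and, not_or,
          not_exists] at hx
        obtain ⟨h0, hp', hq'⟩ := hx
        have hz : ∀ p' : (Fin s → ℝ) × (Fin r → ℝ),
            Finsupp.single (0 : ℝ) (originWeight s p'.2) x = 0 := by
          intro p'
          by_cases hrs : r = s
          · exact Finsupp.single_eq_of_ne (by simpa [hrs] using h0)
          · simp [originWeight, hrs]
        rw [Finsupp.notMem_support_iff, Finsupp.sub_apply, squaredAtoms, squaredAtoms,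
          Finsupp.add_apply, Finsupp.add_apply, Finsupp.finsetSum_apply, Finsupp.finsetSum_apply,
          hz, hz, Finset.sum_eq_zero fun j _ => Finsupp.single_eq_of_ne (Ne.symm (hp' j)),
          Finset.sum_eq_zero fun j _ => Finsupp.single_eq_of_ne (Ne.symm (hq' j))]
        simp
      refine (Finset.card_le_card hsupp).trans ((Finset.card_union_le _ _).trans ?_)
      have h1 := Finset.card_union_le (Finset.univ.image (fun j => p.1 j ^ 2))
        (Finset.univ.image fun j => q.1 j ^ 2)
      have h2 := Finset.card_image_le (s := Finset.univ) (f := fun j => p.1 j ^ 2)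
      have h3 := Finset.card_image_le (s := Finset.univ) (f := fun j => q.1 j ^ 2)
      simp only [Finset.card_univ, Fintype.card_fin] at h2 h3
      split_ifs with hrs
      · rw [Finset.card_singleton]; omega
      · rw [Finset.card_empty]; omega
    · rw [map_sub, linearCombination_squaredAtoms, linearCombination_squaredAtoms, sub_eq_zero]
      rcases k with _ | k
      · simp [originWeight_add_sum_fullWeight h]
      · have := congrFun hpq ⟨k, by omega⟩
        simpa [atomMoment] using this
  have heq : ∀ y, squaredAtoms p y = squaredAtoms q y := fun y => by rw [sub_eq_zero.1 hsub]
  have happly : ∀ p : (Fin s → ℝ) × (Fin r → ℝ), p ∈ atomDomain σ → ∀ j,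
      squaredAtoms p (p.1 j ^ 2) = fullWeight p.2 j := by
    intro p hp j
    rw [squaredAtoms_apply_sq (hp.1 j) hp.1]
    simp [(fst_injective_of_mem_atomDomain hp).eq_iff]
  have hrange : ∀ p q : (Fin s → ℝ) × (Fin r → ℝ), p ∈ atomDomain σ → q ∈ atomDomain σ →
      (∀ y, squaredAtoms p y = squaredAtoms q y) → Set.range p.1 ⊆ Set.range q.1 := by
    rintro p q hp hq heq _ ⟨j, rfl⟩
    have h1 := happly p hp j
    rw [heq, squaredAtoms_apply_sq (hp.1 j) hq.1] at h1
    have h2 := (fullWeight_pos hp.2.1 hp.2.2.1 j).ne'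
    rw [← h1] at h2
    obtain ⟨i, -, hi⟩ := Finset.exists_ne_zero_of_sum_ne_zero h2
    exact ⟨i, by by_contra h'; simp [h'] at hi⟩
  have hl : p.1 = q.1 := by
    have h1 : Set.range p.1 = Set.range q.1 :=
      (hrange p q hp hq heq).antisymm (hrange q p hq hp fun y => (heq y).symm)
    have h2 : p.1 ∘ σ.symm = q.1 ∘ σ.symm := by
      refine (hp.2.2.2.range_inj hq.2.2.2).1 ?_
      rw [σ.symm.surjective.range_comp, σ.symm.surjective.range_comp, h1]
    ext j
    have := congrFun h2 (σ j)
    simpa using this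
  have hw : ∀ j : Fin s, fullWeight p.2 j = fullWeight q.2 j := by
    intro j
    rw [← happly p hp j, ← happly q hq j, heq, hl]
  refine Prod.ext hl ?_
  ext j
  have := hw ⟨j, by omega⟩
  simpa [fullWeight] using this

/-- The moments of the symmetric measure with atoms and weights `p` are those of the Jacobi matrix
with off-diagonal entries `a`, and the traces of the squares agree. The traces are recorded because
the Gaussian factors of the densities depend on them. -/
def IsSpectralData {s r d : ℕ} (a : Fin d → ℝ) (p : (Fin s → ℝ) × (Fin r → ℝ)) : Prop :=
  (∀ k, (Pi.single ⟨0, d.succ_pos⟩ 1 : Fin (d + 1) → ℝ) ⬝ᵥ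
      (zeroDiagJacobi (N := d + 1) a ^ k).mulVec (Pi.single ⟨0, d.succ_pos⟩ 1) =
    originWeight s p.2 * 0 ^ k + ∑ j, fullWeight p.2 j / 2 * (p.1 j ^ k + (-p.1 j) ^ k)) ∧
  ∑ i, a i ^ 2 = ∑ j, p.1 j ^ 2

theorem IsSpectralData.sum_mul_jacobiVec {s r d : ℕ} {a : Fin d → ℝ}
    {p : (Fin s → ℝ) × (Fin r → ℝ)} (h : IsSpectralData a p) (j k n : ℕ) (hjk : j + k = 2 * n) :
    ∑ i ∈ Finset.range (d + 1), jacobiVec (zeroExtend a) j i * jacobiVec (zeroExtend a) k i =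
      originWeight s p.2 * 0 ^ n + ∑ i, fullWeight p.2 i * (p.1 i ^ 2) ^ n := by
  have h1 := single_dotProduct_zeroDiagJacobi_pow (N := d + 1) a d.succ_pos j k
  rw [h.1] at h1
  refine h1.symm.trans ?_
  rw [hjk, pow_mul, zero_pow two_ne_zero]
  congr 1
  refine Finset.sum_congr rfl fun i _ => ?_
  rw [(even_two_mul n).neg_pow, pow_mul]
  ring

theorem IsSpectralData.jacobiMoment_eq {s r d : ℕ} {a : Fin d → ℝ}
    {p : (Fin s → ℝ) × (Fin r → ℝ)} (h : IsSpectralData a p) : jacobiMoment a = atomMoment d p := by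
  ext k
  have h1 := h.sum_mul_jacobiVec (k + 1) (k + 1) (k + 1) (by ring)
  rw [zero_pow (by omega), mul_zero, zero_add] at h1
  simp only [atomMoment, pow_mul]
  rw [← h1, jacobiMoment]
  have hk := k.2
  rw [← Finset.sum_subset (Finset.range_mono (by omega : (k : ℕ) + 2 ≤ d + 1)) fun i _ hi => by
    rw [jacobiVec_eq_zero_of_lt _ (by have := Finset.mem_range.not.1 hi; omega), mul_zero]]
  exact Finset.sum_congr rfl fun i _ => by ring

theorem exists_isSpectralData {s r d : ℕ} (hd : d = r + s) (h : s = r ∨ s = r + 1)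
    {a : Fin d → ℝ} (ha : ∀ i, 0 < a i) :
    ∃ p : (Fin s → ℝ) × (Fin r → ℝ), p ∈ atomDomain 1 ∧ IsSpectralData a p := by
  have hrs : r ≤ s := by omega
  obtain ⟨l, w, w₀, hl, hl0, hw, h1, h2, h3, h4⟩ :=
    exists_symmetric_atoms_zeroDiagJacobi (N := d + 1) (a := a) ha d.succ_pos (s := s) (by omega)
  have hsum : w₀ + ∑ j, w j = 1 := by
    have := h3 0
    rw [pow_zero, Matrix.one_mulVec, single_one_dotProduct, Pi.single_eq_same] at this
    rw [this, pow_zero, mul_one]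
    congr 1
    exact Finset.sum_congr rfl fun j _ => by ring
  have hfull : fullWeight (fun j => w (Fin.castLE hrs j)) = w :=
    fullWeight_comp_castLE hrs h fun hs => by
      rw [h1 (by omega), zero_add] at hsum
      exact hsum
  have horig : originWeight s (fun j => w (Fin.castLE hrs j)) = w₀ := by
    have := originWeight_add_sum_fullWeight h (fun j => w (Fin.castLE hrs j))
    rw [hfull] at this
    linarith
  refine ⟨(l, fun j => w (Fin.castLE hrs j)), ⟨hl0, fun j => hw _, ?_, ?_⟩, ?_, h4⟩
  · rcases h with rfl | rfl
    · have := h2 (by omega)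
      simp only [Fin.castLE_rfl, id_eq]
      linarith
    · have := hw (Fin.last r)
      rw [h1 (by omega), zero_add, Fin.sum_univ_castSucc] at hsum
      have h5 : ∑ j : Fin r, w (Fin.castLE hrs j) = ∑ j : Fin r, w j.castSucc := rfl
      simp only [h5]
      linarith
  · exact hl
  · intro k
    simp only [hfull, horig]
    exact h3 k

/-- The ordered atoms and weights are a measurable function of the Jacobi matrix. -/
theorem exists_measurable_isSpectralData {s r d : ℕ} (hd : d = r + s) (h : s = r ∨ s = r + 1) :
    ∃ T : (Fin d → ℝ) → (Fin s → ℝ) × (Fin r → ℝ), Measurable T ∧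
      ∀ a, (∀ i, 0 < a i) → T a ∈ atomDomain 1 ∧ IsSpectralData a (T a) := by
  have hcont : Continuous (atomMoment d (s := s) (r := r)) := by
    have : Continuous fun z : Fin d → ℝ => atomMoment d (atomCoords (s := s) (r := r) hd z) :=
      (differentiable_atomMoment hd).continuous
    have h2 : Continuous (atomCoords (s := s) (r := r) hd).symm := by
      refine continuous_pi fun i => ?_
      obtain ⟨i, rfl⟩ := (atomIndexEquiv hd).surjective i
      have h3 : ∀ p : (Fin s → ℝ) × (Fin r → ℝ), (atomCoords hd).symm p (atomIndexEquiv hd i) =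
          Sum.elim p.1 p.2 i := by
        intro p
        have := (atomCoords hd).apply_symm_apply p
        rw [atomCoords_apply] at this
        rcases i with i | i
        · exact congrFun (congrArg Prod.fst this) i
        · exact congrFun (congrArg Prod.snd this) i
      simp only [h3]
      rcases i with i | i
      · exact (continuous_apply i).comp continuous_fst
      · exact (continuous_apply i).comp continuous_snd
    have h4 := this.comp h2
    refine h4.congr fun p => ?_
    simp
  have hemb := hcont.continuousOn.measurableEmbedding (measurableSet_atomDomain 1)
    (atomMoment_injOn (r := r) hd h 1)
  obtain ⟨T, hT, hTc⟩ := hemb.exists_measurable_extend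
    (g := (Subtype.val : atomDomain (s := s) (r := r) 1 → _)) measurable_subtype_coe
    fun _ => inferInstance
  refine ⟨T ∘ jacobiMoment, hT.comp (differentiable_jacobiMoment d).continuous.measurable,
    fun a ha => ?_⟩
  obtain ⟨p, hp, hap⟩ := exists_isSpectralData hd h ha
  have : T (jacobiMoment a) = p := by
    rw [hap.jacobiMoment_eq]
    exact congrFun hTc ⟨p, hp⟩
  rw [Function.comp_apply, this]
  exact ⟨hp, hap⟩

/-! ### Change of variables -/

/-- If two injective maps `F` and `G` have the same image, then `T = G⁻¹ ∘ F` transports densities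
according to the ratio of the Jacobian determinants. -/
theorem map_withDensity_of_image_eq {E : Type*} [NormedAddCommGroup E] [NormedSpace ℝ E]
    [FiniteDimensional ℝ E] [MeasurableSpace E] [BorelSpace E] (μ : Measure E) [μ.IsAddHaarMeasure]
    {F G T : E → E} {F' G' : E → E →L[ℝ] E} {A D : Set E} (hA : MeasurableSet A)
    (hD : MeasurableSet D) (hF : ∀ x, HasFDerivAt F (F' x) x) (hG : ∀ x, HasFDerivAt G (G' x) x)
    (hFi : Set.InjOn F A) (hGi : Set.InjOn G D) (hT : Measurable T)
    (hTA : ∀ x ∈ A, T x ∈ D ∧ G (T x) = F x) (himage : G '' D ⊆ F '' A) {ρ g : E → ℝ≥0∞}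
    (hρ : ∀ x ∈ A, ρ x * ENNReal.ofReal |(G' (T x)).det| =
      g (T x) * ENNReal.ofReal |(F' x).det|)
    (hF0 : ∀ x ∈ A, (F' x).det ≠ 0) :
    ((μ.restrict A).withDensity ρ).map T = (μ.restrict D).withDensity g := by
  classical
  ext B hB
  rw [Measure.map_apply hT hB, withDensity_apply _ (hT hB), withDensity_apply _ hB,
    Measure.restrict_restrict (hT hB), Measure.restrict_restrict hB]
  have hTG : ∀ y ∈ D, ∃ x ∈ A, F x = G y ∧ T x = y := by
    intro y hy
    obtain ⟨x, hx, hxy⟩ := himage ⟨y, hy, rfl⟩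
    exact ⟨x, hx, hxy, hGi (hTA x hx).1 hy ((hTA x hx).2.trans hxy)⟩
  have him : F '' (T ⁻¹' B ∩ A) = G '' (B ∩ D) := by
    ext y
    constructor
    · rintro ⟨x, ⟨hxB, hxA⟩, rfl⟩
      exact ⟨T x, ⟨hxB, (hTA x hxA).1⟩, (hTA x hxA).2⟩
    · rintro ⟨z, ⟨hzB, hzD⟩, rfl⟩
      obtain ⟨x, hx, hxz, hTx⟩ := hTG z hzD
      exact ⟨x, ⟨by simpa [hTx] using hzB, hx⟩, hxz⟩
  set inv : E → E := fun y => if h : ∃ x ∈ A, F x = y then h.choose else y with hinv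
  have hinvF : ∀ x ∈ A, inv (F x) = x := by
    intro x hx
    have h : ∃ x' ∈ A, F x' = F x := ⟨x, hx, rfl⟩
    simp only [hinv, h, dite_true]
    exact hFi h.choose_spec.1 hx h.choose_spec.2
  -- both integrals are the integral over the common image of the same function
  set φ : E → ℝ≥0∞ := fun y => ρ (inv y) / ENNReal.ofReal |(F' (inv y)).det| with hφ
  have hpos : ∀ x ∈ A, ENNReal.ofReal |(F' x).det| ≠ 0 := fun x hx => by
    simpa using hF0 x hx
  have h1 := lintegral_image_eq_lintegral_abs_det_fderiv_mul μ ((hT hB).inter hA)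
    (fun x _ => (hF x).hasFDerivWithinAt) (hFi.mono Set.inter_subset_right) φ
  have h2 := lintegral_image_eq_lintegral_abs_det_fderiv_mul μ (hB.inter hD)
    (fun x _ => (hG x).hasFDerivWithinAt) (hGi.mono Set.inter_subset_right) φ
  rw [← him, h1] at h2
  refine Eq.trans ?_ (h2.trans ?_)
  · refine setLIntegral_congr_fun ((hT hB).inter hA) fun x hx => ?_
    simp only [hφ, hinvF x hx.2]
    rw [ENNReal.mul_div_cancel (hpos x hx.2) ENNReal.ofReal_ne_top]
  · refine setLIntegral_congr_fun (hB.inter hD) fun y hy => ?_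
    obtain ⟨x, hx, hxy, rfl⟩ := hTG y hy.2
    simp only [hφ, ← hxy, hinvF x hx]
    rw [← mul_div_assoc, mul_comm, hρ x hx,
      ENNReal.mul_div_cancel_right (hpos x hx) ENNReal.ofReal_ne_top]

/-- The atoms and weights listed in the order `σ`. -/
noncomputable def permAtoms {s r : ℕ} (hrs : r ≤ s) (σ : Equiv.Perm (Fin s))
    (p : (Fin s → ℝ) × (Fin r → ℝ)) : (Fin s → ℝ) × (Fin r → ℝ) :=
  (fun j => p.1 (σ j), fun j => fullWeight p.2 (σ (Fin.castLE hrs j)))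

section Perm

variable {s r : ℕ} (hrs : r ≤ s) (h : s = r ∨ s = r + 1) (σ : Equiv.Perm (Fin s))
  (p : (Fin s → ℝ) × (Fin r → ℝ))

include h

theorem fullWeight_permAtoms :
    fullWeight (permAtoms hrs σ p).2 = fun j => fullWeight p.2 (σ j) := by
  refine fullWeight_comp_castLE (w := fun j => fullWeight p.2 (σ j)) hrs h fun hs => ?_
  rw [Equiv.sum_comp σ (fun j => fullWeight p.2 j), ← originWeight_add_sum_fullWeight h p.2]
  simp [originWeight, hs]

theorem originWeight_permAtoms : originWeight s (permAtoms hrs σ p).2 = originWeight s p.2 := by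
  have h1 := originWeight_add_sum_fullWeight h p.2
  have h2 := originWeight_add_sum_fullWeight h (permAtoms hrs σ p).2
  rw [fullWeight_permAtoms hrs h, Equiv.sum_comp σ (fun j => fullWeight p.2 j)] at h2
  linarith

variable {p}

theorem permAtoms_mem_atomDomain (hp : p ∈ atomDomain 1) : permAtoms hrs σ p ∈ atomDomain σ := by
  refine ⟨fun j => hp.1 _, fun j => fullWeight_pos hp.2.1 hp.2.2.1 _, ?_, ?_⟩
  · rcases h with rfl | rfl
    · have := originWeight_permAtoms hrs (Or.inl rfl) σ p
      simp only [originWeight, if_true] at this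
      rw [this]
      exact hp.2.2.1
    · have h1 := congrFun (fullWeight_permAtoms hrs (Or.inr rfl) σ p) (Fin.last r)
      have h2 := fullWeight_pos hp.2.1 hp.2.2.1 (σ (Fin.last r))
      rw [← h1] at h2
      simpa [fullWeight] using h2
  · have := hp.2.2.2
    intro i j hij
    have h2 : p.1 j < p.1 i := this hij
    simpa [_root_.permAtoms] using h2

theorem IsSpectralData.permAtoms {d : ℕ} {a : Fin d → ℝ} (hp : IsSpectralData a p) :
    IsSpectralData a (permAtoms hrs σ p) := by
  refine ⟨fun k => ?_, ?_⟩
  · rw [fullWeight_permAtoms hrs h, originWeight_permAtoms hrs h, hp.1 k]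
    congr 1
    exact (Equiv.sum_comp σ (fun j => fullWeight p.2 j / 2 * (p.1 j ^ k + (-p.1 j) ^ k))).symm
  · rw [hp.2]
    exact (Equiv.sum_comp σ (fun j => p.1 j ^ 2)).symm

end Perm

theorem measurable_fullWeight {s r : ℕ} :
    Measurable (fullWeight : (Fin r → ℝ) → Fin s → ℝ) := by
  refine measurable_pi_lambda _ fun j => ?_
  unfold fullWeight
  split_ifs
  · exact measurable_pi_apply _
  · fun_prop

theorem measurable_permAtoms {s r : ℕ} (hrs : r ≤ s) (σ : Equiv.Perm (Fin s)) :
    Measurable (permAtoms hrs σ) := by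
  refine Measurable.prodMk ?_ ?_
  · fun_prop
  · exact measurable_pi_lambda _ fun j =>
      (measurable_pi_iff.1 measurable_fullWeight _).comp measurable_snd

/-- The law of the atoms and weights listed in the order `σ`, from the law of the Jacobi matrix. -/
theorem map_permAtoms_withDensity {s r d : ℕ} (hd : d = r + s) (hrs : r ≤ s)
    (h : s = r ∨ s = r + 1) (σ : Equiv.Perm (Fin s))
    {T : (Fin d → ℝ) → (Fin s → ℝ) × (Fin r → ℝ)} (hT : Measurable T)
    (hTa : ∀ a, (∀ i, 0 < a i) → T a ∈ atomDomain 1 ∧ IsSpectralData a (T a))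
    {ρ : (Fin d → ℝ) → ℝ≥0∞} {g : (Fin s → ℝ) × (Fin r → ℝ) → ℝ≥0∞}
    (hρ : ∀ a z, (∀ i, 0 < a i) → atomCoords hd z ∈ atomDomain σ →
      IsSpectralData a (atomCoords (s := s) hd z) →
      ρ a * ENNReal.ofReal |(fderiv ℝ (fun z => atomMoment d (atomCoords (s := s) hd z)) z).det| =
        g (atomCoords hd z) * ENNReal.ofReal |(fderiv ℝ jacobiMoment a).det|) :
    ((volume.restrict {a : Fin d → ℝ | ∀ i, 0 < a i}).withDensity ρ).map
      (fun a => permAtoms hrs σ (T a)) = (volume.restrict (atomDomain σ)).withDensity g := by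
  have hmeas : MeasurableSet {a : Fin d → ℝ | ∀ i, 0 < a i} := by
    rw [Set.ofPred_forall]
    exact MeasurableSet.iInter fun i => measurableSet_lt measurable_const (measurable_pi_apply i)
  have hcoord := measurePreserving_atomCoords (s := s) hd
  have hTσ : ∀ a, (∀ i, 0 < a i) → permAtoms hrs σ (T a) ∈ atomDomain σ ∧
      IsSpectralData a (permAtoms hrs σ (T a)) := fun a ha =>
    ⟨permAtoms_mem_atomDomain hrs h σ (hTa a ha).1, (hTa a ha).2.permAtoms hrs h σ⟩
  have hTm : Measurable fun a => (atomCoords hd).symm (permAtoms hrs σ (T a)) :=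
    (atomCoords hd).symm.measurable.comp ((measurable_permAtoms hrs σ).comp hT)
  have key := map_withDensity_of_image_eq (volume : Measure (Fin d → ℝ))
    (F := jacobiMoment) (G := fun z => atomMoment d (atomCoords (s := s) hd z))
    (F' := fderiv ℝ jacobiMoment)
    (G' := fderiv ℝ fun z => atomMoment d (atomCoords (s := s) hd z))
    (T := fun a => (atomCoords hd).symm (permAtoms hrs σ (T a)))
    (A := {a | ∀ i, 0 < a i}) (D := atomCoords hd ⁻¹' atomDomain σ) (ρ := ρ)
    (g := fun z => g (atomCoords hd z)) hmeas
    ((atomCoords hd).measurable (measurableSet_atomDomain σ))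
    (fun x => (differentiable_jacobiMoment d x).hasFDerivAt)
    (fun x => (differentiable_atomMoment hd x).hasFDerivAt) (jacobiMoment_injOn d)
    (fun x hx y hy hxy => (atomCoords hd).injective (atomMoment_injOn hd h σ hx hy hxy))
    hTm ?_ ?_ ?_ ?_
  · have h1 := congrArg (fun μ => Measure.map (atomCoords hd) μ) key
    rw [Measure.map_map (atomCoords hd).measurable hTm] at h1
    have h2 : (atomCoords hd) ∘ (fun a => (atomCoords hd).symm (permAtoms hrs σ (T a))) =
        fun a => permAtoms hrs σ (T a) := by
      ext1 a
      simp
    rw [h2] at h1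
    rw [h1]
    ext B hB
    rw [Measure.map_apply (atomCoords hd).measurable hB, withDensity_apply _
      ((atomCoords hd).measurable hB), withDensity_apply _ hB, Measure.restrict_restrict
      ((atomCoords hd).measurable hB), Measure.restrict_restrict hB, ← Set.preimage_inter,
      hcoord.setLIntegral_comp_preimage_emb (atomCoords hd).measurableEmbedding]
  · intro a ha
    refine ⟨?_, ?_⟩
    · simpa using (hTσ a ha).1
    · simpa using (hTσ a ha).2.jacobiMoment_eq.symm
  · rintro _ ⟨z, hz, rfl⟩
    have hz' : atomCoords hd z ∈ atomDomain σ := hz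
    have hsum := originWeight_add_sum_fullWeight h (atomCoords hd z).2
    obtain ⟨a, ha, haz⟩ := exists_jacobiMoment_eq (d := d) (fst_injective_of_mem_atomDomain hz')
      hz'.1 (fullWeight_pos hz'.2.1 hz'.2.2.1) hsum (by
        rcases h with rfl | rfl
        · refine Or.inr ⟨?_, by omega⟩
          simpa [originWeight] using hz'.2.2.1
        · exact Or.inl ⟨by simp [originWeight], by omega⟩)
    exact ⟨a, ha, funext haz⟩
  · intro a ha
    exact hρ a _ ha (by simpa using (hTσ a ha).1) (by simpa using (hTσ a ha).2)
  · intro a ha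
    rw [det_fderiv_jacobiMoment]
    refine Finset.prod_ne_zero_iff.2 fun k _ => ?_
    have := prod_zeroExtend_pos ha k.2.le
    have := ha k
    positivity

/-! ### The law of the off-diagonal entries -/

theorem lintegral_prod_apply_eq_prod {d : ℕ} (f : Fin d → ℝ → ℝ≥0∞) (hf : ∀ i, Measurable (f i)) :
    ∫⁻ x : Fin d → ℝ, ∏ i, f i (x i) = ∏ i, ∫⁻ t, f i t := by
  induction d with
  | zero => simp [volume_pi]
  | succ d ih =>
    have h := (volume_preserving_piFinSuccAbove (fun _ : Fin (d + 1) => ℝ) 0).symm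
    rw [← h.lintegral_comp_emb (MeasurableEquiv.measurableEmbedding _)]
    simp only [Fin.prod_univ_succ, MeasurableEquiv.piFinSuccAbove_symm_apply, Fin.insertNthEquiv,
      Equiv.coe_fn_mk, Fin.insertNth_zero', Fin.cons_zero, Fin.cons_succ]
    rw [← ih (fun i => f i.succ) fun i => hf _, Measure.volume_eq_prod]
    exact lintegral_prod_mul (hf 0).aemeasurable
      (Finset.measurable_prod _ fun i _ => (hf _).comp (measurable_pi_apply i)).aemeasurable

theorem pi_withDensity_eq {d : ℕ} (f : Fin d → ℝ → ℝ≥0∞) (hf : ∀ i, Measurable (f i))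
    [∀ i, SigmaFinite ((volume : Measure ℝ).withDensity (f i))] :
    Measure.pi (fun i => (volume : Measure ℝ).withDensity (f i)) =
      (volume : Measure (Fin d → ℝ)).withDensity fun x => ∏ i, f i (x i) := by
  classical
  refine Measure.pi_eq fun s hs => ?_
  rw [withDensity_apply _ (MeasurableSet.univ_pi hs),
    ← lintegral_indicator (MeasurableSet.univ_pi hs)]
  have h : ∀ x : Fin d → ℝ, (Set.univ.pi s).indicator (fun x => ∏ i, f i (x i)) x =
      ∏ i, (s i).indicator (f i) (x i) := by
    intro x
    by_cases hx : ∀ i, x i ∈ s i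
    · rw [Set.indicator_of_mem (by simpa using hx)]
      exact Finset.prod_congr rfl fun i _ => (Set.indicator_of_mem (hx i) _).symm
    · rw [Set.indicator_of_notMem (by simpa using hx)]
      push Not at hx
      obtain ⟨i, hi⟩ := hx
      exact (Finset.prod_eq_zero (Finset.mem_univ i) (Set.indicator_of_notMem hi _)).symm
  simp_rw [h]
  rw [lintegral_prod_apply_eq_prod _ fun i => (hf i).indicator (hs i)]
  refine Finset.prod_congr rfl fun i _ => ?_
  rw [lintegral_indicator (hs i), withDensity_apply _ (hs i)]

theorem measurable_chiPDF (α : ℝ) : Measurable (chiPDF α) := by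
  unfold chiPDF
  exact Measurable.ite measurableSet_Ioi (by fun_prop) measurable_const

/-- The joint law of independent chi variables; the density is restricted to the positive cone, on
which the change of variables takes place. -/
theorem map_pi_chi {Ω : Type*} [MeasurableSpace Ω] {P : Measure Ω} [IsProbabilityMeasure P]
    {d : ℕ} {α : Fin d → ℝ} {a : Fin d → Ω → ℝ} (ha : ∀ k, HasLaw (a k) (chiMeasure (α k)) P)
    (hind : iIndepFun a P) :
    P.map (fun ω k => a k ω) = (volume.restrict {a : Fin d → ℝ | ∀ i, 0 < a i}).withDensity
      fun x => ∏ k, ENNReal.ofReal (chiPDF (α k) (x k)) := by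
  have hprob : ∀ k, IsProbabilityMeasure (chiMeasure (α k)) := fun k =>
    (ha k).isProbabilityMeasure_iff.1 inferInstance
  unfold chiMeasure at hprob
  have hmeas : MeasurableSet {a : Fin d → ℝ | ∀ i, 0 < a i} := by
    rw [Set.ofPred_forall]
    exact MeasurableSet.iInter fun i => measurableSet_lt measurable_const (measurable_pi_apply i)
  rw [(hind.hasLaw_pi ha).map_eq]
  unfold chiMeasure
  rw [pi_withDensity_eq (fun k x => ENNReal.ofReal (chiPDF (α k) x))
    fun k => (measurable_chiPDF _).ennreal_ofReal, ← withDensity_indicator hmeas]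
  congr 1
  ext x
  by_cases hx : ∀ i, 0 < x i
  · rw [Set.indicator_of_mem (by exact hx)]
  · rw [Set.indicator_of_notMem (by exact hx)]
    push Not at hx
    obtain ⟨i, hi⟩ := hx
    refine Finset.prod_eq_zero (Finset.mem_univ i) ?_
    simp [chiPDF, hi.not_gt]

/-! ### Symmetrization over the orderings -/

theorem exists_mem_atomDomain {s r : ℕ} {p : (Fin s → ℝ) × (Fin r → ℝ)} (h1 : ∀ j, 0 < p.1 j)
    (h2 : ∀ j, 0 < p.2 j) (h3 : 0 < 1 - ∑ j, p.2 j) (h4 : Function.Injective p.1) :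
    ∃ σ, p ∈ atomDomain σ := by
  set τ := Tuple.sort fun j => -p.1 j with hτ
  refine ⟨τ.symm, h1, h2, h3, ?_⟩
  have hmono : StrictMono ((fun j => -p.1 j) ∘ τ) :=
    (Tuple.monotone_sort fun j => -p.1 j).strictMono_of_injective
      ((neg_injective.comp h4).comp τ.injective)
  intro i j hij
  exact neg_lt_neg_iff.1 (hmono hij)

theorem eq_of_mem_atomDomain {s r : ℕ} {p : (Fin s → ℝ) × (Fin r → ℝ)} {σ τ : Equiv.Perm (Fin s)}
    (hσ : p ∈ atomDomain σ) (hτ : p ∈ atomDomain τ) : σ = τ := by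
  have h : p.1 ∘ σ.symm = p.1 ∘ τ.symm := by
    refine (hσ.2.2.2.range_inj hτ.2.2.2).1 ?_
    rw [σ.symm.surjective.range_comp, τ.symm.surjective.range_comp]
  have h2 : σ.symm = τ.symm := Equiv.ext fun i =>
    fst_injective_of_mem_atomDomain hσ (congrFun h i)
  simpa using congrArg Equiv.symm h2

/-- Averaging the densities of the `s!` ordered lists yields the density of the unordered list. -/
theorem average_withDensity_atomDomain {s r : ℕ} {g : (Fin s → ℝ) × (Fin r → ℝ) → ℝ≥0∞}
    (hg : ∀ p, (∀ σ, p ∉ atomDomain σ) → g p = 0) :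
    ((s.factorial : ℝ≥0∞))⁻¹ • ∑ σ : Equiv.Perm (Fin s),
      (volume.restrict (atomDomain σ)).withDensity (fun p => s.factorial * g p) =
      (volume : Measure ((Fin s → ℝ) × (Fin r → ℝ))).withDensity g := by
  have hs0 : (s.factorial : ℝ≥0∞) ≠ 0 := by exact_mod_cast s.factorial_ne_zero
  have hst : (s.factorial : ℝ≥0∞) ≠ ⊤ := ENNReal.natCast_ne_top _
  ext B hB
  rw [Measure.smul_apply, Measure.finsetSum_apply, smul_eq_mul, withDensity_apply _ hB]
  have h1 : ∀ σ : Equiv.Perm (Fin s),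
      (volume.restrict (atomDomain (r := r) σ)).withDensity (fun p => s.factorial * g p) B =
        s.factorial * ∫⁻ p in B ∩ atomDomain σ, g p := by
    intro σ
    rw [withDensity_apply _ hB, lintegral_const_mul' _ _ hst, Measure.restrict_restrict hB]
  simp_rw [h1]
  rw [← Finset.mul_sum, ← mul_assoc, ENNReal.inv_mul_cancel hs0 hst, one_mul,
    ← tsum_fintype (L := .unconditional _),
    ← lintegral_iUnion (fun σ => hB.inter (measurableSet_atomDomain σ))]
  · have hU : MeasurableSet (⋃ σ : Equiv.Perm (Fin s), B ∩ atomDomain (r := r) σ) :=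
      MeasurableSet.iUnion fun σ => hB.inter (measurableSet_atomDomain σ)
    rw [← lintegral_indicator hU, ← lintegral_indicator hB]
    congr 1
    ext p
    by_cases hpB : p ∈ B
    · by_cases hp : ∃ σ, p ∈ atomDomain σ
      · rw [Set.indicator_of_mem (by simpa [hpB] using hp), Set.indicator_of_mem hpB]
      · push Not at hp
        rw [Set.indicator_of_notMem (by simpa [hpB] using hp), Set.indicator_of_mem hpB, hg p hp]
    · rw [Set.indicator_of_notMem (by simp [hpB]), Set.indicator_of_notMem hpB]
  · intro σ τ hστ
    rw [Function.onFun, Set.disjoint_left]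
    exact fun p hp hp' => hστ (eq_of_mem_atomDomain hp.2 hp'.2)

/-! ### The spectral measure as a measure -/

theorem isSpectralMeasure_of_moments {N s : ℕ} {A : Matrix (Fin N) (Fin N) ℝ} {i : Fin N}
    {l w : Fin s → ℝ} {w₀ : ℝ} (hw₀ : 0 ≤ w₀) (hw : ∀ j, 0 ≤ w j) (hsum : w₀ + ∑ j, w j = 1)
    (hmom : ∀ k, (Pi.single i 1 : Fin N → ℝ) ⬝ᵥ (A ^ k).mulVec (Pi.single i 1) =
      w₀ * 0 ^ k + ∑ j, w j / 2 * (l j ^ k + (-l j) ^ k)) :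
    IsSpectralMeasure A i (ENNReal.ofReal w₀ • Measure.dirac 0 + symmetricAtoms l w) := by
  have hw2 : ∀ j, 0 ≤ w j / 2 := fun j => div_nonneg (hw j) two_pos.le
  have hd : ∀ (f : ℝ → ℝ) (x : ℝ), Integrable f (Measure.dirac x) := fun f x =>
    integrable_dirac (by simp)
  have hint : ∀ (f : ℝ → ℝ) (j : Fin s), Integrable f
      (ENNReal.ofReal (w j / 2) • (Measure.dirac (l j) + Measure.dirac (-l j))) := fun f j =>
    ((hd f _).add_measure (hd f _)).smul_measure ENNReal.ofReal_ne_top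
  have hint0 : ∀ f : ℝ → ℝ, Integrable f (ENNReal.ofReal w₀ • Measure.dirac 0) := fun f =>
    (hd f _).smul_measure ENNReal.ofReal_ne_top
  have hints : ∀ f : ℝ → ℝ, Integrable f (symmetricAtoms l w) := fun f =>
    integrable_finsetSum_measure.2 fun j _ => hint f j
  refine ⟨⟨?_⟩, fun k => ⟨(hint0 _).add_measure (hints _), ?_⟩⟩
  · simp only [symmetricAtoms, Measure.add_apply, Measure.smul_apply, Measure.finsetSum_apply,
      measure_univ, smul_eq_mul, mul_one]
    have h2 : ∀ j, ENNReal.ofReal (w j / 2) * (1 + 1) = ENNReal.ofReal (w j) := by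
      intro j
      rw [mul_add, mul_one, ← ENNReal.ofReal_add (hw2 j) (hw2 j), add_halves]
    simp only [h2]
    rw [← ENNReal.ofReal_sum_of_nonneg fun j _ => hw j, ← ENNReal.ofReal_add hw₀
      (Finset.sum_nonneg fun j _ => hw j), hsum, ENNReal.ofReal_one]
  · rw [hmom, integral_add_measure (hint0 _) (hints _), symmetricAtoms,
      integral_finsetSum_measure fun j _ => hint _ j, integral_smul_measure, integral_dirac,
      ENNReal.toReal_ofReal hw₀, smul_eq_mul]
    congr 1
    refine Finset.sum_congr rfl fun j _ => ?_
    rw [integral_smul_measure, integral_add_measure (hd _ _) (hd _ _), integral_dirac,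
      integral_dirac, ENNReal.toReal_ofReal (hw2 j), smul_eq_mul]

/-! ### Random Jacobi matrices with independent chi entries -/

/-- The law of the randomly ordered atoms and weights of a random zero-diagonal Jacobi matrix with
independent chi entries has density `g`, once the densities match at corresponding points. -/
theorem exists_atoms_of_chi_entries {Ω : Type*} [MeasurableSpace Ω] {P : Measure Ω}
    [IsProbabilityMeasure P] {N s r : ℕ} (hN : N = r + s + 1) (hrs : r ≤ s)
    (h : s = r ∨ s = r + 1) {J : Ω → Matrix (Fin N) (Fin N) ℝ} {a : Fin (N - 1) → Ω → ℝ}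
    {α : Fin (N - 1) → ℝ} (ha : ∀ k, HasLaw (a k) (chiMeasure (α k)) P) (hind : iIndepFun a P)
    (hJ : ∀ᵐ ω ∂P, J ω = zeroDiagJacobi fun k => a k ω)
    {g : (Fin s → ℝ) × (Fin r → ℝ) → ℝ≥0∞} (hg : ∀ p, (∀ σ, p ∉ atomDomain σ) → g p = 0)
    (hρ : ∀ (hd : N - 1 = r + s) (a z : Fin (N - 1) → ℝ), (∀ i, 0 < a i) →
      ∀ σ, atomCoords hd z ∈ atomDomain σ → IsSpectralData a (atomCoords (s := s) hd z) →
      (∏ k, ENNReal.ofReal (chiPDF (α k) (a k))) * ENNReal.ofReal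
        |(fderiv ℝ (fun z => atomMoment (N - 1) (atomCoords (s := s) hd z)) z).det| =
        s.factorial * g (atomCoords hd z) * ENNReal.ofReal |(fderiv ℝ jacobiMoment a).det|) :
    ∃ T : Ω → (Fin s → ℝ) × (Fin r → ℝ), Measurable T ∧
      (∀ᵐ ω ∂P, T ω ∈ atomDomain 1 ∧ IsSpectralMeasure (J ω) ⟨0, by omega⟩
        (ENNReal.ofReal (originWeight s (T ω).2) • Measure.dirac 0 +
          symmetricAtoms (T ω).1 (fullWeight (T ω).2))) ∧
      randomOrderLaw P hrs (fun ω => (T ω).1) (fun ω => fullWeight (T ω).2) =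
        (volume : Measure ((Fin s → ℝ) × (Fin r → ℝ))).withDensity g := by
  subst hN
  have hd : r + s + 1 - 1 = r + s := rfl
  obtain ⟨T, hT, hTa⟩ := exists_measurable_isSpectralData hd h
  have hlaw := map_pi_chi ha hind
  have hmeas : AEMeasurable (fun ω k => a k ω) P := (hind.hasLaw_pi ha).aemeasurable
  have hpos : ∀ᵐ ω ∂P, ∀ k, 0 < a k ω := by
    have hset : MeasurableSet {x : Fin (r + s + 1 - 1) → ℝ | ∀ i, 0 < x i} := by
      rw [Set.ofPred_forall]
      exact MeasurableSet.iInter fun i => measurableSet_lt measurable_const (measurable_pi_apply i)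
    have : ∀ᵐ x ∂(P.map fun ω k => a k ω), ∀ i, 0 < x i := by
      rw [hlaw]
      exact (withDensity_absolutelyContinuous _ _).ae_le (ae_restrict_mem hset)
    exact ae_of_ae_map hmeas this
  set X := hmeas.mk with hX
  refine ⟨fun ω => T (X ω), hT.comp hmeas.measurable_mk, ?_, ?_⟩
  · filter_upwards [hJ, hpos, hmeas.ae_eq_mk] with ω h1 h2 h3
    have h4 : X ω = fun k => a k ω := h3.symm
    have h5 := hTa (X ω) (by rw [h4]; exact h2)
    refine ⟨h5.1, ?_⟩
    rw [h1, ← h4]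
    exact isSpectralMeasure_of_moments (originWeight_nonneg h5.1.2.2.1)
      (fun j => (fullWeight_pos h5.1.2.1 h5.1.2.2.1 j).le)
      (originWeight_add_sum_fullWeight h _) h5.2.1
  · rw [← average_withDensity_atomDomain hg, randomOrderLaw]
    congr 1
    refine Finset.sum_congr rfl fun σ _ => ?_
    have h1 := map_permAtoms_withDensity hd hrs h σ hT hTa
      (ρ := fun x => ∏ k, ENNReal.ofReal (chiPDF (α k) (x k)))
      (g := fun p => s.factorial * g p) fun a z ha hz haz => hρ hd a z ha σ hz haz
    rw [← h1, ← hlaw, Measure.map_congr (f := fun ω k => a k ω) (g := X) hmeas.ae_eq_mk]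
    have h2 : Measurable fun a => permAtoms hrs σ (T a) := (measurable_permAtoms hrs σ).comp hT
    exact (Measure.map_map h2 hmeas.measurable_mk).symm

/-! ### The ratio of the Jacobians -/

theorem prod_range_two_mul {M : Type*} [CommMonoid M] (f : ℕ → M) (n : ℕ) :
    ∏ k ∈ Finset.range (2 * n), f k =
      (∏ j ∈ Finset.range n, f (2 * j)) * ∏ j ∈ Finset.range n, f (2 * j + 1) := by
  induction n with
  | zero => simp
  | succ n ih =>
    rw [show 2 * (n + 1) = 2 * n + 1 + 1 by ring, Finset.prod_range_succ, Finset.prod_range_succ,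
      ih, Finset.prod_range_succ, Finset.prod_range_succ, mul_assoc, mul_mul_mul_comm]

theorem abs_det_fderiv_jacobiMoment_mul_prod {d : ℕ} {a : Fin d → ℝ} (ha : ∀ i, 0 < a i) :
    |(fderiv ℝ jacobiMoment a).det| * ∏ k, a k =
      2 ^ d * ∏ k ∈ Finset.range d, (∏ i ∈ Finset.range (k + 1), zeroExtend a i) ^ 2 := by
  rw [det_fderiv_jacobiMoment, abs_of_nonneg (Finset.prod_nonneg fun k _ => by
    have := ha k; positivity), ← Finset.prod_mul_distrib,
    ← Fin.prod_univ_eq_prod_range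
      (fun k => (∏ i ∈ Finset.range (k + 1), zeroExtend a i) ^ 2) d]
  have : (2 : ℝ) ^ d = ∏ _k : Fin d, (2 : ℝ) := by simp
  rw [this, ← Finset.prod_mul_distrib]
  refine Finset.prod_congr rfl fun k _ => ?_
  rw [Finset.prod_range_succ, zeroExtend_coe]
  ring

/-- The ratio of the Jacobians without an atom at the origin: by the Hankel determinants, the
Vandermonde factors cancel. -/
theorem jacobian_ratio_last {r d : ℕ} (hd : d = r + (r + 1)) {a z : Fin d → ℝ}
    (ha : ∀ i, 0 < a i) {σ : Equiv.Perm (Fin (r + 1))} {l : Fin (r + 1) → ℝ} {w : Fin r → ℝ}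
    (hz : atomCoords hd z = (l, w)) (hmem : (l, w) ∈ atomDomain σ) (h : IsSpectralData a (l, w)) :
    |(fderiv ℝ (fun z => atomMoment d (atomCoords (s := r + 1) hd z)) z).det| *
        (2 ^ r * (∏ j : Fin (r + 1), fullWeight w j) * ∏ j, l j) =
      |(fderiv ℝ jacobiMoment a).det| * ∏ k, a k := by
  have hM := h.sum_mul_jacobiVec
  have hO := prod_odd_eq_of_moments hM (by omega)
  have hE := prod_even_eq_of_moments hM (by omega) (by simp [originWeight])
  have hpos : 0 ≤ ∏ j : Fin (r + 1), 2 * fullWeight w j * l j := Finset.prod_nonneg fun j _ =>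
    mul_nonneg (mul_nonneg two_pos.le (fullWeight_pos hmem.2.1 hmem.2.2.1 j).le) (hmem.1 j).le
  rw [Finset.prod_range_succ'] at hE
  simp only [mul_zero, Finset.range_zero, Finset.prod_empty, one_pow, mul_one, mul_add] at hE
  rw [abs_det_fderiv_jacobiMoment_mul_prod ha, abs_det_fderiv_atomMoment_last hd z hz,
    abs_of_nonneg hpos]
  generalize zeroExtend a = A at hE hO ⊢
  rw [show d = 2 * r + 1 by omega, Finset.prod_range_succ, prod_range_two_mul,
    mul_right_comm (Finset.prod _ _) (Finset.prod _ _) ((_ : ℝ) ^ 2),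
    ← Finset.prod_range_succ (fun x => (∏ i ∈ Finset.range (2 * x + 1), A i) ^ 2), hO]
  simp only [add_assoc, one_add_one_eq_two] at hE ⊢
  rw [hE]
  simp only [Finset.prod_mul_distrib, Finset.prod_const, Finset.card_univ, Fintype.card_fin,
    Finset.prod_pow]
  ring

/-- The ratio of the Jacobians with an atom at the origin. -/
theorem jacobian_ratio_zero {r d : ℕ} (hd : d = r + r) {a z : Fin d → ℝ}
    (ha : ∀ i, 0 < a i) {σ : Equiv.Perm (Fin r)} {l w : Fin r → ℝ}
    (hz : atomCoords hd z = (l, w)) (hmem : (l, w) ∈ atomDomain σ) (h : IsSpectralData a (l, w)) :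
    |(fderiv ℝ (fun z => atomMoment d (atomCoords (s := r) hd z)) z).det| *
        (2 ^ r * (originWeight r w * ∏ j : Fin r, fullWeight w j) * ∏ j, l j) =
      |(fderiv ℝ jacobiMoment a).det| * ∏ k, a k := by
  have hM := h.sum_mul_jacobiVec
  have hO := prod_odd_eq_of_moments hM (by omega)
  have hE := prod_even_eq_of_moments_of_zero hM (by omega)
  have hpos : 0 ≤ ∏ j : Fin r, 2 * fullWeight w j * l j := Finset.prod_nonneg fun j _ =>
    mul_nonneg (mul_nonneg two_pos.le (fullWeight_pos hmem.2.1 hmem.2.2.1 j).le) (hmem.1 j).le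
  rw [Finset.prod_range_succ'] at hE
  simp only [mul_zero, Finset.range_zero, Finset.prod_empty, one_pow, mul_one, mul_add] at hE
  rw [abs_det_fderiv_jacobiMoment_mul_prod ha, abs_det_fderiv_atomMoment_zero hd z hz,
    abs_of_nonneg hpos]
  generalize zeroExtend a = A at hE hO ⊢
  rw [show d = 2 * r by omega, prod_range_two_mul, hO]
  simp only [add_assoc, one_add_one_eq_two] at hE ⊢
  rw [hE]
  simp only [Finset.prod_mul_distrib, Finset.prod_const, Finset.card_univ, Fintype.card_fin,
    Finset.prod_pow]
  ring

/-! ### Powers of the off-diagonal entries in terms of atoms and weights -/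

/-- With `L k = log a_{k+1}` and `c = n - m`, `m = r + 1`, this expresses `∑ α_k log a_k` through
the sums that occur in the logarithms of the two Hankel determinants. -/
theorem sum_chiralParam_mul_of_le (L : ℕ → ℝ) (c β : ℝ) (r : ℕ) :
    ∑ k ∈ Finset.range (2 * r + 1), L k *
      (if Even k then β * (c + (r + 1) - ((k / 2 : ℕ) : ℝ))
        else β * ((r + 1) - (((k / 2 : ℕ) : ℝ) + 1))) =
      β * ((c + 1) * ∑ j ∈ Finset.range (r + 1), L (2 * j) +
        ∑ k ∈ Finset.range (r + 1), ∑ i ∈ Finset.range (2 * k), L i) := by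
  induction r with
  | zero => simp; ring
  | succ r ih =>
    rw [show 2 * (r + 1) + 1 = 2 * r + 1 + 1 + 1 by ring, Finset.sum_range_succ,
      Finset.sum_range_succ, Finset.sum_range_succ _ (r + 1), Finset.sum_range_succ _ (r + 1)]
    have h1 : ∀ k : ℕ, L k * (if Even k then β * (c + (((r + 1 : ℕ) : ℝ) + 1) - ((k / 2 : ℕ) : ℝ))
        else β * ((((r + 1 : ℕ) : ℝ) + 1) - (((k / 2 : ℕ) : ℝ) + 1))) =
        L k * (if Even k then β * (c + (r + 1) - ((k / 2 : ℕ) : ℝ))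
        else β * ((r + 1) - (((k / 2 : ℕ) : ℝ) + 1))) + β * L k := by
      intro k
      push_cast
      split_ifs <;> ring
    rw [Finset.sum_congr rfl fun k _ => h1 k, Finset.sum_add_distrib, ih, ← Finset.mul_sum]
    have h2 : ¬ Even (2 * r + 1) := by simp
    have h3 : Even (2 * r + 1 + 1) := by rw [Nat.even_iff]; omega
    have h4 : (2 * r + 1) / 2 = r := by omega
    have h5 : (2 * r + 1 + 1) / 2 = r + 1 := by omega
    have h6 : 2 * (r + 1) = 2 * r + 1 + 1 := by ring
    rw [if_neg h2, if_pos h3, h4, h5, h6, Finset.sum_range_succ _ (2 * r + 1)]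
    push_cast
    ring

/-- The counterpart of `sum_chiralParam_mul_of_le` for `c = m - n`. -/
theorem sum_chiralParam_mul_of_gt (L : ℕ → ℝ) (c β : ℝ) (n : ℕ) :
    ∑ k ∈ Finset.range (2 * n), L k *
      (if Even k then β * (n - ((k / 2 : ℕ) : ℝ))
        else β * (c + n - (((k / 2 : ℕ) : ℝ) + 1))) =
      β * (c * ∑ j ∈ Finset.range n, L (2 * j + 1) +
        ∑ k ∈ Finset.range n, ∑ i ∈ Finset.range (2 * k + 1), L i) := by
  induction n with
  | zero => simp
  | succ n ih =>
    rw [show 2 * (n + 1) = 2 * n + 1 + 1 by ring, Finset.sum_range_succ,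
      Finset.sum_range_succ, Finset.sum_range_succ _ n, Finset.sum_range_succ _ n]
    have h1 : ∀ k : ℕ, L k * (if Even k then β * (((n + 1 : ℕ) : ℝ) - ((k / 2 : ℕ) : ℝ))
        else β * (c + ((n + 1 : ℕ) : ℝ) - (((k / 2 : ℕ) : ℝ) + 1))) =
        L k * (if Even k then β * (n - ((k / 2 : ℕ) : ℝ))
        else β * (c + n - (((k / 2 : ℕ) : ℝ) + 1))) + β * L k := by
      intro k
      push_cast
      split_ifs <;> ring
    rw [Finset.sum_congr rfl fun k _ => h1 k, Finset.sum_add_distrib, ih, ← Finset.mul_sum]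
    have h2 : ¬ Even (2 * n + 1) := by simp
    have h3 : Even (2 * n) := by simp
    have h4 : (2 * n + 1) / 2 = n := by omega
    have h5 : (2 * n) / 2 = n := by omega
    rw [if_neg h2, if_pos h3, h4, h5, Finset.sum_range_succ _ (2 * n)]
    push_cast
    ring

theorem prod_rpow_eq_exp_sum {ι : Type*} [Fintype ι] {x : ι → ℝ} (hx : ∀ i, 0 < x i)
    (y : ι → ℝ) : ∏ i, x i ^ y i = Real.exp (∑ i, Real.log (x i) * y i) := by
  rw [Real.exp_sum]
  exact Finset.prod_congr rfl fun i _ => Real.rpow_def_of_pos (hx i) _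

theorem prod_abs_rpow_eq_exp {s : ℕ} {x : Fin s → ℝ} (hx : Function.Injective x) (β : ℝ) :
    ∏ j, ∏ k ∈ Finset.Ioi j, |x k - x j| ^ β =
      Real.exp (β * Real.log (∏ i, ∏ j ∈ Finset.Ioi i, (x j - x i))) := by
  have hne : ∀ i, ∀ j ∈ Finset.Ioi i, x j - x i ≠ 0 := fun i j hij =>
    sub_ne_zero.2 fun h => (Finset.mem_Ioi.1 hij).ne' (hx h)
  have hprod : 0 < |∏ i, ∏ j ∈ Finset.Ioi i, (x j - x i)| :=
    abs_pos.2 (Finset.prod_ne_zero_iff.2 fun i _ => Finset.prod_ne_zero_iff.2 (hne i))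
  rw [mul_comm, ← Real.log_abs, ← Real.rpow_def_of_pos hprod, Finset.abs_prod,
    ← Real.finsetProd_rpow _ _ fun i _ => abs_nonneg _]
  refine Finset.prod_congr rfl fun i _ => ?_
  rw [Finset.abs_prod, ← Real.finsetProd_rpow _ _ fun i _ => abs_nonneg _]

theorem log_prod_sq_prod_zeroExtend {d : ℕ} {a : Fin d → ℝ} (ha : ∀ i, 0 < a i)
    (n : ℕ) (φ : ℕ → ℕ) (hφ : ∀ k < n, φ k ≤ d) :
    Real.log (∏ k ∈ Finset.range n, (∏ i ∈ Finset.range (φ k), zeroExtend a i) ^ 2) =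
      2 * ∑ k ∈ Finset.range n, ∑ i ∈ Finset.range (φ k), Real.log (zeroExtend a i) := by
  have hpos : ∀ i < d, zeroExtend a i ≠ 0 := fun i hi => by
    rw [zeroExtend_of_lt a hi]; exact (ha _).ne'
  rw [Real.log_prod fun k hk => pow_ne_zero 2
    (prod_zeroExtend_pos ha (hφ k (Finset.mem_range.1 hk))).ne', Finset.mul_sum]
  refine Finset.sum_congr rfl fun k hk => ?_
  rw [Real.log_pow, Real.log_prod fun i hi => hpos i
    ((Finset.mem_range.1 hi).trans_le (hφ k (Finset.mem_range.1 hk)))]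
  norm_num

theorem sq_fst_injective_of_mem_atomDomain {s r : ℕ} {σ : Equiv.Perm (Fin s)}
    {p : (Fin s → ℝ) × (Fin r → ℝ)} (hp : p ∈ atomDomain σ) :
    Function.Injective fun j => p.1 j ^ 2 := by
  intro i j hij
  exact fst_injective_of_mem_atomDomain hp
    ((pow_left_inj₀ (hp.1 i).le (hp.1 j).le two_ne_zero).1 hij)

/-- The powers of the entries in the chi densities, without an atom at the origin. The proof
compares logarithms: the left-hand side is linear in those of the two Hankel determinants. -/
theorem prod_rpow_chiralParam_of_le {r d n : ℕ} {β : ℝ} (hd : d = r + (r + 1)) {a : Fin d → ℝ}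
    (ha : ∀ i, 0 < a i) {σ : Equiv.Perm (Fin (r + 1))} {l : Fin (r + 1) → ℝ} {w : Fin r → ℝ}
    (hmem : (l, w) ∈ atomDomain σ) (h : IsSpectralData a (l, w)) :
    ∏ k, a k ^ chiralParam β (r + 1) n k =
      (∏ j, l j ^ (β * (n - r))) * (∏ j : Fin (r + 1), fullWeight w j ^ (β / 2)) *
        ∏ j, ∏ k ∈ Finset.Ioi j, |l k ^ 2 - l j ^ 2| ^ β := by
  have hM := h.sum_mul_jacobiVec
  have hO := prod_odd_eq_of_moments hM (by omega)
  have hE := prod_even_eq_of_moments hM (by omega) (by simp [originWeight])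
  have hsq := sq_fst_injective_of_mem_atomDomain hmem
  have hD : ∏ i, ∏ j ∈ Finset.Ioi i, (l j ^ 2 - l i ^ 2) ≠ 0 :=
    Finset.prod_ne_zero_iff.2 fun i _ => Finset.prod_ne_zero_iff.2 fun j hij =>
      sub_ne_zero.2 fun h => (Finset.mem_Ioi.1 hij).ne' (hsq h)
  have hW : ∀ j : Fin (r + 1), 0 < fullWeight w j := fullWeight_pos hmem.2.1 hmem.2.2.1
  have hl : ∀ j, 0 < l j := hmem.1
  have hO' := congrArg Real.log hO
  have hE' := congrArg Real.log hE
  rw [log_prod_sq_prod_zeroExtend ha (r + 1) (fun k => 2 * k + 1) (fun k hk => by omega),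
    Real.log_mul (Finset.prod_ne_zero_iff.2 fun j _ =>
      (mul_pos (hW j) (pow_pos (hl j) 2)).ne') (pow_ne_zero 2 hD), Real.log_pow,
    Finset.prod_mul_distrib, Real.log_mul (Finset.prod_ne_zero_iff.2 fun j _ => (hW j).ne')
      (Finset.prod_ne_zero_iff.2 fun j _ => (pow_pos (hl j) 2).ne'),
    Real.log_prod fun j _ => (hW j).ne', Real.log_prod fun j _ => (pow_pos (hl j) 2).ne'] at hO'
  rw [log_prod_sq_prod_zeroExtend ha (r + 1) (fun k => 2 * k) (fun k hk => by omega),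
    Real.log_mul (Finset.prod_ne_zero_iff.2 fun j _ => (hW j).ne') (pow_ne_zero 2 hD),
    Real.log_pow, Real.log_prod fun j _ => (hW j).ne'] at hE'
  simp only [Finset.sum_range_succ _ (2 * _), Finset.sum_add_distrib, Real.log_pow,
    ← Finset.mul_sum] at hO'
  rw [prod_rpow_eq_exp_sum ha, prod_rpow_eq_exp_sum hl, prod_rpow_eq_exp_sum hW,
    prod_abs_rpow_eq_exp hsq, ← Real.exp_add, ← Real.exp_add]
  congr 1
  have hsum := sum_chiralParam_mul_of_le (fun k => Real.log (zeroExtend a k)) (n - (r + 1)) β r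
  rw [show 2 * r + 1 = d by omega, ← Fin.sum_univ_eq_sum_range (fun k => Real.log (zeroExtend a k) *
    (if Even k then β * (((n : ℝ) - (r + 1)) + (r + 1) - ((k / 2 : ℕ) : ℝ))
        else β * ((r + 1) - (((k / 2 : ℕ) : ℝ) + 1)))) d] at hsum
  simp only [zeroExtend_coe, sub_add_cancel] at hsum
  have hchi : ∀ k : Fin d, chiralParam β (r + 1) n k = (if Even (k : ℕ) then
      β * ((n : ℝ) - (((k : ℕ) / 2 : ℕ) : ℝ)) else
        β * (((r : ℝ) + 1) - ((((k : ℕ) / 2 : ℕ) : ℝ) + 1))) := by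
    intro k
    simp [chiralParam]
  simp only [hchi]
  rw [hsum, ← Finset.sum_mul, ← Finset.sum_mul]
  push_cast at hO' hE'
  linear_combination (β * (n - r) / 2) * hO' + (β / 2 - β * (n - r) / 2) * hE'

/-- The powers of the entries in the chi densities, with an atom at the origin. -/
theorem prod_rpow_chiralParam_of_gt {n d m : ℕ} {β : ℝ} (hd : d = n + n) {a : Fin d → ℝ}
    (ha : ∀ i, 0 < a i) {σ : Equiv.Perm (Fin n)} {l w : Fin n → ℝ}
    (hmem : (l, w) ∈ atomDomain σ) (h : IsSpectralData a (l, w)) :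
    ∏ k, a k ^ chiralParam β m n k =
      (∏ j, l j ^ (β * (m - n + 1))) * (∏ j : Fin n, fullWeight w j ^ (β / 2)) *
        originWeight n w ^ (β * (m - n) / 2) *
        ∏ j, ∏ k ∈ Finset.Ioi j, |l k ^ 2 - l j ^ 2| ^ β := by
  have hM := h.sum_mul_jacobiVec
  have hO := prod_odd_eq_of_moments hM (by omega)
  have hE := prod_even_eq_of_moments_of_zero hM (by omega)
  have hsq := sq_fst_injective_of_mem_atomDomain hmem
  have hD : ∏ i, ∏ j ∈ Finset.Ioi i, (l j ^ 2 - l i ^ 2) ≠ 0 :=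
    Finset.prod_ne_zero_iff.2 fun i _ => Finset.prod_ne_zero_iff.2 fun j hij =>
      sub_ne_zero.2 fun h => (Finset.mem_Ioi.1 hij).ne' (hsq h)
  have hW : ∀ j : Fin n, 0 < fullWeight w j := fullWeight_pos hmem.2.1 hmem.2.2.1
  have hl : ∀ j, 0 < l j := hmem.1
  have hw₀ : 0 < originWeight n w := by simpa [originWeight] using hmem.2.2.1
  have hWp : ∏ j : Fin n, fullWeight w j ≠ 0 := Finset.prod_ne_zero_iff.2 fun j _ => (hW j).ne'
  have hlp : ∏ j, l j ^ 2 ≠ 0 := Finset.prod_ne_zero_iff.2 fun j _ => (pow_pos (hl j) 2).ne'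
  have hO' := congrArg Real.log hO
  have hE' := congrArg Real.log hE
  rw [log_prod_sq_prod_zeroExtend ha n (fun k => 2 * k + 1) (fun k hk => by omega),
    Finset.prod_mul_distrib, Real.log_mul (mul_ne_zero hWp hlp) (pow_ne_zero 2 hD), Real.log_pow,
    Real.log_mul hWp hlp, Real.log_prod fun j _ => (hW j).ne',
    Real.log_prod fun j _ => (pow_pos (hl j) 2).ne'] at hO'
  rw [log_prod_sq_prod_zeroExtend ha (n + 1) (fun k => 2 * k) (fun k hk => by omega),
    Real.log_mul (mul_ne_zero (mul_ne_zero hw₀.ne' hWp) (pow_ne_zero 2 hlp)) (pow_ne_zero 2 hD),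
    Real.log_mul (mul_ne_zero hw₀.ne' hWp) (pow_ne_zero 2 hlp), Real.log_mul hw₀.ne' hWp,
    Real.log_pow, Real.log_pow, Real.log_prod fun j _ => (hW j).ne',
    Real.log_prod fun j _ => (pow_pos (hl j) 2).ne', Finset.sum_range_succ'] at hE'
  simp only [Real.log_pow, ← Finset.mul_sum] at hO'
  have h2 : ∀ k, 2 * (k + 1) = 2 * k + 1 + 1 := fun k => by ring
  simp only [h2, Finset.sum_range_succ _ (2 * _ + 1), Finset.sum_add_distrib, Real.log_pow,
    ← Finset.mul_sum, mul_zero, Finset.range_zero, Finset.sum_empty, add_zero] at hE'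
  rw [prod_rpow_eq_exp_sum ha, prod_rpow_eq_exp_sum hl, prod_rpow_eq_exp_sum hW,
    prod_abs_rpow_eq_exp hsq, Real.rpow_def_of_pos hw₀, ← Real.exp_add, ← Real.exp_add,
    ← Real.exp_add]
  congr 1
  have hsum := sum_chiralParam_mul_of_gt (fun k => Real.log (zeroExtend a k)) (m - n) β n
  rw [show 2 * n = d by omega, ← Fin.sum_univ_eq_sum_range (fun k => Real.log (zeroExtend a k) *
    (if Even k then β * (n - ((k / 2 : ℕ) : ℝ))
        else β * (((m : ℝ) - n) + n - (((k / 2 : ℕ) : ℝ) + 1)))) d] at hsum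
  simp only [zeroExtend_coe, sub_add_cancel] at hsum
  simp only [chiralParam]
  rw [hsum, ← Finset.sum_mul, ← Finset.sum_mul]
  push_cast at hO' hE'
  linear_combination (β / 2 - β * (m - n) / 2) * hO' + (β * (m - n) / 2) * hE'

/-! ### Normalization constants -/

theorem prod_Icc_one_eq_prod_range {M : Type*} [CommMonoid M] (f : ℕ → M) (s : ℕ) :
    ∏ j ∈ Finset.Icc 1 s, f j = ∏ j ∈ Finset.range s, f (j + 1) := by
  induction s with
  | zero => simp
  | succ s ih => rw [Finset.prod_Icc_succ_top (by omega), ih, Finset.prod_range_succ]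

theorem prod_Gamma_one_add {β : ℝ} (hβ : 0 < β) (s : ℕ) :
    ∏ j ∈ Finset.range s, Real.Gamma (1 + β * ((j + 1 : ℕ) : ℝ) / 2) / Real.Gamma (1 + β / 2) =
      s.factorial * (∏ j ∈ Finset.range s, Real.Gamma (β * ((j : ℝ) + 1) / 2)) /
        Real.Gamma (β / 2) ^ s := by
  have hG : Real.Gamma (β / 2) ≠ 0 := (Real.Gamma_pos_of_pos (by positivity)).ne'
  induction s with
  | zero => simp
  | succ s ih =>
    have h1 : Real.Gamma (1 + β * ((s + 1 : ℕ) : ℝ) / 2) =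
        β * ((s : ℝ) + 1) / 2 * Real.Gamma (β * ((s : ℝ) + 1) / 2) := by
      rw [add_comm, Real.Gamma_add_one (by positivity)]
      push_cast
      rfl
    have h2 : Real.Gamma (1 + β / 2) = β / 2 * Real.Gamma (β / 2) := by
      rw [add_comm, Real.Gamma_add_one (by positivity)]
    rw [Finset.prod_range_succ, ih, h1, h2, Finset.prod_range_succ, Nat.factorial_succ]
    push_cast
    field_simp
    ring

theorem chiralNorm_eq {β : ℝ} (hβ : 0 < β) (s : ℕ) (c : ℝ) :
    chiralNorm β s c = 2 ^ ((s : ℝ) * (c * β / 2 + 1 + ((s : ℝ) - 1) * β / 2)) *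
      (s.factorial * (∏ j ∈ Finset.range s, Real.Gamma (β * ((j : ℝ) + 1) / 2)) /
        Real.Gamma (β / 2) ^ s) *
      ∏ j ∈ Finset.range s, Real.Gamma (1 + β * c / 2 + β * (j : ℝ) / 2) := by
  rw [chiralNorm, prod_Icc_one_eq_prod_range, ← prod_Gamma_one_add hβ, mul_assoc,
    ← Finset.prod_mul_distrib]
  congr 1
  refine Finset.prod_congr rfl fun j _ => ?_
  push_cast
  rw [add_sub_cancel_right]
  ring

/-- The normalization constant of the chi density. -/
noncomputable def chiConst (α : ℝ) : ℝ :=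
  1 / ((2 : ℝ) ^ (α / 2 - 1) * Real.Gamma (α / 2))

/-- The factor `∏ a_k` supplied by the Jacobian turns the exponents `α - 1` into `α`. -/
theorem prod_chiPDF_mul_prod {d : ℕ} {a : Fin d → ℝ} (ha : ∀ i, 0 < a i) (α : Fin d → ℝ) :
    (∏ k, chiPDF (α k) (a k)) * ∏ k, a k =
      (∏ k, chiConst (α k)) * (∏ k, a k ^ α k) * Real.exp (-(∑ k, a k ^ 2) / 2) := by
  rw [← Finset.sum_neg_distrib, Finset.sum_div, Real.exp_sum, ← Finset.prod_mul_distrib,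
    ← Finset.prod_mul_distrib, ← Finset.prod_mul_distrib]
  refine Finset.prod_congr rfl fun k _ => ?_
  rw [chiPDF, if_pos (ha k), chiConst, Real.rpow_sub_one (ha k).ne']
  have := (ha k).ne'
  field_simp

theorem prod_range_chiConst (α : ℕ → ℝ) (d : ℕ) :
    ∏ k ∈ Finset.range d, chiConst (α k) =
      1 / (2 ^ ((∑ k ∈ Finset.range d, α k) / 2 - d) *
        ∏ k ∈ Finset.range d, Real.Gamma (α k / 2)) := by
  simp only [chiConst]
  rw [Finset.prod_div_distrib, Finset.prod_const_one, Finset.prod_mul_distrib,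
    ← Real.rpow_sum_of_pos two_pos, Finset.sum_sub_distrib, Finset.sum_div]
  simp

theorem chiralParam_two_mul (β : ℝ) (m n j : ℕ) : chiralParam β m n (2 * j) = β * (n - j) := by
  simp [chiralParam]

theorem chiralParam_two_mul_add_one (β : ℝ) (m n j : ℕ) :
    chiralParam β m n (2 * j + 1) = β * (m - (j + 1)) := by
  have : (2 * j + 1) / 2 = j := by omega
  simp [chiralParam, this]

/-- A product of Gamma values along an arithmetic progression, read backwards. -/
theorem prod_range_Gamma_reflect (c β : ℝ) (s : ℕ) :
    ∏ j ∈ Finset.range s, Real.Gamma (β * (c + s - j) / 2) =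
      ∏ j ∈ Finset.range s, Real.Gamma (β * (c + j + 1) / 2) := by
  rw [← Finset.prod_range_reflect]
  refine Finset.prod_congr rfl fun j hj => ?_
  have h1 : 1 ≤ s := by have := Finset.mem_range.1 hj; omega
  have h2 : j ≤ s - 1 := by have := Finset.mem_range.1 hj; omega
  rw [Nat.cast_sub h2, Nat.cast_sub h1]
  congr 1
  push_cast
  ring

theorem sum_range_two_mul_cast (r : ℕ) :
    ∑ k ∈ Finset.range (r + 1), (2 * (k : ℝ)) = r * (r + 1) := by
  induction r with
  | zero => simp
  | succ r ih => rw [Finset.sum_range_succ, ih]; push_cast; ring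

/-- The constants of the chi densities, without an atom at the origin: the entries with odd index
contribute the second family of Gamma factors of `h_{β,s,a}`, those with even index the first one,
up to the constant of the Dirichlet density. -/
theorem prod_chiConst_of_le {β : ℝ} (hβ : 0 < β) {r n : ℕ} (hn : r + 1 ≤ n) :
    ∏ k ∈ Finset.range (2 * r + 1), chiConst (chiralParam β (r + 1) n k) =
      (r + 1).factorial * (2 ^ (r + 1) / chiralNorm β (r + 1) (chiralA β (r + 1) n)) *
        (Real.Gamma (β * (r + 1 : ℕ) / 2) / Real.Gamma (β / 2) ^ (r + 1)) * 2 ^ r := by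
  have hn' : (r : ℝ) + 1 ≤ n := by exact_mod_cast hn
  have hsum : ∑ k ∈ Finset.range (2 * r + 1), chiralParam β (r + 1) n k = β * n * (r + 1) := by
    have h := sum_chiralParam_mul_of_le (fun _ => 1) (n - (r + 1)) β r
    simp only [one_mul, sub_add_cancel, Finset.sum_const, Finset.card_range, nsmul_eq_mul,
      mul_one] at h
    push_cast at h
    rw [sum_range_two_mul_cast] at h
    simp only [chiralParam]
    push_cast
    rw [h]
    ring
  have hG : ∏ k ∈ Finset.range (2 * r + 1), Real.Gamma (chiralParam β (r + 1) n k / 2) =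
      (∏ j ∈ Finset.range (r + 1), Real.Gamma (β * ((n - (r + 1)) + j + 1) / 2)) *
        ∏ j ∈ Finset.range r, Real.Gamma (β * (j + 1) / 2) := by
    have h1 := prod_range_Gamma_reflect (n - (r + 1)) β (r + 1)
    have h2 := prod_range_Gamma_reflect 0 β r
    simp only [zero_add] at h2
    rw [Finset.prod_range_succ, prod_range_two_mul, mul_right_comm,
      ← Finset.prod_range_succ (fun j => Real.Gamma (chiralParam β (r + 1) n (2 * j) / 2)),
      ← h1, ← h2]
    congr 1
    · refine Finset.prod_congr rfl fun j _ => ?_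
      rw [chiralParam_two_mul]
      push_cast
      ring_nf
    · refine Finset.prod_congr rfl fun j _ => ?_
      rw [chiralParam_two_mul_add_one]
      push_cast
      ring_nf
  have hA : chiralA β (r + 1) n = n - r - 2 / β := by
    rw [chiralA, abs_of_nonneg (by push_cast; linarith)]
    push_cast
    ring
  have hG2 : ∏ j ∈ Finset.range (r + 1),
      Real.Gamma (1 + β * chiralA β (r + 1) n / 2 + β * (j : ℝ) / 2) =
      ∏ j ∈ Finset.range (r + 1), Real.Gamma (β * ((n - (r + 1)) + j + 1) / 2) := by
    refine Finset.prod_congr rfl fun j _ => ?_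
    rw [hA]
    congr 1
    field_simp
    ring
  have hpos1 : 0 <
      ∏ j ∈ Finset.range (r + 1), Real.Gamma (β * (((n : ℝ) - (r + 1)) + j + 1) / 2) :=
    Finset.prod_pos fun j _ => Real.Gamma_pos_of_pos (by
      have : (0 : ℝ) ≤ n - (r + 1) := by linarith
      positivity)
  have hpos2 : 0 < ∏ j ∈ Finset.range r, Real.Gamma (β * ((j : ℝ) + 1) / 2) :=
    Finset.prod_pos fun j _ => Real.Gamma_pos_of_pos (by positivity)
  have hpos3 : 0 < Real.Gamma (β * ((r : ℝ) + 1) / 2) := Real.Gamma_pos_of_pos (by positivity)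
  have hpos4 : 0 < Real.Gamma (β / 2) := Real.Gamma_pos_of_pos (by positivity)
  rw [prod_range_chiConst, hsum, hG, chiralNorm_eq hβ, hG2, Finset.prod_range_succ (fun j : ℕ =>
    Real.Gamma (β * ((j : ℝ) + 1) / 2))]
  have hpow : (2 : ℝ) ^ (((r + 1 : ℕ) : ℝ) * (chiralA β (r + 1) n * β / 2 + 1 +
      (((r + 1 : ℕ) : ℝ) - 1) * β / 2)) =
      2 ^ (β * n * (r + 1) / 2 - ((2 * r + 1 : ℕ) : ℝ)) * 2 ^ (2 * r + 1) := by
    rw [← Real.rpow_natCast 2 (2 * r + 1), ← Real.rpow_add two_pos, hA]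
    congr 1
    push_cast
    field_simp
    ring
  rw [hpow]
  have hfac : ((r + 1).factorial : ℝ) ≠ 0 := by exact_mod_cast (r + 1).factorial_ne_zero
  have hp : (0 : ℝ) < 2 ^ (β * n * (r + 1) / 2 - ((2 * r + 1 : ℕ) : ℝ)) :=
    Real.rpow_pos_of_pos two_pos _
  push_cast at hp ⊢
  field_simp
  ring

/-- The constants of the chi densities, with an atom at the origin; here the two parities exchange
their roles, and the Gamma factors of the second family are shifted by one. -/
theorem prod_chiConst_of_gt {β : ℝ} (hβ : 0 < β) {m n : ℕ} (hm : n + 1 ≤ m) :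
    ∏ k ∈ Finset.range (2 * n), chiConst (chiralParam β m n k) =
      n.factorial * (2 ^ n / chiralNorm β n (chiralA β m n)) *
        (Real.Gamma (β * m / 2) / (Real.Gamma (β / 2) ^ n *
          Real.Gamma (β * ((m : ℝ) - n) / 2))) * 2 ^ n := by
  have hm' : (n : ℝ) + 1 ≤ m := by exact_mod_cast hm
  have hsum : ∑ k ∈ Finset.range (2 * n), chiralParam β m n k = β * n * m := by
    have h := sum_chiralParam_mul_of_gt (fun _ => 1) (m - n) β n
    simp only [one_mul, sub_add_cancel, Finset.sum_const, Finset.card_range, nsmul_eq_mul,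
      mul_one] at h
    push_cast at h
    rw [Finset.sum_add_distrib] at h
    have h2 := sum_range_two_mul_cast n
    rw [Finset.sum_range_succ] at h2
    simp only [Finset.sum_const, Finset.card_range, nsmul_eq_mul, mul_one] at h
    simp only [chiralParam]
    rw [h]
    linear_combination β * h2
  have hG : ∏ k ∈ Finset.range (2 * n), Real.Gamma (chiralParam β m n k / 2) =
      (∏ j ∈ Finset.range n, Real.Gamma (β * (j + 1) / 2)) *
        ∏ j ∈ Finset.range n, Real.Gamma (β * ((m - n) + j) / 2) := by
    have h1 := prod_range_Gamma_reflect 0 β n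
    have h2 := prod_range_Gamma_reflect ((m : ℝ) - n - 1) β n
    simp only [zero_add] at h1
    rw [prod_range_two_mul, ← h1]
    congr 1
    · refine Finset.prod_congr rfl fun j _ => ?_
      rw [chiralParam_two_mul]
    · refine Eq.trans ?_ (h2.trans ?_)
      · refine Finset.prod_congr rfl fun j _ => ?_
        rw [chiralParam_two_mul_add_one]
        ring_nf
      · refine Finset.prod_congr rfl fun j _ => ?_
        ring_nf
  have hA : chiralA β m n = m - n + 1 - 2 / β := by
    rw [chiralA, abs_sub_comm, abs_of_nonneg (by linarith)]
  have hG2 : Real.Gamma (β * (m - n) / 2) * ∏ j ∈ Finset.range n,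
      Real.Gamma (1 + β * chiralA β m n / 2 + β * (j : ℝ) / 2) =
      (∏ j ∈ Finset.range n, Real.Gamma (β * ((m - n) + j) / 2)) * Real.Gamma (β * m / 2) := by
    have h1 := Finset.prod_range_succ (fun j : ℕ => Real.Gamma (β * (((m : ℝ) - n) + j) / 2)) n
    rw [Finset.prod_range_succ', sub_add_cancel] at h1
    rw [← h1, mul_comm]
    congr 1
    · refine Finset.prod_congr rfl fun j _ => ?_
      rw [hA]
      congr 1
      push_cast
      field_simp
      ring
    · simp
  have hmn : (0 : ℝ) < m - n := by linarith
  have hpos0 : 0 < ∏ j ∈ Finset.range n,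
      Real.Gamma (1 + β * chiralA β m n / 2 + β * (j : ℝ) / 2) :=
    Finset.prod_pos fun j _ => Real.Gamma_pos_of_pos (by
      have : 1 + β * chiralA β m n / 2 + β * (j : ℝ) / 2 = β * (m - n + 1 + j) / 2 := by
        rw [hA]; field_simp; ring
      rw [this]
      positivity)
  have hpos1 : 0 < ∏ j ∈ Finset.range n, Real.Gamma (β * (((m : ℝ) - n) + j) / 2) :=
    Finset.prod_pos fun j _ => Real.Gamma_pos_of_pos (by positivity)
  have hpos2 : 0 < ∏ j ∈ Finset.range n, Real.Gamma (β * ((j : ℝ) + 1) / 2) :=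
    Finset.prod_pos fun j _ => Real.Gamma_pos_of_pos (by positivity)
  have hpos3 : 0 < Real.Gamma (β * ((m : ℝ) - n) / 2) := Real.Gamma_pos_of_pos (by positivity)
  have hpos4 : 0 < Real.Gamma (β / 2) := Real.Gamma_pos_of_pos (by positivity)
  rw [prod_range_chiConst, hsum, hG, chiralNorm_eq hβ]
  have hpow : (2 : ℝ) ^ ((n : ℝ) * (chiralA β m n * β / 2 + 1 + ((n : ℝ) - 1) * β / 2)) =
      2 ^ (β * n * m / 2 - ((2 * n : ℕ) : ℝ)) * 2 ^ (2 * n) := by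
    rw [← Real.rpow_natCast 2 (2 * n), ← Real.rpow_add two_pos, hA]
    congr 1
    push_cast
    field_simp
    ring
  rw [hpow]
  have hfac : (n.factorial : ℝ) ≠ 0 := by exact_mod_cast n.factorial_ne_zero
  have hp : (0 : ℝ) < 2 ^ (β * n * m / 2 - ((2 * n : ℕ) : ℝ)) := Real.rpow_pos_of_pos two_pos _
  generalize (2 : ℝ) ^ (β * n * m / 2 - ((2 * n : ℕ) : ℝ)) = q at hp ⊢
  generalize (∏ j ∈ Finset.range n,
      Real.Gamma (1 + β * chiralA β m n / 2 + β * (j : ℝ) / 2)) = g4 at hG2 hpos0 ⊢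
  generalize (∏ j ∈ Finset.range n, Real.Gamma (β * (((m : ℝ) - n) + j) / 2)) = g3 at hG2 hpos1 ⊢
  generalize (∏ j ∈ Finset.range n, Real.Gamma (β * ((j : ℝ) + 1) / 2)) = g0 at hpos2 ⊢
  generalize Real.Gamma (β * ((m : ℝ) - n) / 2) = gd at hG2 hpos3 ⊢
  field_simp
  linear_combination (2 : ℝ) ^ (2 * n) * hG2

/-! ### Matching of the densities -/

theorem chiPDF_nonneg {α : ℝ} (hα : 0 < α) (x : ℝ) : 0 ≤ chiPDF α x := by
  have := Real.Gamma_pos_of_pos (half_pos hα)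
  unfold chiPDF
  split_ifs with hx <;> positivity

/-- The form in which the density identity and the ratio `K / A` of the Jacobians are combined. -/
theorem ofReal_density_mul_eq {d s : ℕ} {f : Fin d → ℝ} {A K D F G : ℝ} (hf : ∀ k, 0 ≤ f k)
    (hK : K ≠ 0) (hdens : (∏ k, f k) * A = s.factorial * D * K) (hjac : |G| * K = |F| * A) :
    (∏ k, ENNReal.ofReal (f k)) * ENNReal.ofReal |G| =
      s.factorial * ENNReal.ofReal D * ENNReal.ofReal |F| := by
  have h : (∏ k, f k) * |G| = s.factorial * D * |F| := by
    refine mul_right_cancel₀ hK ?_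
    linear_combination (∏ k, f k) * hjac + |F| * hdens
  rw [← ENNReal.ofReal_prod_of_nonneg fun k _ => hf k,
    ← ENNReal.ofReal_mul (Finset.prod_nonneg fun k _ => hf k), h,
    ENNReal.ofReal_mul' (abs_nonneg _), ENNReal.ofReal_mul (Nat.cast_nonneg _),
    ENNReal.ofReal_natCast]

theorem chiralParam_pos_of_le {β : ℝ} (hβ : 0 < β) {r n k : ℕ} (hn : r + 1 ≤ n)
    (hk : k < 2 * r + 1) : 0 < chiralParam β (r + 1) n k := by
  unfold chiralParam
  split_ifs with h
  · have : k / 2 < n := by omega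
    exact mul_pos hβ (sub_pos.2 (by exact_mod_cast this))
  · have : k / 2 + 1 < r + 1 := by rw [Nat.not_even_iff] at h; omega
    exact mul_pos hβ (sub_pos.2 (by exact_mod_cast this))

theorem chiralParam_pos_of_gt {β : ℝ} (hβ : 0 < β) {m n k : ℕ} (hm : n + 1 ≤ m)
    (hk : k < 2 * n) : 0 < chiralParam β m n k := by
  unfold chiralParam
  split_ifs with h
  · have : k / 2 < n := by omega
    exact mul_pos hβ (sub_pos.2 (by exact_mod_cast this))
  · have : k / 2 + 1 < m := by omega
    exact mul_pos hβ (sub_pos.2 (by exact_mod_cast this))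

/-- The powers `l ^ c` split into the densities `l ^ (c - 1) exp (-l² / 2)` and the contribution
`∏ l` of the Jacobian. -/
theorem prod_rpow_mul_exp {s : ℕ} {l : Fin s → ℝ} (hl : ∀ j, 0 < l j) {b c : ℝ} (hc : b + 1 = c) :
    (∏ j, l j ^ c) * Real.exp (-(∑ j, l j ^ 2) / 2) =
      (∏ j, l j ^ b * Real.exp (-l j ^ 2 / 2)) * ∏ j, l j := by
  rw [← Finset.sum_neg_distrib, Finset.sum_div, Real.exp_sum, ← Finset.prod_mul_distrib,
    ← Finset.prod_mul_distrib]
  refine Finset.prod_congr rfl fun j _ => ?_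
  rw [← hc, Real.rpow_add_one (hl j).ne']
  ring

theorem prod_rpow_eq_prod_rpow_sub_one_mul {s : ℕ} {w : Fin s → ℝ} (hw : ∀ j, 0 < w j) (c : ℝ) :
    ∏ j, w j ^ c = (∏ j, w j ^ (c - 1)) * ∏ j, w j := by
  rw [← Finset.prod_mul_distrib]
  refine Finset.prod_congr rfl fun j _ => ?_
  rw [Real.rpow_sub_one (hw j).ne', div_mul_cancel₀ _ (hw j).ne']

/-- The chi densities and the claimed density agree up to the ratio of the Jacobians, for
`m = r + 1` and `m ≤ n`; the factor `m!` accounts for the orderings. -/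
theorem density_identity_of_le {r d n : ℕ} {β : ℝ} (hβ : 0 < β) (hn : r + 1 ≤ n)
    (hd : d = r + (r + 1)) {a : Fin d → ℝ} (ha : ∀ i, 0 < a i) {σ : Equiv.Perm (Fin (r + 1))}
    {l : Fin (r + 1) → ℝ} {w : Fin r → ℝ} (hmem : (l, w) ∈ atomDomain σ)
    (h : IsSpectralData a (l, w)) :
    (∏ k : Fin d, chiPDF (chiralParam β (r + 1) n k) (a k)) * ∏ k, a k =
      (r + 1).factorial * (eigenvalueDensity β (r + 1) (chiralA β (r + 1) n) l *
        weightDensity β (r + 1) w) *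
        (2 ^ r * (∏ j : Fin (r + 1), fullWeight w j) * ∏ j, l j) := by
  have hn' : (r : ℝ) + 1 ≤ n := by exact_mod_cast hn
  have hl : ∀ j, 0 < l j := hmem.1
  have hW : ∀ j : Fin (r + 1), 0 < fullWeight w j := fullWeight_pos hmem.2.1 hmem.2.2.1
  have hA : β * chiralA β (r + 1) n + 1 + 1 = β * (n - r) := by
    rw [chiralA, abs_of_nonneg (by push_cast; linarith)]
    push_cast
    field_simp
    ring
  have hsq : ∑ i, a i ^ 2 = ∑ j, l j ^ 2 := h.2
  have hwd : weightDensity β (r + 1) w =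
      Real.Gamma (β * (r + 1 : ℕ) / 2) / Real.Gamma (β / 2) ^ (r + 1) *
        ∏ j : Fin (r + 1), fullWeight w j ^ (β / 2 - 1) := by
    have hmw : (∀ j, 0 < w j) ∧ 0 < 1 - ∑ j, w j := ⟨hmem.2.1, hmem.2.2.1⟩
    rw [weightDensity]
    refine (if_pos hmw).trans ?_
    rw [Fin.prod_univ_castSucc]
    simp [fullWeight]
  have hconst : ∏ k : Fin d, chiConst (chiralParam β (r + 1) n k) = _ :=
    (Fin.prod_univ_eq_prod_range (fun k => chiConst (chiralParam β (r + 1) n k)) d).trans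
      ((congrArg (fun d => ∏ k ∈ Finset.range d, chiConst (chiralParam β (r + 1) n k))
        (by omega : d = 2 * r + 1)).trans (prod_chiConst_of_le hβ hn))
  rw [prod_chiPDF_mul_prod ha, hconst, prod_rpow_chiralParam_of_le hd ha hmem h, hsq, hwd,
    eigenvalueDensity, if_pos hl, prod_rpow_eq_prod_rpow_sub_one_mul hW]
  linear_combination ((r + 1).factorial * (2 ^ (r + 1) /
    chiralNorm β (r + 1) (chiralA β (r + 1) n)) *
    (Real.Gamma (β * (r + 1 : ℕ) / 2) / Real.Gamma (β / 2) ^ (r + 1)) * 2 ^ r *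
    ((∏ j : Fin (r + 1), fullWeight w j ^ (β / 2 - 1)) * ∏ j : Fin (r + 1), fullWeight w j) *
    ∏ j, ∏ k ∈ Finset.Ioi j, |l k ^ 2 - l j ^ 2| ^ β) * prod_rpow_mul_exp hl hA

/-- The counterpart of `density_identity_of_le` for `m ≥ n + 1`. -/
theorem density_identity_of_gt {m d n : ℕ} {β : ℝ} (hβ : 0 < β) (hm : n + 1 ≤ m)
    (hd : d = n + n) {a : Fin d → ℝ} (ha : ∀ i, 0 < a i) {σ : Equiv.Perm (Fin n)}
    {l w : Fin n → ℝ} (hmem : (l, w) ∈ atomDomain σ) (h : IsSpectralData a (l, w)) :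
    (∏ k : Fin d, chiPDF (chiralParam β m n k) (a k)) * ∏ k, a k =
      n.factorial * (eigenvalueDensity β n (chiralA β m n) l * weightDensityWithZero β m n w) *
        (2 ^ n * (originWeight n w * ∏ j : Fin n, fullWeight w j) * ∏ j, l j) := by
  have hm' : (n : ℝ) + 1 ≤ m := by exact_mod_cast hm
  have hl : ∀ j, 0 < l j := hmem.1
  have hW : ∀ j : Fin n, 0 < fullWeight w j := fullWeight_pos hmem.2.1 hmem.2.2.1
  have hw₀ : 0 < originWeight n w := by simpa [originWeight] using hmem.2.2.1
  have hA : β * chiralA β m n + 1 + 1 = β * (m - n + 1) := by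
    rw [chiralA, abs_sub_comm, abs_of_nonneg (by linarith)]
    field_simp
    ring
  have hsq : ∑ i, a i ^ 2 = ∑ j, l j ^ 2 := h.2
  have hwd : weightDensityWithZero β m n w =
      Real.Gamma (β * m / 2) / (Real.Gamma (β / 2) ^ n * Real.Gamma (β * ((m : ℝ) - n) / 2)) *
        originWeight n w ^ (β * ((m : ℝ) - n) / 2 - 1) *
        ∏ j : Fin n, fullWeight w j ^ (β / 2 - 1) := by
    have hmw : (∀ j, 0 < w j) ∧ 0 < 1 - ∑ j, w j := ⟨hmem.2.1, hmem.2.2.1⟩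
    rw [weightDensityWithZero, if_pos hmw]
    simp [fullWeight, originWeight]
  have hconst : ∏ k : Fin d, chiConst (chiralParam β m n k) = _ :=
    (Fin.prod_univ_eq_prod_range (fun k => chiConst (chiralParam β m n k)) d).trans
      ((congrArg (fun d => ∏ k ∈ Finset.range d, chiConst (chiralParam β m n k))
        (by omega : d = 2 * n)).trans (prod_chiConst_of_gt hβ hm))
  have h0 : originWeight n w ^ (β * ((m : ℝ) - n) / 2) =
      originWeight n w ^ (β * ((m : ℝ) - n) / 2 - 1) * originWeight n w := by
    rw [Real.rpow_sub_one hw₀.ne', div_mul_cancel₀ _ hw₀.ne']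
  rw [prod_chiPDF_mul_prod ha, hconst, prod_rpow_chiralParam_of_gt hd ha hmem h, hsq, hwd,
    eigenvalueDensity, if_pos hl, prod_rpow_eq_prod_rpow_sub_one_mul hW, h0]
  linear_combination (n.factorial * (2 ^ n / chiralNorm β n (chiralA β m n)) *
    (Real.Gamma (β * m / 2) / (Real.Gamma (β / 2) ^ n * Real.Gamma (β * ((m : ℝ) - n) / 2))) *
    2 ^ n *
    ((∏ j : Fin n, fullWeight w j ^ (β / 2 - 1)) * ∏ j : Fin n, fullWeight w j) *
    (originWeight n w ^ (β * ((m : ℝ) - n) / 2 - 1) * originWeight n w) *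
    ∏ j, ∏ k ∈ Finset.Ioi j, |l k ^ 2 - l j ^ 2| ^ β) * prod_rpow_mul_exp hl hA

theorem prod_abs_rpow_eq_zero {s : ℕ} {β : ℝ} (hβ : 0 < β) {l : Fin s → ℝ}
    (hl : ¬ Function.Injective l) :
    ∏ j, ∏ k ∈ Finset.Ioi j, |l k ^ 2 - l j ^ 2| ^ β = 0 := by
  obtain ⟨i, j, hij, hne⟩ := Function.not_injective_iff.1 hl
  rcases hne.lt_or_gt with h | h
  · exact Finset.prod_eq_zero (Finset.mem_univ i) (Finset.prod_eq_zero (Finset.mem_Ioi.2 h)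
      (by rw [hij, sub_self, abs_zero, Real.zero_rpow hβ.ne']))
  · exact Finset.prod_eq_zero (Finset.mem_univ j) (Finset.prod_eq_zero (Finset.mem_Ioi.2 h)
      (by rw [hij, sub_self, abs_zero, Real.zero_rpow hβ.ne']))

/-- The joint density vanishes off the domains of the orderings: on the positive cone, the power
of the Vandermonde product is zero when two atoms coincide. -/
theorem eigenvalueDensity_mul_eq_zero {s r : ℕ} {β c v : ℝ} (hβ : 0 < β)
    {p : (Fin s → ℝ) × (Fin r → ℝ)} (hp : ∀ σ, p ∉ atomDomain σ)
    (hv : ¬ ((∀ j, 0 < p.2 j) ∧ 0 < 1 - ∑ j, p.2 j) → v = 0) :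
    eigenvalueDensity β s c p.1 * v = 0 := by
  by_cases hw : (∀ j, 0 < p.2 j) ∧ 0 < 1 - ∑ j, p.2 j
  · by_cases hl : ∀ j, 0 < p.1 j
    · have hinj : ¬ Function.Injective p.1 := fun hinj =>
        let ⟨σ, hσ⟩ := exists_mem_atomDomain hl hw.1 hw.2 hinj
        hp σ hσ
      rw [eigenvalueDensity, if_pos hl, prod_abs_rpow_eq_zero hβ hinj, mul_zero, zero_mul]
    · rw [eigenvalueDensity, if_neg hl, zero_mul]
  · rw [hv hw, mul_zero]

theorem mainTheorem3 {Ω : Type*} [MeasurableSpace Ω] (P : Measure Ω) [IsProbabilityMeasure P]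
    (β : ℝ) (hβ : 0 < β) (m n : ℕ) (hm : 0 < m) (hn : 0 < n) :
    (m ≤ n → ∀ J : Ω → Matrix (Fin (2 * m)) (Fin (2 * m)) ℝ,
      IsChiralGaussianBetaEnsemble P β m n J →
      ∃ l w : Ω → Fin m → ℝ, Measurable l ∧ Measurable w ∧
        (∀ᵐ ω ∂P, StrictAnti (l ω) ∧ (∀ j, 0 < l ω j) ∧
          (∀ j, 0 < w ω j) ∧ ∑ j, w ω j = 1 ∧
          IsSpectralMeasure (J ω) ⟨0, by omega⟩ (symmetricAtoms (l ω) (w ω))) ∧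
        randomOrderLaw P (Nat.sub_le m 1) l w =
          (volume : Measure ((Fin m → ℝ) × (Fin (m - 1) → ℝ))).withDensity fun p =>
            ENNReal.ofReal
              (eigenvalueDensity β m (chiralA β m n) p.1 * weightDensity β m p.2)) ∧
    (n + 1 ≤ m → ∀ J : Ω → Matrix (Fin (2 * n + 1)) (Fin (2 * n + 1)) ℝ,
      IsChiralGaussianBetaEnsemble P β m n J →
      ∃ (l w : Ω → Fin n → ℝ) (w₀ : Ω → ℝ), Measurable l ∧ Measurable w ∧ Measurable w₀ ∧
        (∀ᵐ ω ∂P, StrictAnti (l ω) ∧ (∀ j, 0 < l ω j) ∧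
          0 < w₀ ω ∧ (∀ j, 0 < w ω j) ∧ w₀ ω + ∑ j, w ω j = 1 ∧
          IsSpectralMeasure (J ω) ⟨0, by omega⟩
            (ENNReal.ofReal (w₀ ω) • Measure.dirac 0 + symmetricAtoms (l ω) (w ω))) ∧
        randomOrderLaw P (le_refl n) l w =
          (volume : Measure ((Fin n → ℝ) × (Fin n → ℝ))).withDensity fun p =>
            ENNReal.ofReal
              (eigenvalueDensity β n (chiralA β m n) p.1 * weightDensityWithZero β m n p.2)) := by
  constructor
  · intro hmn J hJ
    obtain ⟨-, a, ha, hind, hJa⟩ := hJ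
    obtain ⟨r, rfl⟩ : ∃ r, m = r + 1 := ⟨m - 1, by omega⟩
    obtain ⟨T, hT, hae, hlaw⟩ := exists_atoms_of_chi_entries (r := r) (s := r + 1) (by ring)
      (Nat.le_succ r) (Or.inr rfl) ha hind hJa
      (g := fun p => ENNReal.ofReal
        (eigenvalueDensity β (r + 1) (chiralA β (r + 1) n) p.1 * weightDensity β (r + 1) p.2))
      (fun p hp => by
        rw [eigenvalueDensity_mul_eq_zero (v := weightDensity β (r + 1) p.2) hβ hp
          fun h => if_neg h, ENNReal.ofReal_zero])
      (fun hd a z ha σ hz haz => by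
        have hK : 2 ^ r * (∏ j : Fin (r + 1), fullWeight (atomCoords (s := r + 1) hd z).2 j) *
            ∏ j, (atomCoords (s := r + 1) hd z).1 j ≠ 0 :=
          mul_ne_zero (mul_ne_zero (by positivity) (Finset.prod_ne_zero_iff.2 fun j _ =>
            (fullWeight_pos hz.2.1 hz.2.2.1 j).ne')) (Finset.prod_ne_zero_iff.2 fun j _ =>
            (hz.1 j).ne')
        exact ofReal_density_mul_eq (fun k => chiPDF_nonneg
          (chiralParam_pos_of_le hβ hmn (by have := k.2; omega)) _) hK
          (density_identity_of_le hβ hmn hd ha hz haz) (jacobian_ratio_last hd ha rfl hz haz))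
    refine ⟨fun ω => (T ω).1, fun ω => fullWeight (T ω).2, hT.fst,
      measurable_fullWeight.comp hT.snd, ?_, hlaw⟩
    filter_upwards [hae] with ω ⟨h1, h2⟩
    have h0 : originWeight (r + 1) (T ω).2 = 0 := by simp [originWeight]
    have hsum := originWeight_add_sum_fullWeight (Or.inr rfl : r + 1 = r ∨ r + 1 = r + 1) (T ω).2
    rw [h0, zero_add] at hsum
    rw [h0, ENNReal.ofReal_zero, zero_smul, zero_add] at h2
    exact ⟨h1.2.2.2, h1.1, fullWeight_pos h1.2.1 h1.2.2.1, hsum, h2⟩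
  · intro hmn J hJ
    obtain ⟨-, a, ha, hind, hJa⟩ := hJ
    obtain ⟨T, hT, hae, hlaw⟩ := exists_atoms_of_chi_entries (r := n) (s := n) (by ring)
      le_rfl (Or.inl rfl) ha hind hJa
      (g := fun p => ENNReal.ofReal
        (eigenvalueDensity β n (chiralA β m n) p.1 * weightDensityWithZero β m n p.2))
      (fun p hp => by
        rw [eigenvalueDensity_mul_eq_zero (v := weightDensityWithZero β m n p.2) hβ hp
          fun h => if_neg h, ENNReal.ofReal_zero])
      (fun hd a z ha σ hz haz => by
        have hw₀ : originWeight n (atomCoords (s := n) hd z).2 ≠ 0 := by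
          simpa [originWeight] using hz.2.2.1.ne'
        have hK : 2 ^ n * (originWeight n (atomCoords (s := n) hd z).2 *
            ∏ j : Fin n, fullWeight (atomCoords (s := n) hd z).2 j) *
            ∏ j, (atomCoords (s := n) hd z).1 j ≠ 0 :=
          mul_ne_zero (mul_ne_zero (by positivity) (mul_ne_zero hw₀
            (Finset.prod_ne_zero_iff.2 fun j _ => (fullWeight_pos hz.2.1 hz.2.2.1 j).ne')))
            (Finset.prod_ne_zero_iff.2 fun j _ => (hz.1 j).ne')
        exact ofReal_density_mul_eq (fun k => chiPDF_nonneg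
          (chiralParam_pos_of_gt hβ hmn (by have := k.2; omega)) _) hK
          (density_identity_of_gt hβ hmn hd ha hz haz) (jacobian_ratio_zero hd ha rfl hz haz))
    have hw₀ : Measurable fun w : Fin n → ℝ => originWeight n w := by
      simp only [originWeight, if_true]
      fun_prop
    refine ⟨fun ω => (T ω).1, fun ω => fullWeight (T ω).2, fun ω => originWeight n (T ω).2, hT.fst,
      measurable_fullWeight.comp hT.snd, hw₀.comp hT.snd, ?_, hlaw⟩
    filter_upwards [hae] with ω ⟨h1, h2⟩
    refine ⟨h1.2.2.2, h1.1, ?_, fullWeight_pos h1.2.1 h1.2.2.1,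
      originWeight_add_sum_fullWeight (Or.inl rfl) _, h2⟩
    simpa [originWeight] using h1.2.2.1
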